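/- \textbf{Conventions.} For a subset $X$ of a normed space, $[X]$ denotes its closed linear span; products of sets of operators are taken elementwise. A \emph{$C^*$-base} $\mathfrak b=(\mathfrak K,\mathfrak B,\mathfrak B^\dagger)$ is a Hilbert space $\mathfrak K$ with two commuting nondegenerate $C^*$-algebras $\mathfrak B,\mathfrak B^\dagger\subseteq\mathcal L(\mathfrak K)$; put $\mathfrak b^\dagger=(\mathfrak K,\mathfrak B^\dagger,\mathfrak B)$. A \emph{$C^*$-$\mathfrak b$-module} is a pair $H_\alpha=(H,\alpha)$ of a Hilbert space $H$ and a closed subspace $\alpha\subseteq\mathcal L(\mathfrak K,H)$ with $[\alpha\mathfrak K]=H$, $[\alpha\mathfrak B]=\alpha$, $[\alpha^*\alpha]=\mathfrak B$; it carries the representation $\rho_\alpha$ of $\mathfrak B^\dagger$ on $H$ with $\rho_\alpha(b^\dagger)\xi=\xi b^\dagger$ for $\xi\in\alpha$. A \emph{semi-morphism} $H_\alpha\to K_\gamma$ is a $T\in\mathcal L(H,K)$ with $T\alpha\subseteq\gamma$; it is a \emph{morphism} if also $T^*\gamma\subseteq\alpha$. For $C^*$-bases $\mathfrak b_i$, a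 \emph{$C^*$-$(\mathfrak b_1,\dots,\mathfrak b_n)$-module} $(H,\alpha_1,\dots,\alpha_n)$ consists of $C^*$-$\mathfrak b_i$-modules $(H,\alpha_i)$ with $[\rho_{\alpha_i}(\mathfrak B_i^\dagger)\alpha_j]=\alpha_j$ for $i\ne j$; a (semi-)morphism of such modules is a (semi-)morphism for every component. \textbf{Relative tensor product.} For a $C^*$-$\mathfrak b$-module $H_\beta$ and a $C^*$-$\mathfrak b^\dagger$-module $K_\gamma$, let $H\,{}_\beta\!\otimes_\gamma K$ be the Hilbert space generated by elements $\xi\otimes\zeta\otimes\eta$ ($\xi\in\beta$, $\zeta\in\mathfrak K$, $\eta\in\gamma$) with $\langle\xi\otimes\zeta\otimes\eta\,|\,\xi'\otimes\zeta'\otimes\eta'\rangle=\langle\zeta|\xi^*\xi'\eta^*\eta'\zeta'\rangle$. For $\xi\in\beta$, $\eta\in\gamma$ there are operators $|\xi\rangle_1:K\to H\,{}_\beta\!\otimes_\gamma K$ and $|\eta\rangle_2:H\to H\,{}_\beta\!\otimes_\gamma K$ with $|\xi\rangle_1\eta\zeta=\xi\otimes\zeta\otimes\eta=|\eta\rangle_2\xi\zeta$;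 put $\langle\xi|_1=|\xi\rangle_1^*$, $\langle\eta|_2=|\eta\rangle_2^*$, and write $|\beta\rangle_1$, $\langle\gamma|_2$, etc., for the sets of these operators. If $S\in\mathcal L(H,L)$ intertwines $\rho_\beta$ and $\rho_{\beta'}$, then $S\otimes\mathrm{Id}$ is the operator with $(S\otimes\mathrm{Id})|\eta\rangle_2=|\eta\rangle_2S$ for $\eta\in\gamma$; the operators $\mathrm{Id}\otimes T$ are defined likewise through $|\xi\rangle_1$. For further module structures $\alpha$ on $H$ and $\delta$ on $K$, compatible with $\beta$ and $\gamma$ respectively, put $\alpha\triangleleft\gamma=[|\gamma\rangle_2\alpha]$ and $\beta\triangleright\delta=[|\beta\rangle_1\delta]$; these are module structures on $H\,{}_\beta\!\otimes_\gamma K$. Iterated relative tensor products are identified through the canonical associativity isomorphisms. \textbf{$C^*$-pseudo-multiplicative unitaries.} A \emph{$C^*$-pseudo-multiplicative unitary} $(\mathfrak b,H,\hat\beta,\alpha,\beta,V)$ consists of a $C^*$-base $\mathfrak b=(\mathfrak K,\mathfrak B,\mathfrak B^\dagger)$, a $C^*$-$(\mathfrak b^\dagger,\mathfrak b,\mathfrak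 b^\dagger)$-module $(H,\hat\beta,\alpha,\beta)$ and a unitary $V:H\,{}_{\hat\beta}\!\otimes_\alpha H\to H\,{}_\alpha\!\otimes_\beta H$ such that $$V(\alpha\triangleleft\alpha)=\alpha\triangleright\alpha,\quad V(\hat\beta\triangleright\beta)=\hat\beta\triangleleft\beta,\quad V(\hat\beta\triangleright\hat\beta)=\alpha\triangleright\hat\beta,\quad V(\beta\triangleleft\alpha)=\beta\triangleleft\beta$$ and such that the pentagon equation $V_{23}V_{12}=V_{12}V_{13}V_{23}$ holds as an equality of operators from $H\,{}_{\hat\beta}\!\otimes_\alpha H\,{}_{\hat\beta}\!\otimes_\alpha H$ to $H\,{}_\alpha\!\otimes_\beta H\,{}_\alpha\!\otimes_\beta H$; here $V_{12}$, $V_{23}$ stand for $V\otimes\mathrm{Id}$, $\mathrm{Id}\otimes V$ on the appropriate threefold relative tensor products, and $V_{13}=\Sigma_{23}(V\otimes\mathrm{Id})(\mathrm{Id}\otimes\Sigma)$, where $\Sigma$ is the flip and $\Sigma_{23}$ exchanges the second and third tensor factors. Put $$C_V=[\langle\alpha|_1V|\alpha\rangle_2],\qquad \hat A_V=[\langle\beta|_2V|\alpha\rangle_2],\qquad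 A_V=[\langle\alpha|_1V|\hat\beta\rangle_1],$$ all contained in $\mathcal L(H)$, and $$\hat\Delta_V(y)=V^*(\mathrm{Id}\otimes y)V\ \ (y\in\rho_\beta(\mathfrak B)'),\qquad \Delta_V(z)=V(z\otimes\mathrm{Id})V^*\ \ (z\in\rho_{\hat\beta}(\mathfrak B)').$$ $V$ is \emph{semi-regular} if $C_V\supseteq[\alpha\alpha^*]$. \textbf{Hopf $C^*$-bimodules.} Let $\mathfrak c=(\mathfrak K,\mathfrak C,\mathfrak C^\dagger)$ be a $C^*$-base. A \emph{$C^*$-$(\mathfrak c^\dagger,\mathfrak c)$-algebra} $A_H^{\beta,\alpha}$ is a $C^*$-$(\mathfrak c^\dagger,\mathfrak c)$-module $(H,\beta,\alpha)$ together with a (possibly degenerate) $C^*$-algebra $A\subseteq\mathcal L(H)$ such that $\rho_\beta(\mathfrak C)A\subseteq A$ and $\rho_\alpha(\mathfrak C^\dagger)A\subseteq A$. For $C^*$-algebras $A\subseteq\mathcal L(H)$ and $B\subseteq\mathcal L(K)$, where $H_\alpha$ is a $C^*$-$\mathfrak c$-module and $K_\gamma$ a $C^*$-$\mathfrak c^\dagger$-module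 with $\rho_\alpha(\mathfrak C^\dagger)A\subseteq A$ and $\rho_\gamma(\mathfrak C)B\subseteq B$, the \emph{fiber product} $A\,{}_\alpha\!*_\gamma B$ is the $C^*$-algebra of all $x\in\mathcal L(H\,{}_\alpha\!\otimes_\gamma K)$ with $x|\alpha\rangle_1,\ x^*|\alpha\rangle_1\subseteq[|\alpha\rangle_1B]$ and $x|\gamma\rangle_2,\ x^*|\gamma\rangle_2\subseteq[|\gamma\rangle_2A]$. For a $*$-homomorphism $\pi:A\to\mathcal L(L)$ let $\mathcal L^\pi(H,L)=\{T\in\mathcal L(H,L): Ta=\pi(a)T\ \forall a\in A\}$. If $L_\lambda$ is a $C^*$-$\mathfrak c$-module and $\lambda$ is the closed linear span of all $S\xi$ with $\xi\in\alpha$ and $S\in\mathcal L^\pi(H,L)$ a semi-morphism $H_\alpha\to L_\lambda$, then $(\pi*\mathrm{Id})(x)$, for $x\in A\,{}_\alpha\!*_\gamma B$, is the unique operator on $L\,{}_\lambda\!\otimes_\gamma K$ with $(\pi*\mathrm{Id})(x)(S\otimes\mathrm{Id})=(S\otimes\mathrm{Id})x$ for all such $S$. The maps $\mathrm{Id}*\pi$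 are defined likewise. A \emph{normal Hopf $C^*$-bimodule over $\mathfrak c$} is a pair $(A_H^{\beta,\alpha},\Delta)$ of a $C^*$-$(\mathfrak c^\dagger,\mathfrak c)$-algebra and a $*$-homomorphism $\Delta:A\to A\,{}_\alpha\!*_\beta A$ that is (a) jointly normal: if $\mathcal M$ denotes the set of those $S\in\mathcal L^\Delta(H,H\,{}_\alpha\!\otimes_\beta H)$ that are morphisms from $(H,\beta,\alpha)$ to $(H\,{}_\alpha\!\otimes_\beta H,\ \beta\triangleleft\beta,\ \alpha\triangleright\alpha)$, then $[\mathcal M\beta]=\beta\triangleleft\beta$ and $[\mathcal M\alpha]=\alpha\triangleright\alpha$; (b) coassociative: $(\Delta*\mathrm{Id})(\Delta(a))=(\mathrm{Id}*\Delta)(\Delta(a))$ in $\mathcal L(H\,{}_\alpha\!\otimes_\beta H\,{}_\alpha\!\otimes_\beta H)$ for all $a\in A$. \textbf{Theorem.} Let $(\mathfrak b,H,\hat\beta,\alpha,\beta,V)$ be a semi-regular $C^*$-pseudo-multiplicative unitary. Then $\hat A_V\subseteq\rho_\beta(\mathfrak B)'$ and $A_V\subseteq\rho_{\hat\beta}(\mathfrak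 B)'$ are $C^*$-algebras, $\big((\hat A_V)_H^{\alpha,\hat\beta},\hat\Delta_V\big)$ is a normal Hopf $C^*$-bimodule over $\mathfrak b^\dagger$, and $\big((A_V)_H^{\beta,\alpha},\Delta_V\big)$ is a normal Hopf $C^*$-bimodule over $\mathfrak b$ (with $\hat\Delta_V$ and $\Delta_V$ restricted to $\hat A_V$ and $A_V$, respectively). -/

import Mathlib

set_option linter.unusedSectionVars false

namespace CStarPMU

noncomputable section

universe u v w x y

open scoped InnerProduct
open ContinuousLinearMap

/-- The closed linear span `[s]` of a subset `s` of a normed space. -/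
def cspan {E : Type u} [NormedAddCommGroup E] [NormedSpace ℂ E] (s : Set E) : Submodule ℂ E :=
  (Submodule.span ℂ s).topologicalClosure

section cspan

variable {E : Type u} [NormedAddCommGroup E] [NormedSpace ℂ E]
  {F : Type v} [NormedAddCommGroup F] [NormedSpace ℂ F]

theorem isClosed_cspan (s : Set E) : IsClosed (cspan s : Set E) :=
  Submodule.isClosed_topologicalClosure _

theorem subset_cspan (s : Set E) : s ⊆ cspan s := fun _ hx =>
  Submodule.le_topologicalClosure _ (Submodule.subset_span hx)

theorem mem_cspan {s : Set E} {x : E} (hx : x ∈ s) : x ∈ cspan s := subset_cspan s hx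

theorem cspan_le {s : Set E} {N : Submodule ℂ E} (hN : IsClosed (N : Set E)) (h : s ⊆ N) :
    cspan s ≤ N :=
  Submodule.topologicalClosure_minimal _ (Submodule.span_le.2 h) hN

theorem cspan_mono {s t : Set E} (h : s ⊆ t) : cspan s ≤ cspan t :=
  cspan_le (isClosed_cspan t) (h.trans (subset_cspan t))

/-- A continuous (conjugate-)linear map that sends `s` into a closed subspace also sends
`[s]` there. -/
theorem map_mem_of_mem_cspan {σ : ℂ →+* ℂ} [RingHomSurjective σ] (L : E →SL[σ] F) {s : Set E}
    {N : Submodule ℂ F} (hN : IsClosed (N : Set F)) (h : ∀ x ∈ s, L x ∈ N) {x : E}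
    (hx : x ∈ cspan s) : L x ∈ N := by
  have : cspan s ≤ N.comap (L : E →ₛₗ[σ] F) :=
    cspan_le (hN.preimage L.continuous) (fun x hx => h x hx)
  exact this hx

end cspan

/-- The bounded operator `R` that is determined by `R ∘ f i = g i` for all `i` (and `0` if there
is none). It is only used for families `f` whose ranges span a dense subspace, so that `R` is
unique, and for which `R` exists. -/
def extendFam {ι : Type w} {V : Type u} {T : Type v} {T' : Type x}
    [NormedAddCommGroup V] [InnerProductSpace ℂ V]
    [NormedAddCommGroup T] [InnerProductSpace ℂ T]
    [NormedAddCommGroup T'] [InnerProductSpace ℂ T']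
    (f : ι → V →L[ℂ] T) (g : ι → V →L[ℂ] T') : T →L[ℂ] T' :=
  open Classical in if h : ∃ R : T →L[ℂ] T', ∀ i, R ∘L f i = g i then h.choose else 0

section extend

variable {ι : Type w} {V : Type u} {T : Type v} {T' : Type x} {W : Type y}
  [NormedAddCommGroup V] [InnerProductSpace ℂ V] [CompleteSpace V]
  [NormedAddCommGroup T] [InnerProductSpace ℂ T] [CompleteSpace T]
  [NormedAddCommGroup T'] [InnerProductSpace ℂ T'] [CompleteSpace T']
  [NormedAddCommGroup W] [InnerProductSpace ℂ W] [CompleteSpace W]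

theorem extendFam_comp_of_exists {f : ι → V →L[ℂ] T} {g : ι → V →L[ℂ] T'}
    (h : ∃ R : T →L[ℂ] T', ∀ i, R ∘L f i = g i) (i : ι) : extendFam f g ∘L f i = g i := by
  rw [extendFam, dif_pos h]
  exact h.choose_spec i

open scoped ComplexOrder in
theorem sum_norm_sq_le (f : ι → V →L[ℂ] T) (g : ι → V →L[ℂ] T') (S : V →L[ℂ] W)
    (h : ∀ i j, (g i)† ∘L g j = (S† ∘L S) ∘L ((f i)† ∘L f j)) (s : Finset ι) (z : ι → V) :
    ‖∑ i ∈ s, g i (z i)‖ ≤ ‖S‖ * ‖∑ i ∈ s, f i (z i)‖ := by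
  set P : V →L[ℂ] V := S† ∘L S with hP
  set Q : V →L[ℂ] V := ((‖S‖ ^ 2 : ℝ) : ℂ) • 1 - P with hQ
  have hcomm : ∀ i j, Commute P ((f i)† ∘L f j) := by
    intro i j
    have h1 := congrArg ContinuousLinearMap.adjoint (h j i)
    simp only [adjoint_comp, adjoint_adjoint, hP] at h1
    have h2 := h i j
    show (S† ∘L S) ∘L _ = _ ∘L (S† ∘L S)
    rw [← h2, h1]
  have hQpos : 0 ≤ Q := by
    rw [ContinuousLinearMap.nonneg_iff_isPositive, ContinuousLinearMap.isPositive_def']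
    refine ⟨?_, fun v => ?_⟩
    · rw [IsSelfAdjoint, hQ, hP, star_sub, star_smul]
      simp [star_eq_adjoint, adjoint_comp]
    · have : ‖S v‖ ^ 2 ≤ ‖S‖ ^ 2 * ‖v‖ ^ 2 := by
        rw [← mul_pow]; gcongr; exact S.le_opNorm v
      have hv : Q v = ((‖S‖ ^ 2 : ℝ) : ℂ) • v - (S†) (S v) := rfl
      rw [reApplyInnerSelf_apply, hv, inner_sub_left, adjoint_inner_left, inner_smul_left,
        Complex.conj_ofReal, map_sub, inner_self_eq_norm_sq]
      show 0 ≤ (((‖S‖ ^ 2 : ℝ) : ℂ) * inner ℂ v v).re - ‖S v‖ ^ 2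
      have h3 : (inner ℂ v v).re = ‖v‖ ^ 2 := inner_self_eq_norm_sq (𝕜 := ℂ) v
      rw [Complex.re_ofReal_mul, h3]
      linarith
  set q := CFC.sqrt Q
  have hqq : q * q = Q := CFC.sqrt_mul_sqrt_self Q hQpos
  have hqs : q† = q := (CFC.sqrt_nonneg Q).isSelfAdjoint
  have hqc : ∀ i j, Commute q ((f i)† ∘L f j) := fun i j => by
    have : Commute Q ((f i)† ∘L f j) :=
      Commute.sub_left ((Commute.one_left _).smul_left _) (hcomm i j)
    exact Commute.cfcₙ_nnreal this _
  have key : ((‖S‖ ^ 2 : ℝ) : ℂ) * inner ℂ (∑ i ∈ s, f i (z i)) (∑ i ∈ s, f i (z i))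
      - inner ℂ (∑ i ∈ s, g i (z i)) (∑ i ∈ s, g i (z i))
      = inner ℂ (∑ i ∈ s, f i (q (z i))) (∑ i ∈ s, f i (q (z i))) := by
    simp only [sum_inner, inner_sum, Finset.mul_sum, ← Finset.sum_sub_distrib]
    refine Finset.sum_congr rfl fun i _ => Finset.sum_congr rfl fun j _ => ?_
    have e1 : inner ℂ (f j (q (z j))) (f i (q (z i)))
        = inner ℂ (z j) ((q * (((f j)† ∘L f i) * q)) (z i)) := by
      rw [mul_apply_eq_comp, mul_apply_eq_comp, ← adjoint_inner_left q, hqs, comp_apply,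
        adjoint_inner_right]
    have e2 : q * (((f j)† ∘L f i) * q) = Q * ((f j)† ∘L f i) := by
      rw [← (hqc j i).eq, ← mul_assoc, hqq]
    have e3 : inner ℂ (g j (z j)) (g i (z i)) = inner ℂ (z j) ((P * ((f j)† ∘L f i)) (z i)) := by
      rw [← adjoint_inner_right, ← comp_apply, h j i]; rfl
    have e4 : inner ℂ (f j (z j)) (f i (z i)) = inner ℂ (z j) (((f j)† ∘L f i) (z i)) := by
      rw [comp_apply, adjoint_inner_right]
    rw [e1, e2, e3, e4, hQ, sub_mul, sub_apply, inner_sub_right, smul_mul_assoc, one_mul,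
      smul_apply, inner_smul_right]
  have key2 := congrArg Complex.re key
  rw [Complex.sub_re, Complex.re_ofReal_mul] at key2
  have n1 : (inner ℂ (∑ i ∈ s, f i (z i)) (∑ i ∈ s, f i (z i))).re
      = ‖∑ i ∈ s, f i (z i)‖ ^ 2 := inner_self_eq_norm_sq (𝕜 := ℂ) _
  have n2 : (inner ℂ (∑ i ∈ s, g i (z i)) (∑ i ∈ s, g i (z i))).re
      = ‖∑ i ∈ s, g i (z i)‖ ^ 2 := inner_self_eq_norm_sq (𝕜 := ℂ) _
  have n3 : 0 ≤ (inner ℂ (∑ i ∈ s, f i (q (z i))) (∑ i ∈ s, f i (q (z i)))).re :=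
    inner_self_nonneg (𝕜 := ℂ)
  rw [n1, n2] at key2
  refine (sq_le_sq₀ (norm_nonneg _) (by positivity)).1 ?_
  rw [mul_pow]
  linarith

/-- The basic existence result for `extendFam`. -/
theorem exists_extendFam (f : ι → V →L[ℂ] T) (g : ι → V →L[ℂ] T') (S : V →L[ℂ] W)
    (hf : cspan {t : T | ∃ i z, f i z = t} = ⊤)
    (h : ∀ i j, (g i)† ∘L g j = (S† ∘L S) ∘L ((f i)† ∘L f j)) :
    ∃ R : T →L[ℂ] T', (∀ i, R ∘L f i = g i) ∧ ‖R‖ ≤ ‖S‖ := by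
  let F : (ι →₀ V) →ₗ[ℂ] T := Finsupp.lsum ℂ fun i => (f i : V →ₗ[ℂ] T)
  let G : (ι →₀ V) →ₗ[ℂ] T' := Finsupp.lsum ℂ fun i => (g i : V →ₗ[ℂ] T')
  have hn : ∀ x, ‖G x‖ ≤ ‖S‖ * ‖F x‖ := fun x => sum_norm_sq_le f g S h x.support x
  have hd : DenseRange F := by
    have h1 : cspan {t : T | ∃ i z, f i z = t} ≤ (LinearMap.range F).topologicalClosure := by
      refine cspan_le (Submodule.isClosed_topologicalClosure _) ?_
      rintro _ ⟨i, z, rfl⟩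
      refine Submodule.le_topologicalClosure _ ⟨Finsupp.single i z, ?_⟩
      simp [F]
    rw [hf, top_le_iff] at h1
    have h2 := Submodule.dense_iff_topologicalClosure_eq_top.2 h1
    simpa [DenseRange, LinearMap.coe_range] using h2
  refine ⟨G.extendOfNorm F, fun i => ?_,
    LinearMap.opNorm_extendOfNorm_le hd (norm_nonneg S) hn⟩
  ext z
  have := LinearMap.extendOfNorm_eq (f := G) (e := F) hd ⟨_, hn⟩ (Finsupp.single i z)
  simpa [F, G] using this

theorem eq_of_comp_eq {f : ι → V →L[ℂ] T} (hf : cspan {t : T | ∃ i z, f i z = t} = ⊤)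
    {R R' : T →L[ℂ] T'} (h : ∀ i, R ∘L f i = R' ∘L f i) : R = R' := by
  have h1 : cspan {t : T | ∃ i z, f i z = t} ≤ LinearMap.ker ((R - R' : T →L[ℂ] T') : T →ₗ[ℂ] T') := by
    refine cspan_le (ContinuousLinearMap.isClosed_ker (R - R')) ?_
    rintro _ ⟨i, z, rfl⟩
    have := DFunLike.congr_fun (h i) z
    simpa [sub_eq_zero] using this
  ext t
  have : t ∈ LinearMap.ker ((R - R' : T →L[ℂ] T') : T →ₗ[ℂ] T') := h1 (hf ▸ Submodule.mem_top)
  simpa [sub_eq_zero] using this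

theorem ext_inner_total {f : ι → V →L[ℂ] T} (hf : cspan {t : T | ∃ i z, f i z = t} = ⊤)
    {y y' : T} (h : ∀ i z, inner ℂ (f i z) y = inner ℂ (f i z) y') : y = y' := by
  have h0 : innerSL ℂ y = innerSL ℂ y' := by
    refine eq_of_comp_eq hf fun i => ContinuousLinearMap.ext fun z => ?_
    have := congrArg (starRingEnd ℂ) (h i z)
    simpa [inner_conj_symm] using this
  exact innerSL_inj.1 h0

/-- The defining property of `extendFam`, under the condition that is met in all its uses. -/
theorem extendFam_comp (f : ι → V →L[ℂ] T) (g : ι → V →L[ℂ] T') (S : V →L[ℂ] W)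
    (hf : cspan {t : T | ∃ i z, f i z = t} = ⊤)
    (h : ∀ i j, (g i)† ∘L g j = (S† ∘L S) ∘L ((f i)† ∘L f j)) (i : ι) :
    extendFam f g ∘L f i = g i :=
  extendFam_comp_of_exists (let ⟨R, h1, _⟩ := exists_extendFam f g S hf h; ⟨R, h1⟩) i

theorem norm_extendFam_le (f : ι → V →L[ℂ] T) (g : ι → V →L[ℂ] T') (S : V →L[ℂ] W)
    (hf : cspan {t : T | ∃ i z, f i z = t} = ⊤)
    (h : ∀ i j, (g i)† ∘L g j = (S† ∘L S) ∘L ((f i)† ∘L f j)) : ‖extendFam f g‖ ≤ ‖S‖ := by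
  obtain ⟨R, h1, h2⟩ := exists_extendFam f g S hf h
  have : extendFam f g = R :=
    eq_of_comp_eq hf fun i => (extendFam_comp f g S hf h i).trans (h1 i).symm
  rwa [this]

end extend


/-- Positivity of the kernel `(ξ_i)† ξ_j (η_i)† η_j` when the operators `(ξ_i)† ξ_j` commute with
the operators `(η_i)† η_j`. -/
theorem kernel_nonneg {𝔎 : Type u} {H : Type v} {K : Type w} {ι : Type x}
    [NormedAddCommGroup 𝔎] [InnerProductSpace ℂ 𝔎] [CompleteSpace 𝔎]
    [NormedAddCommGroup H] [InnerProductSpace ℂ H] [CompleteSpace H]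
    [NormedAddCommGroup K] [InnerProductSpace ℂ K] [CompleteSpace K]
    [Fintype ι] [DecidableEq ι]
    (ξ : ι → 𝔎 →L[ℂ] H) (η : ι → 𝔎 →L[ℂ] K)
    (hc : ∀ i j k l, Commute ((ξ i)† ∘L ξ j) ((η k)† ∘L η l)) (z : ι → 𝔎) :
    0 ≤ (∑ i, ∑ j, inner ℂ (z i) (((ξ i)† ∘L ξ j ∘L (η i)† ∘L η j) (z j))).re := by
  let E := PiLp 2 (fun _ : ι => 𝔎)
  let p : ι → E →L[ℂ] 𝔎 := fun i => PiLp.proj 2 (fun _ : ι => 𝔎) i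
  let e : ι → 𝔎 →L[ℂ] E := fun i => (p i)†
  have he : ∀ i a, e i a = PiLp.single 2 i a := by
    intro i a
    refine ext_inner_right ℂ fun v => ?_
    have h1 : inner ℂ (e i a) v = inner ℂ a (v i) := adjoint_inner_left _ _ _
    rw [h1, PiLp.inner_apply, Finset.sum_eq_single i]
    · simp
    · intro j _ hj
      simp [hj]
    · simp
  have hpe : ∀ k i a, p k (e i a) = if k = i then a else 0 := by
    intro k i a
    rw [he]
    show (PiLp.single 2 i a : E) k = _
    by_cases h : k = i
    · subst h; simp
    · simp [h]
  let T : E →L[ℂ] H := ∑ i, ξ i ∘L p i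
  have hTv : ∀ v, T v = ∑ i, ξ i (p i v) := fun v => by simp [T]
  have hTe : ∀ i a, T (e i a) = ξ i a := by
    intro i a
    rw [hTv, Finset.sum_eq_single i]
    · rw [hpe, if_pos rfl]
    · intro j _ hj
      rw [hpe, if_neg hj, map_zero]
    · simp
  have hpT : ∀ k a, p k ((T†) a) = ((ξ k)†) a := by
    intro k a
    refine ext_inner_left ℂ fun b => ?_
    rw [← adjoint_inner_left, adjoint_inner_right, adjoint_inner_right]
    exact congrArg (fun t => inner ℂ t a) (hTe k b)
  let D : (𝔎 →L[ℂ] 𝔎) → (E →L[ℂ] E) := fun c => ∑ i, e i ∘L c ∘L p i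
  have hDv : ∀ c v k, p k (D c v) = c (p k v) := by
    intro c v k
    have : D c v = ∑ i, e i (c (p i v)) := by simp [D]
    rw [this, map_sum, Finset.sum_eq_single k]
    · rw [hpe, if_pos rfl]
    · intro j _ hj
      rw [hpe, if_neg hj.symm]
    · simp
  have hext : ∀ a b : E, (∀ k, p k a = p k b) → a = b := fun a b h => PiLp.ext h
  have hDe : ∀ c j a, D c (e j a) = e j (c a) := by
    intro c j a
    refine hext _ _ fun k => ?_
    rw [hDv, hpe, hpe]
    split_ifs <;> simp
  let X : E →L[ℂ] E := T† ∘L T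
  have hX : 0 ≤ X := by
    rw [ContinuousLinearMap.nonneg_iff_isPositive]
    exact isPositive_adjoint_comp_self T
  have hXD : ∀ c, (∀ i j, Commute ((ξ i)† ∘L ξ j) c) → Commute X (D c) := by
    intro c h
    refine ContinuousLinearMap.ext fun v => hext _ _ fun k => ?_
    show p k ((T†) (T (D c v))) = p k (D c ((T†) (T v)))
    rw [hDv, hpT, hpT, hTv, hTv, map_sum, map_sum, map_sum]
    refine Finset.sum_congr rfl fun j _ => ?_
    rw [hDv]
    exact DFunLike.congr_fun (h k j).eq (p j v)
  let S : E →L[ℂ] E := CFC.sqrt X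
  have hSS : S * S = X := CFC.sqrt_mul_sqrt_self X hX
  have hSs : S† = S := (CFC.sqrt_nonneg X).isSelfAdjoint
  have hSD : ∀ c, (∀ i j, Commute ((ξ i)† ∘L ξ j) c) → Commute S (D c) := fun c h =>
    Commute.cfcₙ_nnreal (hXD c h) _
  have hterm : ∀ i j, inner ℂ (z i) (((ξ i)† ∘L ξ j ∘L (η i)† ∘L η j) (z j))
      = ∑ k, inner ℂ (η i (p k (S (e i (z i))))) (η j (p k (S (e j (z j))))) := by
    intro i j
    set N := (η i)† ∘L η j with hN
    have h1 : inner ℂ (z i) (((ξ i)† ∘L ξ j ∘L (η i)† ∘L η j) (z j))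
        = inner ℂ (e i (z i)) (X (e j (N (z j)))) := by
      show inner ℂ (z i) (((ξ i)†) (ξ j (N (z j)))) = inner ℂ (e i (z i)) ((T†) (T (e j (N (z j)))))
      rw [adjoint_inner_right, adjoint_inner_right, hTe, hTe]
    have h2 : X (e j (N (z j))) = (S†) (D N (S (e j (z j)))) := by
      rw [← hDe, hSs, ← hSS]
      exact congrArg S (DFunLike.congr_fun (hSD N fun a b => hc a b i j).eq (e j (z j)))
    rw [h1, h2, adjoint_inner_right, PiLp.inner_apply]
    refine Finset.sum_congr rfl fun k _ => ?_
    have h3 : (D N (S (e j (z j)))) k = N (p k (S (e j (z j)))) := hDv _ _ _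
    rw [h3, hN, comp_apply, adjoint_inner_right]
    rfl
  have hsum : ∑ i, ∑ j, inner ℂ (z i) (((ξ i)† ∘L ξ j ∘L (η i)† ∘L η j) (z j))
      = ∑ k, inner ℂ (∑ i, η i (p k (S (e i (z i))))) (∑ i, η i (p k (S (e i (z i))))) := by
    simp only [hterm, sum_inner, inner_sum]
    rw [Finset.sum_comm]
    conv_lhs => enter [2, j]; rw [Finset.sum_comm]
    rw [Finset.sum_comm]
  rw [hsum, Complex.re_sum]
  exact Finset.sum_nonneg fun k _ => inner_self_nonneg (𝕜 := ℂ)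


/-- A `C*`-base on the Hilbert space `𝔎`: two commuting nondegenerate `C*`-algebras
`𝔅 = alg` and `𝔅† = dual` of operators on `𝔎`. -/
structure CStarBase (𝔎 : Type u) [NormedAddCommGroup 𝔎] [InnerProductSpace ℂ 𝔎]
    [CompleteSpace 𝔎] where
  alg : NonUnitalStarSubalgebra ℂ (𝔎 →L[ℂ] 𝔎)
  dual : NonUnitalStarSubalgebra ℂ (𝔎 →L[ℂ] 𝔎)
  isClosed_alg : IsClosed (alg : Set (𝔎 →L[ℂ] 𝔎))
  isClosed_dual : IsClosed (dual : Set (𝔎 →L[ℂ] 𝔎))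
  commute : ∀ b ∈ alg, ∀ c ∈ dual, Commute b c
  nondegenerate_alg : cspan {z : 𝔎 | ∃ b ∈ alg, ∃ ζ, b ζ = z} = ⊤
  nondegenerate_dual : cspan {z : 𝔎 | ∃ c ∈ dual, ∃ ζ, c ζ = z} = ⊤

/-- The opposite `C*`-base `𝔟† = (𝔎, 𝔅†, 𝔅)`. -/
abbrev CStarBase.op {𝔎 : Type u} [NormedAddCommGroup 𝔎] [InnerProductSpace ℂ 𝔎]
    [CompleteSpace 𝔎] (b : CStarBase 𝔎) : CStarBase 𝔎 where
  alg := b.dual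
  dual := b.alg
  isClosed_alg := b.isClosed_dual
  isClosed_dual := b.isClosed_alg
  commute c hc d hd := (b.commute d hd c hc).symm
  nondegenerate_alg := b.nondegenerate_dual
  nondegenerate_dual := b.nondegenerate_alg

/-- For a `C*`-base `𝔟 = (𝔎, 𝔅, 𝔅†)`, a closed subspace `α = space` of `L(𝔎, H)` that makes
`(H, α)` a `C*`-`𝔟`-module: `[α 𝔎] = H`, `[α 𝔅] = α` and `[α* α] = 𝔅`. -/
structure BaseModule {𝔎 : Type u} [NormedAddCommGroup 𝔎] [InnerProductSpace ℂ 𝔎]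
    [CompleteSpace 𝔎] (b : CStarBase 𝔎) (H : Type v) [NormedAddCommGroup H]
    [InnerProductSpace ℂ H] [CompleteSpace H] where
  space : Submodule ℂ (𝔎 →L[ℂ] H)
  isClosed_space : IsClosed (space : Set (𝔎 →L[ℂ] H))
  total : cspan {x : H | ∃ ξ ∈ space, ∃ ζ, ξ ζ = x} = ⊤
  right_mul : cspan {T : 𝔎 →L[ℂ] H | ∃ ξ ∈ space, ∃ d ∈ b.alg, ξ ∘L d = T} = space
  inner_eq : (cspan {T : 𝔎 →L[ℂ] 𝔎 | ∃ ξ ∈ space, ∃ ξ' ∈ space, ξ† ∘L ξ' = T} :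
    Set (𝔎 →L[ℂ] 𝔎)) = (b.alg : Set (𝔎 →L[ℂ] 𝔎))

section BaseModule

variable {𝔎 : Type u} [NormedAddCommGroup 𝔎] [InnerProductSpace ℂ 𝔎] [CompleteSpace 𝔎]
  {b : CStarBase 𝔎}
  {H : Type v} [NormedAddCommGroup H] [InnerProductSpace ℂ H] [CompleteSpace H]

theorem BaseModule.inner_mem (α : BaseModule b H) {ξ ξ' : 𝔎 →L[ℂ] H} (h : ξ ∈ α.space)
    (h' : ξ' ∈ α.space) : ξ† ∘L ξ' ∈ b.alg := by
  rw [← SetLike.mem_coe, ← α.inner_eq]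
  exact mem_cspan ⟨ξ, h, ξ', h', rfl⟩

theorem BaseModule.total' (α : BaseModule b H) :
    cspan {x : H | ∃ (ξ : α.space) (ζ : 𝔎), (ξ : 𝔎 →L[ℂ] H) ζ = x} = ⊤ := by
  rw [← α.total]
  congr 1
  ext x
  simp

/-- The representation `ρ_α` of `𝔅†` on `H`, determined by `ρ_α(c) ξ = ξ c` for all `ξ ∈ α`. -/
def BaseModule.rho (α : BaseModule b H) (c : 𝔎 →L[ℂ] 𝔎) : H →L[ℂ] H :=
  extendFam (fun ξ : α.space => (ξ : 𝔎 →L[ℂ] H)) (fun ξ : α.space => (ξ : 𝔎 →L[ℂ] H) ∘L c)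

theorem BaseModule.rho_comp (α : BaseModule b H) {c : 𝔎 →L[ℂ] 𝔎} (hc : c ∈ b.dual)
    {ξ : 𝔎 →L[ℂ] H} (hξ : ξ ∈ α.space) : α.rho c ∘L ξ = ξ ∘L c := by
  refine extendFam_comp (fun ξ : α.space => (ξ : 𝔎 →L[ℂ] H))
    (fun ξ : α.space => (ξ : 𝔎 →L[ℂ] H) ∘L c) c α.total' ?_ ⟨ξ, hξ⟩
  intro i j
  have h : _ * _ = _ * _ := b.commute _ (α.inner_mem i.2 j.2) c hc
  rw [adjoint_comp]
  ext z
  exact congrArg (c†) (DFunLike.congr_fun h z)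

end BaseModule

/-! ### The relative tensor product -/

section RTP

variable {𝔎 : Type u} [NormedAddCommGroup 𝔎] [InnerProductSpace ℂ 𝔎] [CompleteSpace 𝔎]
  {b : CStarBase 𝔎}
  {H : Type v} [NormedAddCommGroup H] [InnerProductSpace ℂ H] [CompleteSpace H]
  {K : Type w} [NormedAddCommGroup K] [InnerProductSpace ℂ K] [CompleteSpace K]

/-- The operator-valued kernel `((ξ, η), (ξ', η')) ↦ ξ* ξ' η* η'` on `β × γ`. -/
def rtpKernel (β : BaseModule b H) (γ : BaseModule b.op K) :
    Matrix (β.space × γ.space) (β.space × γ.space) (𝔎 →L[ℂ] 𝔎) :=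
  Matrix.of fun x y => (x.1 : 𝔎 →L[ℂ] H)† ∘L (y.1 : 𝔎 →L[ℂ] H) ∘L
    (x.2 : 𝔎 →L[ℂ] K)† ∘L (y.2 : 𝔎 →L[ℂ] K)

open scoped ComplexOrder in
instance rtpKernel_posSemidef (β : BaseModule b H) (γ : BaseModule b.op K) :
    Fact (rtpKernel β γ).PosSemidef := by
  refine ⟨?_⟩
  have tf := RKHS.posSemidef_tfae (K := rtpKernel β γ)
  have e := tf.out 0 2
  rw [e]
  refine ⟨?_, fun vv => ?_⟩
  · ext1 x y
    have h : _ * _ = _ * _ :=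
      b.commute _ (β.inner_mem x.1.2 y.1.2) _ (γ.inner_mem x.2.2 y.2.2)
    rw [Matrix.conjTranspose_apply]
    show ((y.1 : 𝔎 →L[ℂ] H)† ∘L (x.1 : 𝔎 →L[ℂ] H) ∘L (y.2 : 𝔎 →L[ℂ] K)† ∘L
      (x.2 : 𝔎 →L[ℂ] K))† = _
    simp only [adjoint_comp, adjoint_adjoint]
    exact h.symm
  · classical
    have h := kernel_nonneg (fun x : vv.support => (x.1.1 : 𝔎 →L[ℂ] H))
      (fun x : vv.support => (x.1.2 : 𝔎 →L[ℂ] K))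
      (fun i j k l => b.commute _ (β.inner_mem i.1.1.2 j.1.1.2) _
        (BaseModule.inner_mem (b := b.op) γ k.1.2.2 l.1.2.2)) (fun x => vv x.1)
    rw [← Complex.conj_re] at h
    simp only [map_sum, inner_conj_symm] at h
    rw [Finset.sum_comm] at h
    simp only [Finsupp.sum]
    rw [← Finset.sum_attach]
    refine h.trans_eq (congrArg Complex.re (Finset.sum_congr rfl fun x _ => ?_))
    rw [← Finset.sum_attach vv.support]
    rfl

/-- The relative tensor product `H ⊗ K` of the `C*`-`𝔟`-module `(H, β)` and the
`C*`-`𝔟†`-module `(K, γ)`: the Hilbert space generated by the elements `ξ ⊗ ζ ⊗ η`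
(`ξ ∈ β`, `ζ ∈ 𝔎`, `η ∈ γ`) with inner product
`⟨ξ ⊗ ζ ⊗ η | ξ' ⊗ ζ' ⊗ η'⟩ = ⟨ζ | ξ* ξ' η* η' ζ'⟩`, that is, the Kolmogorov decomposition
of the kernel `rtpKernel β γ`. -/
def RTP (β : BaseModule b H) (γ : BaseModule b.op K) : Type (max u v w) :=
  RKHS.OfKernel (rtpKernel β γ)

instance (β : BaseModule b H) (γ : BaseModule b.op K) : NormedAddCommGroup (RTP β γ) :=
  inferInstanceAs (NormedAddCommGroup (RKHS.OfKernel (rtpKernel β γ)))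

instance (β : BaseModule b H) (γ : BaseModule b.op K) : InnerProductSpace ℂ (RTP β γ) :=
  inferInstanceAs (InnerProductSpace ℂ (RKHS.OfKernel (rtpKernel β γ)))

instance (β : BaseModule b H) (γ : BaseModule b.op K) : CompleteSpace (RTP β γ) :=
  inferInstanceAs (CompleteSpace (RKHS.OfKernel (rtpKernel β γ)))

/-- The operator `ζ ↦ ξ ⊗ ζ ⊗ η` from `𝔎` to `H ⊗ K`. -/
def tmul (β : BaseModule b H) (γ : BaseModule b.op K) (ξ : β.space) (η : γ.space) :
    𝔎 →L[ℂ] RTP β γ :=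
  RKHS.kerFun (RKHS.OfKernel (rtpKernel β γ)) (ξ, η)

theorem tmul_adjoint_comp_tmul (β : BaseModule b H) (γ : BaseModule b.op K) (ξ ξ' : β.space)
    (η η' : γ.space) : (tmul β γ ξ η)† ∘L tmul β γ ξ' η' =
      (ξ : 𝔎 →L[ℂ] H)† ∘L (ξ' : 𝔎 →L[ℂ] H) ∘L (η : 𝔎 →L[ℂ] K)† ∘L (η' : 𝔎 →L[ℂ] K) := by
  have h1 := RKHS.kernel_apply (RKHS.OfKernel (rtpKernel β γ)) (ξ, η) (ξ', η')
  rw [RKHS.OfKernel.kernel_ofKernel] at h1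
  exact h1.symm

theorem inner_tmul (β : BaseModule b H) (γ : BaseModule b.op K) (ξ ξ' : β.space)
    (η η' : γ.space) (ζ ζ' : 𝔎) :
    inner ℂ (tmul β γ ξ η ζ) (tmul β γ ξ' η' ζ') =
      inner ℂ ζ (((ξ : 𝔎 →L[ℂ] H)† ∘L (ξ' : 𝔎 →L[ℂ] H) ∘L
        (η : 𝔎 →L[ℂ] K)† ∘L (η' : 𝔎 →L[ℂ] K)) ζ') := by
  rw [← tmul_adjoint_comp_tmul, comp_apply, adjoint_inner_right]

theorem tmul_total (β : BaseModule b H) (γ : BaseModule b.op K) :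
    cspan {t : RTP β γ | ∃ (p : β.space × γ.space) (ζ : 𝔎), tmul β γ p.1 p.2 ζ = t} = ⊤ :=
  RKHS.kerFun_dense (H := RKHS.OfKernel (rtpKernel β γ))

end RTP


section rho

variable {𝔎 : Type u} [NormedAddCommGroup 𝔎] [InnerProductSpace ℂ 𝔎] [CompleteSpace 𝔎]
  {b : CStarBase 𝔎}
  {𝔎' : Type x} [NormedAddCommGroup 𝔎'] [InnerProductSpace ℂ 𝔎'] [CompleteSpace 𝔎']
  {a : CStarBase 𝔎'}
  {H : Type v} [NormedAddCommGroup H] [InnerProductSpace ℂ H] [CompleteSpace H]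
  {K : Type w} [NormedAddCommGroup K] [InnerProductSpace ℂ K] [CompleteSpace K]

theorem BaseModule.rho_unique (α : BaseModule b H) {c : 𝔎 →L[ℂ] 𝔎} (hc : c ∈ b.dual)
    {R : H →L[ℂ] H} (h : ∀ ξ ∈ α.space, R ∘L ξ = ξ ∘L c) : α.rho c = R :=
  eq_of_comp_eq α.total' fun ξ => (α.rho_comp hc ξ.2).trans (h ξ ξ.2).symm

theorem BaseModule.norm_rho_le (α : BaseModule b H) {c : 𝔎 →L[ℂ] 𝔎} (hc : c ∈ b.dual) :
    ‖α.rho c‖ ≤ ‖c‖ := by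
  refine norm_extendFam_le _ _ c α.total' ?_
  intro i j
  have h : _ * _ = _ * _ := b.commute _ (α.inner_mem i.2 j.2) c hc
  rw [adjoint_comp]
  ext z
  exact congrArg (c†) (DFunLike.congr_fun h z)

theorem BaseModule.rho_add (α : BaseModule b H) {c d : 𝔎 →L[ℂ] 𝔎} (hc : c ∈ b.dual)
    (hd : d ∈ b.dual) : α.rho (c + d) = α.rho c + α.rho d :=
  α.rho_unique (add_mem hc hd) fun ξ hξ => by
    rw [add_comp, comp_add, α.rho_comp hc hξ, α.rho_comp hd hξ]

theorem BaseModule.rho_smul (α : BaseModule b H) (r : ℂ) {c : 𝔎 →L[ℂ] 𝔎} (hc : c ∈ b.dual) :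
    α.rho (r • c) = r • α.rho c :=
  α.rho_unique (SMulMemClass.smul_mem r hc) fun ξ hξ => by
    rw [smul_comp, comp_smul, α.rho_comp hc hξ]

/-- The condition `[ρ_β(𝔅†) α] = α` for two module structures on the same Hilbert space. -/
def BaseModule.Preserves (β : BaseModule b H) (α : BaseModule a H) : Prop :=
  cspan {T : 𝔎' →L[ℂ] H | ∃ c ∈ b.dual, ∃ ξ ∈ α.space, β.rho c ∘L ξ = T} = α.space

theorem BaseModule.Preserves.mem {β : BaseModule b H} {α : BaseModule a H} (h : β.Preserves α)
    {c : 𝔎 →L[ℂ] 𝔎} (hc : c ∈ b.dual) {ξ : 𝔎' →L[ℂ] H} (hξ : ξ ∈ α.space) :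
    β.rho c ∘L ξ ∈ α.space := by
  have h1 : cspan _ = α.space := h
  rw [← h1]
  exact mem_cspan ⟨c, hc, ξ, hξ, rfl⟩

theorem BaseModule.Preserves.rho_comm {β : BaseModule b H} {α : BaseModule a H}
    (h : β.Preserves α) {c : 𝔎 →L[ℂ] 𝔎} (hc : c ∈ b.dual) {d : 𝔎' →L[ℂ] 𝔎'} (hd : d ∈ a.dual) :
    β.rho c ∘L α.rho d = α.rho d ∘L β.rho c := by
  refine eq_of_comp_eq α.total' fun ξ => ?_
  rw [comp_assoc, α.rho_comp hd ξ.2, comp_assoc, α.rho_comp hd (h.mem hc ξ.2), comp_assoc]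

/-- If `T` is spanned by the ranges of operators `κ j : H → T` such that the operators
`(κ i)* (κ j)` act nondegenerately on `α`, then `[κ α]` turns `T` into a `C*`-module. -/
def BaseModule.push {ι : Type y} (α : BaseModule a H) (κ : ι → H →L[ℂ] K)
    (htot : cspan {t : K | ∃ i x, κ i x = t} = ⊤)
    (hsub : ∀ i j, ∀ ξ ∈ α.space, ((κ i)† ∘L κ j) ∘L ξ ∈ α.space)
    (hsup : α.space ≤ cspan {T : 𝔎' →L[ℂ] H | ∃ i j, ∃ ξ ∈ α.space, ((κ i)† ∘L κ j) ∘L ξ = T}) :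
    BaseModule a K where
  space := cspan {T : 𝔎' →L[ℂ] K | ∃ i, ∃ ξ ∈ α.space, κ i ∘L ξ = T}
  isClosed_space := isClosed_cspan _
  total := by
    rw [← top_le_iff, ← htot]
    refine cspan_le (isClosed_cspan _) ?_
    rintro _ ⟨i, x, rfl⟩
    have hx : x ∈ cspan {x : H | ∃ ξ ∈ α.space, ∃ ζ, ξ ζ = x} := α.total ▸ Submodule.mem_top
    refine map_mem_of_mem_cspan (κ i) (isClosed_cspan _) ?_ hx
    rintro _ ⟨ξ, hξ, ζ, rfl⟩
    exact mem_cspan ⟨κ i ∘L ξ, mem_cspan ⟨i, ξ, hξ, rfl⟩, ζ, rfl⟩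
  right_mul := by
    refine le_antisymm (cspan_le (isClosed_cspan _) ?_) (cspan_le (isClosed_cspan _) ?_)
    · rintro _ ⟨x, hx, d, hd, rfl⟩
      refine map_mem_of_mem_cspan ((compL ℂ 𝔎' 𝔎' K).flip d) (isClosed_cspan _) ?_ hx
      rintro _ ⟨i, ξ, hξ, rfl⟩
      refine mem_cspan ⟨i, ξ ∘L d, ?_, rfl⟩
      have h1 := α.right_mul
      rw [← h1]
      exact mem_cspan ⟨ξ, hξ, d, hd, rfl⟩
    · rintro _ ⟨i, ξ, hξ, rfl⟩
      rw [← α.right_mul] at hξ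
      refine map_mem_of_mem_cspan (compL ℂ 𝔎' H K (κ i)) (isClosed_cspan _) ?_ hξ
      rintro _ ⟨ξ, hξ, d, hd, rfl⟩
      exact mem_cspan ⟨κ i ∘L ξ, mem_cspan ⟨i, ξ, hξ, rfl⟩, d, hd, rfl⟩
  inner_eq := by
    rw [← α.inner_eq]
    refine congrArg _ (le_antisymm (cspan_le (isClosed_cspan _) ?_) (cspan_le (isClosed_cspan _) ?_))
    · rintro _ ⟨x, hx, x', hx', rfl⟩
      refine map_mem_of_mem_cspan (compL ℂ 𝔎' K 𝔎' (x†)) (isClosed_cspan _) ?_ hx'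
      rintro _ ⟨j, ξ', hξ', rfl⟩
      refine map_mem_of_mem_cspan (((compL ℂ 𝔎' K 𝔎').flip (κ j ∘L ξ')).comp
        (ContinuousLinearMap.adjoint (𝕜 := ℂ) (E := 𝔎') (F := K)).toContinuousLinearEquiv.toContinuousLinearMap) (isClosed_cspan _) ?_ hx
      rintro _ ⟨i, ξ, hξ, rfl⟩
      refine mem_cspan ⟨ξ, hξ, _, hsub i j ξ' hξ', ?_⟩
      show _ = (κ i ∘L ξ)† ∘L (κ j ∘L ξ')
      rw [adjoint_comp]
      rfl
    · rintro _ ⟨ξ, hξ, ξ', hξ', rfl⟩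
      refine map_mem_of_mem_cspan (compL ℂ 𝔎' H 𝔎' (ξ†)) (isClosed_cspan _) ?_ (hsup hξ')
      rintro _ ⟨i, j, ξ', hξ', rfl⟩
      refine mem_cspan ⟨κ i ∘L ξ, mem_cspan ⟨i, ξ, hξ, rfl⟩, κ j ∘L ξ',
        mem_cspan ⟨j, ξ', hξ', rfl⟩, ?_⟩
      rw [adjoint_comp]
      rfl

theorem BaseModule.Preserves.le_cspan {β : BaseModule b H} {α : BaseModule a H}
    (h : β.Preserves α) {ι : Type y} (N : ι → ι → 𝔎 →L[ℂ] 𝔎)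
    (hN : (cspan {c : 𝔎 →L[ℂ] 𝔎 | ∃ i j, N i j = c} : Set (𝔎 →L[ℂ] 𝔎)) = b.dual) :
    α.space ≤ cspan {T : 𝔎' →L[ℂ] H | ∃ i j, ∃ ξ ∈ α.space, β.rho (N i j) ∘L ξ = T} := by
  have h1 : cspan _ = α.space := h
  conv_lhs => rw [← h1]
  refine cspan_le (isClosed_cspan _) ?_
  rintro _ ⟨c, hc, ξ, hξ, rfl⟩
  set M := cspan {T : 𝔎' →L[ℂ] H | ∃ i j, ∃ ξ ∈ α.space, β.rho (N i j) ∘L ξ = T}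
  have hsub : ∀ i j, N i j ∈ b.dual := fun i j => by
    rw [← SetLike.mem_coe, ← hN]; exact mem_cspan ⟨i, j, rfl⟩
  have hspan : ∀ c ∈ Submodule.span ℂ {c : 𝔎 →L[ℂ] 𝔎 | ∃ i j, N i j = c},
      c ∈ b.dual ∧ β.rho c ∘L ξ ∈ M := by
    intro c hc
    induction hc using Submodule.span_induction with
    | mem c hc =>
      obtain ⟨i, j, rfl⟩ := hc
      exact ⟨hsub i j, mem_cspan ⟨i, j, ξ, hξ, rfl⟩⟩
    | zero =>
      refine ⟨zero_mem _, ?_⟩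
      have : β.rho 0 = 0 := β.rho_unique (zero_mem _) fun ξ _ => by simp
      rw [this, zero_comp]
      exact zero_mem _
    | add c d _ _ hc hd =>
      refine ⟨add_mem hc.1 hd.1, ?_⟩
      rw [β.rho_add hc.1 hd.1, add_comp]
      exact add_mem hc.2 hd.2
    | smul r c _ hc =>
      refine ⟨SMulMemClass.smul_mem r hc.1, ?_⟩
      rw [β.rho_smul r hc.1, smul_comp]
      exact M.smul_mem r hc.2
  have hc' : c ∈ closure (Submodule.span ℂ {c : 𝔎 →L[ℂ] 𝔎 | ∃ i j, N i j = c} : Set _) := by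
    have : c ∈ (cspan {c : 𝔎 →L[ℂ] 𝔎 | ∃ i j, N i j = c} : Set (𝔎 →L[ℂ] 𝔎)) := hN ▸ hc
    exact this
  obtain ⟨s, hs, hsc⟩ := mem_closure_iff_seq_limit.1 hc'
  have hlim : Filter.Tendsto (fun n => β.rho (s n)) Filter.atTop (nhds (β.rho c)) := by
    rw [tendsto_iff_norm_sub_tendsto_zero] at hsc ⊢
    refine squeeze_zero (fun _ => norm_nonneg _) (fun n => ?_) hsc
    have h2 : β.rho (s n) - β.rho c = β.rho (s n - c) := by
      refine (β.rho_unique (sub_mem (hspan _ (hs n)).1 hc) fun ξ hξ => ?_).symm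
      rw [sub_comp, comp_sub, β.rho_comp hc hξ, β.rho_comp (hspan _ (hs n)).1 hξ]
    rw [h2]
    exact β.norm_rho_le (sub_mem (hspan _ (hs n)).1 hc)
  have hcont : Continuous fun R : H →L[ℂ] H => R ∘L ξ :=
    ((compL ℂ 𝔎' H H).flip ξ).continuous
  exact (isClosed_cspan _).mem_of_tendsto ((hcont.tendsto _).comp hlim)
    (Filter.Eventually.of_forall fun n => (hspan _ (hs n)).2)

end rho


section kets

variable {𝔎 : Type u} [NormedAddCommGroup 𝔎] [InnerProductSpace ℂ 𝔎] [CompleteSpace 𝔎]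
  {b : CStarBase 𝔎}
  {𝔎' : Type x} [NormedAddCommGroup 𝔎'] [InnerProductSpace ℂ 𝔎'] [CompleteSpace 𝔎']
  {a : CStarBase 𝔎'}
  {H : Type v} [NormedAddCommGroup H] [InnerProductSpace ℂ H] [CompleteSpace H]
  {K : Type w} [NormedAddCommGroup K] [InnerProductSpace ℂ K] [CompleteSpace K]
  (β : BaseModule b H) (γ : BaseModule b.op K)

/-- The operator `|ξ⟩₁ : K → H ⊗ K`, `η ζ ↦ ξ ⊗ ζ ⊗ η`, for `ξ ∈ β`. -/
def ket1 (ξ : β.space) : K →L[ℂ] RTP β γ :=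
  extendFam (fun η : γ.space => (η : 𝔎 →L[ℂ] K)) (fun η : γ.space => tmul β γ ξ η)

/-- The operator `|η⟩₂ : H → H ⊗ K`, `ξ ζ ↦ ξ ⊗ ζ ⊗ η`, for `η ∈ γ`. -/
def ket2 (η : γ.space) : H →L[ℂ] RTP β γ :=
  extendFam (fun ξ : β.space => (ξ : 𝔎 →L[ℂ] H)) (fun ξ : β.space => tmul β γ ξ η)

theorem ket1_comp (ξ : β.space) (η : γ.space) :
    ket1 β γ ξ ∘L (η : 𝔎 →L[ℂ] K) = tmul β γ ξ η := by
  refine extendFam_comp (fun η : γ.space => (η : 𝔎 →L[ℂ] K)) (fun η : γ.space => tmul β γ ξ η)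
    (ξ : 𝔎 →L[ℂ] H) γ.total' (fun i j => ?_) η
  rw [tmul_adjoint_comp_tmul, comp_assoc]

theorem ket2_comp (ξ : β.space) (η : γ.space) :
    ket2 β γ η ∘L (ξ : 𝔎 →L[ℂ] H) = tmul β γ ξ η := by
  refine extendFam_comp (fun ξ : β.space => (ξ : 𝔎 →L[ℂ] H)) (fun ξ : β.space => tmul β γ ξ η)
    (η : 𝔎 →L[ℂ] K) β.total' (fun i j => ?_) ξ
  rw [tmul_adjoint_comp_tmul, ← comp_assoc]
  exact b.commute _ (β.inner_mem i.2 j.2) _ (γ.inner_mem η.2 η.2)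

theorem ket1_adjoint_comp_ket1 (ξ ξ' : β.space) :
    (ket1 β γ ξ)† ∘L ket1 β γ ξ' = γ.rho ((ξ : 𝔎 →L[ℂ] H)† ∘L (ξ' : 𝔎 →L[ℂ] H)) := by
  refine (γ.rho_unique (β.inner_mem ξ.2 ξ'.2) fun η hη => ?_).symm
  refine ContinuousLinearMap.ext fun ζ => ext_inner_total γ.total' fun η' ζ' => ?_
  have e1 : (ket1 β γ ξ') (η ζ) = tmul β γ ξ' ⟨η, hη⟩ ζ :=
    DFunLike.congr_fun (ket1_comp β γ ξ' ⟨η, hη⟩) ζ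
  have e2 : (ket1 β γ ξ) ((η' : 𝔎 →L[ℂ] K) ζ') = tmul β γ ξ η' ζ' :=
    DFunLike.congr_fun (ket1_comp β γ ξ η') ζ'
  have h : _ * _ = _ * _ := b.commute _ (β.inner_mem ξ.2 ξ'.2) _ (γ.inner_mem η'.2 hη)
  have h2 : (ξ : 𝔎 →L[ℂ] H)† ∘L (ξ' : 𝔎 →L[ℂ] H) ∘L (η' : 𝔎 →L[ℂ] K)† ∘L η =
      (η' : 𝔎 →L[ℂ] K)† ∘L (η ∘L ((ξ : 𝔎 →L[ℂ] H)† ∘L (ξ' : 𝔎 →L[ℂ] H))) := h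
  rw [comp_apply, comp_apply, adjoint_inner_right, e1, e2, inner_tmul, h2,
    comp_apply ((η' : 𝔎 →L[ℂ] K)†), adjoint_inner_right]

theorem ket2_adjoint_comp_ket2 (η η' : γ.space) :
    (ket2 β γ η)† ∘L ket2 β γ η' = β.rho ((η : 𝔎 →L[ℂ] K)† ∘L (η' : 𝔎 →L[ℂ] K)) := by
  refine (β.rho_unique (γ.inner_mem η.2 η'.2) fun ξ hξ => ?_).symm
  refine ContinuousLinearMap.ext fun ζ => ext_inner_total β.total' fun ξ' ζ' => ?_
  have e1 : (ket2 β γ η') (ξ ζ) = tmul β γ ⟨ξ, hξ⟩ η' ζ :=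
    DFunLike.congr_fun (ket2_comp β γ ⟨ξ, hξ⟩ η') ζ
  have e2 : (ket2 β γ η) ((ξ' : 𝔎 →L[ℂ] H) ζ') = tmul β γ ξ' η ζ' :=
    DFunLike.congr_fun (ket2_comp β γ ξ' η) ζ'
  rw [comp_apply, comp_apply, adjoint_inner_right, e1, e2, inner_tmul,
    comp_apply ((ξ' : 𝔎 →L[ℂ] H)†), adjoint_inner_right]

theorem ket1_total : cspan {t : RTP β γ | ∃ (ξ : β.space) (x : K), ket1 β γ ξ x = t} = ⊤ := by
  rw [← top_le_iff, ← tmul_total β γ]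
  refine cspan_mono ?_
  rintro _ ⟨p, ζ, rfl⟩
  exact ⟨p.1, (p.2 : 𝔎 →L[ℂ] K) ζ, DFunLike.congr_fun (ket1_comp β γ p.1 p.2) ζ⟩

theorem ket2_total : cspan {t : RTP β γ | ∃ (η : γ.space) (x : H), ket2 β γ η x = t} = ⊤ := by
  rw [← top_le_iff, ← tmul_total β γ]
  refine cspan_mono ?_
  rintro _ ⟨p, ζ, rfl⟩
  exact ⟨p.2, (p.1 : 𝔎 →L[ℂ] H) ζ, DFunLike.congr_fun (ket2_comp β γ p.1 p.2) ζ⟩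

theorem BaseModule.inner_eq' : (cspan {T : 𝔎 →L[ℂ] 𝔎 | ∃ ξ ξ' : β.space,
    (ξ : 𝔎 →L[ℂ] H)† ∘L (ξ' : 𝔎 →L[ℂ] H) = T} : Set (𝔎 →L[ℂ] 𝔎)) = b.alg := by
  rw [← β.inner_eq]
  congr 2
  ext T
  simp

/-- The module structure `α ◁ γ = [|γ⟩₂ α]` on `H ⊗ K`. -/
def ltri (α : BaseModule a H) (β : BaseModule b H) (γ : BaseModule b.op K)
    (h : β.Preserves α) : BaseModule a (RTP β γ) :=
  α.push (fun η : γ.space => ket2 β γ η) (ket2_total β γ)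
    (fun i j ξ hξ => by
      rw [ket2_adjoint_comp_ket2]
      exact h.mem (γ.inner_mem i.2 j.2) hξ)
    (by
      simp only [ket2_adjoint_comp_ket2]
      exact h.le_cspan (fun i j : γ.space => (i : 𝔎 →L[ℂ] K)† ∘L (j : 𝔎 →L[ℂ] K)) γ.inner_eq')

/-- The module structure `β ▷ δ = [|β⟩₁ δ]` on `H ⊗ K`. -/
def rtri (β : BaseModule b H) (γ : BaseModule b.op K) (δ : BaseModule a K)
    (h : γ.Preserves δ) : BaseModule a (RTP β γ) :=
  δ.push (fun ξ : β.space => ket1 β γ ξ) (ket1_total β γ)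
    (fun i j ξ hξ => by
      rw [ket1_adjoint_comp_ket1]
      exact h.mem (β.inner_mem i.2 j.2) hξ)
    (by
      simp only [ket1_adjoint_comp_ket1]
      exact h.le_cspan (fun i j : β.space => (i : 𝔎 →L[ℂ] H)† ∘L (j : 𝔎 →L[ℂ] H)) β.inner_eq')

end kets

/-! ### Operators on relative tensor products -/

section operators

variable {𝔎 : Type u} [NormedAddCommGroup 𝔎] [InnerProductSpace ℂ 𝔎] [CompleteSpace 𝔎]
  {b : CStarBase 𝔎}
  {𝔎' : Type y} [NormedAddCommGroup 𝔎'] [InnerProductSpace ℂ 𝔎'] [CompleteSpace 𝔎']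
  {d : CStarBase 𝔎'}
  {H : Type v} [NormedAddCommGroup H] [InnerProductSpace ℂ H] [CompleteSpace H]
  {K : Type w} [NormedAddCommGroup K] [InnerProductSpace ℂ K] [CompleteSpace K]
  {L : Type x} [NormedAddCommGroup L] [InnerProductSpace ℂ L] [CompleteSpace L]

/-- The operator `S ⊗ Id : H ⊗ K → L ⊗ K`, determined by `(S ⊗ Id)|η⟩₂ = |η⟩₂ S` for `η ∈ γ`,
where `S : H → L` intertwines `ρ_β` and `ρ_β'`. -/
def tensorId (β : BaseModule b H) (β' : BaseModule b L) (γ : BaseModule b.op K)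
    (S : H →L[ℂ] L) : RTP β γ →L[ℂ] RTP β' γ :=
  extendFam (fun η : γ.space => ket2 β γ η) (fun η : γ.space => ket2 β' γ η ∘L S)

/-- The operator `Id ⊗ S : H ⊗ K → H ⊗ L`, determined by `(Id ⊗ S)|ξ⟩₁ = |ξ⟩₁ S` for `ξ ∈ β`,
where `S : K → L` intertwines `ρ_γ` and `ρ_γ'`. -/
def idTensor (β : BaseModule b H) (γ : BaseModule b.op K) (γ' : BaseModule b.op L)
    (S : K →L[ℂ] L) : RTP β γ →L[ℂ] RTP β γ' :=
  extendFam (fun ξ : β.space => ket1 β γ ξ) (fun ξ : β.space => ket1 β γ' ξ ∘L S)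

/-- The flip `Σ : H ⊗ K → K ⊗ H`, `ξ ⊗ ζ ⊗ η ↦ η ⊗ ζ ⊗ ξ`. -/
def flip (β : BaseModule b H) (γ : BaseModule b.op K) : RTP β γ →L[ℂ] RTP (b := b.op) γ β :=
  extendFam (fun p : β.space × γ.space => tmul β γ p.1 p.2)
    (fun p : β.space × γ.space => tmul (b := b.op) γ β p.2 p.1)

/-- The canonical isomorphism `(H ⊗ K) ⊗ L → H ⊗ (K ⊗ L)`, `|φ⟩₂|ξ⟩₁ κ ↦ |ξ⟩₁|φ⟩₂ κ`
for `ξ ∈ β`, `κ ∈ K`, `φ ∈ φ`. -/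
def assoc (β : BaseModule b H) (γ : BaseModule b.op K) (ε : BaseModule d K)
    (φ : BaseModule d.op L) (h : γ.Preserves ε) (h' : ε.Preserves γ) :
    RTP (rtri β γ ε h) φ →L[ℂ] RTP β (ltri γ ε φ h') :=
  extendFam
    (fun p : β.space × φ.space => ket2 (rtri β γ ε h) φ p.2 ∘L ket1 β γ p.1)
    (fun p : β.space × φ.space => ket1 β (ltri γ ε φ h') p.1 ∘L ket2 ε φ p.2)

/-- The inverse of `assoc`. -/
def assocSymm (β : BaseModule b H) (γ : BaseModule b.op K) (ε : BaseModule d K)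
    (φ : BaseModule d.op L) (h : γ.Preserves ε) (h' : ε.Preserves γ) :
    RTP β (ltri γ ε φ h') →L[ℂ] RTP (rtri β γ ε h) φ :=
  extendFam
    (fun p : β.space × φ.space => ket1 β (ltri γ ε φ h') p.1 ∘L ket2 ε φ p.2)
    (fun p : β.space × φ.space => ket2 (rtri β γ ε h) φ p.2 ∘L ket1 β γ p.1)

/-- For module structures `β` and `δ` on `H`, the canonical isomorphism
`Σ₂₃ : (H ⊗ K) ⊗ L → (H ⊗ L) ⊗ K`, `(x ⊗ η) ⊗ θ ↦ (x ⊗ θ) ⊗ η`, for `η ∈ γ`, `θ ∈ θ`. -/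
def sigma23 (β : BaseModule b H) (γ : BaseModule b.op K) (δ : BaseModule d H)
    (θ : BaseModule d.op L) (h : β.Preserves δ) (h' : δ.Preserves β) :
    RTP (ltri δ β γ h) θ →L[ℂ] RTP (ltri β δ θ h') γ :=
  extendFam
    (fun p : γ.space × θ.space => ket2 (ltri δ β γ h) θ p.2 ∘L ket2 β γ p.1)
    (fun p : γ.space × θ.space => ket2 (ltri β δ θ h') γ p.1 ∘L ket2 δ θ p.2)

theorem tensorId_comp_ket2 (β : BaseModule b H) (β' : BaseModule b L) (γ : BaseModule b.op K)
    {S : H →L[ℂ] L} (hS : ∀ c ∈ b.dual, S ∘L β.rho c = β'.rho c ∘L S) (η : γ.space) :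
    tensorId β β' γ S ∘L ket2 β γ η = ket2 β' γ η ∘L S := by
  refine extendFam_comp (fun η : γ.space => ket2 β γ η) (fun η : γ.space => ket2 β' γ η ∘L S) S
    (ket2_total β γ) (fun i j => ?_) η
  rw [ket2_adjoint_comp_ket2, adjoint_comp, comp_assoc, comp_assoc, hS _ (γ.inner_mem i.2 j.2),
    ← ket2_adjoint_comp_ket2, comp_assoc]

theorem idTensor_comp_ket1 (β : BaseModule b H) (γ : BaseModule b.op K) (γ' : BaseModule b.op L)
    {S : K →L[ℂ] L} (hS : ∀ c ∈ b.alg, S ∘L γ.rho c = γ'.rho c ∘L S) (ξ : β.space) :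
    idTensor β γ γ' S ∘L ket1 β γ ξ = ket1 β γ' ξ ∘L S := by
  refine extendFam_comp (fun ξ : β.space => ket1 β γ ξ) (fun ξ : β.space => ket1 β γ' ξ ∘L S) S
    (ket1_total β γ) (fun i j => ?_) ξ
  rw [ket1_adjoint_comp_ket1, adjoint_comp, comp_assoc, comp_assoc, hS _ (β.inner_mem i.2 j.2),
    ← ket1_adjoint_comp_ket1, comp_assoc]

theorem flip_comp_tmul (β : BaseModule b H) (γ : BaseModule b.op K) (ξ : β.space) (η : γ.space) :
    flip β γ ∘L tmul β γ ξ η = tmul (b := b.op) γ β η ξ := by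
  refine extendFam_comp (fun p : β.space × γ.space => tmul β γ p.1 p.2)
    (fun p : β.space × γ.space => tmul (b := b.op) γ β p.2 p.1)
    (ContinuousLinearMap.id ℂ 𝔎) (tmul_total β γ) (fun i j => ?_) (ξ, η)
  rw [tmul_adjoint_comp_tmul, tmul_adjoint_comp_tmul, adjoint_id, id_comp, id_comp]
  exact (b.commute _ (β.inner_mem i.1.2 j.1.2) _ (γ.inner_mem i.2.2 j.2.2)).symm

theorem rho_ltri (δ : BaseModule d H) (β : BaseModule b H) (γ : BaseModule b.op K)
    (h : β.Preserves δ) {c : 𝔎' →L[ℂ] 𝔎'} (hc : c ∈ d.dual) (η : γ.space) :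
    (ltri δ β γ h).rho c ∘L ket2 β γ η = ket2 β γ η ∘L δ.rho c := by
  refine eq_of_comp_eq δ.total' fun ξ => ?_
  have h1 : ket2 β γ η ∘L (ξ : 𝔎' →L[ℂ] H) ∈ (ltri δ β γ h).space :=
    mem_cspan ⟨η, ξ, ξ.2, rfl⟩
  rw [comp_assoc, (ltri δ β γ h).rho_comp hc h1, comp_assoc, comp_assoc, δ.rho_comp hc ξ.2]

theorem rho_rtri (β : BaseModule b H) (γ : BaseModule b.op K) (δ : BaseModule d K)
    (h : γ.Preserves δ) {c : 𝔎' →L[ℂ] 𝔎'} (hc : c ∈ d.dual) (ξ : β.space) :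
    (rtri β γ δ h).rho c ∘L ket1 β γ ξ = ket1 β γ ξ ∘L δ.rho c := by
  refine eq_of_comp_eq δ.total' fun η => ?_
  have h1 : ket1 β γ ξ ∘L (η : 𝔎' →L[ℂ] K) ∈ (rtri β γ δ h).space :=
    mem_cspan ⟨ξ, η, η.2, rfl⟩
  rw [comp_assoc, (rtri β γ δ h).rho_comp hc h1, comp_assoc, comp_assoc, δ.rho_comp hc η.2]

theorem assoc_kernel (β : BaseModule b H) (γ : BaseModule b.op K) (ε : BaseModule d K)
    (φ : BaseModule d.op L) (h : γ.Preserves ε) (h' : ε.Preserves γ) (p q : β.space × φ.space) :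
    (ket1 β (ltri γ ε φ h') p.1 ∘L ket2 ε φ p.2)† ∘L (ket1 β (ltri γ ε φ h') q.1 ∘L ket2 ε φ q.2)
      = (ket2 (rtri β γ ε h) φ p.2 ∘L ket1 β γ p.1)† ∘L
        (ket2 (rtri β γ ε h) φ q.2 ∘L ket1 β γ q.1) := by
  have e1 : (ket1 β (ltri γ ε φ h') p.1 ∘L ket2 ε φ p.2)† ∘L
      (ket1 β (ltri γ ε φ h') q.1 ∘L ket2 ε φ q.2) =
      (ket2 ε φ p.2)† ∘L (((ket1 β (ltri γ ε φ h') p.1)† ∘L ket1 β (ltri γ ε φ h') q.1) ∘L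
        ket2 ε φ q.2) := by
    rw [adjoint_comp]; rfl
  have e2 : (ket2 (rtri β γ ε h) φ p.2 ∘L ket1 β γ p.1)† ∘L
        (ket2 (rtri β γ ε h) φ q.2 ∘L ket1 β γ q.1) =
      (ket1 β γ p.1)† ∘L (((ket2 (rtri β γ ε h) φ p.2)† ∘L ket2 (rtri β γ ε h) φ q.2) ∘L
        ket1 β γ q.1) := by
    rw [adjoint_comp]; rfl
  rw [e1, e2, ket1_adjoint_comp_ket1, ket2_adjoint_comp_ket2,
    rho_ltri γ ε φ h' (β.inner_mem p.1.2 q.1.2), rho_rtri β γ ε h (φ.inner_mem p.2.2 q.2.2),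
    ← comp_assoc, ← comp_assoc, ket1_adjoint_comp_ket1, ket2_adjoint_comp_ket2]
  exact h'.rho_comm (φ.inner_mem p.2.2 q.2.2) (β.inner_mem p.1.2 q.1.2)

theorem assoc_total (β : BaseModule b H) (γ : BaseModule b.op K) (ε : BaseModule d K)
    (φ : BaseModule d.op L) (h : γ.Preserves ε) :
    cspan {t : RTP (rtri β γ ε h) φ | ∃ (p : β.space × φ.space) (x : K),
      (ket2 (rtri β γ ε h) φ p.2 ∘L ket1 β γ p.1) x = t} = ⊤ := by
  rw [← top_le_iff, ← ket2_total (rtri β γ ε h) φ]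
  refine cspan_le (isClosed_cspan _) ?_
  rintro _ ⟨η, x, rfl⟩
  have hx : x ∈ cspan {t : RTP β γ | ∃ (ξ : β.space) (x : K), ket1 β γ ξ x = t} :=
    ket1_total β γ ▸ Submodule.mem_top
  refine map_mem_of_mem_cspan (ket2 (rtri β γ ε h) φ η) (isClosed_cspan _) ?_ hx
  rintro _ ⟨ξ, y, rfl⟩
  exact mem_cspan ⟨(ξ, η), y, rfl⟩

theorem assoc_comp (β : BaseModule b H) (γ : BaseModule b.op K) (ε : BaseModule d K)
    (φ : BaseModule d.op L) (h : γ.Preserves ε) (h' : ε.Preserves γ) (ξ : β.space) (θ : φ.space) :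
    assoc β γ ε φ h h' ∘L (ket2 (rtri β γ ε h) φ θ ∘L ket1 β γ ξ) =
      ket1 β (ltri γ ε φ h') ξ ∘L ket2 ε φ θ :=
  extendFam_comp
    (fun p : β.space × φ.space => ket2 (rtri β γ ε h) φ p.2 ∘L ket1 β γ p.1)
    (fun p : β.space × φ.space => ket1 β (ltri γ ε φ h') p.1 ∘L ket2 ε φ p.2)
    (ContinuousLinearMap.id ℂ K) (assoc_total β γ ε φ h)
    (fun p q => by rw [adjoint_id, id_comp, id_comp]; exact assoc_kernel β γ ε φ h h' p q) (ξ, θ)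

theorem assocSymm_comp (β : BaseModule b H) (γ : BaseModule b.op K) (ε : BaseModule d K)
    (φ : BaseModule d.op L) (h : γ.Preserves ε) (h' : ε.Preserves γ) (ξ : β.space) (θ : φ.space) :
    assocSymm β γ ε φ h h' ∘L (ket1 β (ltri γ ε φ h') ξ ∘L ket2 ε φ θ) =
      ket2 (rtri β γ ε h) φ θ ∘L ket1 β γ ξ := by
  refine extendFam_comp
    (fun p : β.space × φ.space => ket1 β (ltri γ ε φ h') p.1 ∘L ket2 ε φ p.2)
    (fun p : β.space × φ.space => ket2 (rtri β γ ε h) φ p.2 ∘L ket1 β γ p.1)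
    (ContinuousLinearMap.id ℂ K) ?_
    (fun p q => by
      rw [adjoint_id, id_comp, id_comp]; exact (assoc_kernel β γ ε φ h h' p q).symm) (ξ, θ)
  rw [← top_le_iff, ← ket1_total β (ltri γ ε φ h')]
  refine cspan_le (isClosed_cspan _) ?_
  rintro _ ⟨η, x, rfl⟩
  have hx : x ∈ cspan {t : RTP ε φ | ∃ (θ : φ.space) (x : K), ket2 ε φ θ x = t} :=
    ket2_total ε φ ▸ Submodule.mem_top
  refine map_mem_of_mem_cspan (ket1 β (ltri γ ε φ h') η) (isClosed_cspan _) ?_ hx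
  rintro _ ⟨ξ, y, rfl⟩
  exact mem_cspan ⟨(η, ξ), y, rfl⟩

theorem sigma23_comp (β : BaseModule b H) (γ : BaseModule b.op K) (δ : BaseModule d H)
    (θ : BaseModule d.op L) (h : β.Preserves δ) (h' : δ.Preserves β)
    (η : γ.space) (τ : θ.space) :
    sigma23 β γ δ θ h h' ∘L (ket2 (ltri δ β γ h) θ τ ∘L ket2 β γ η) =
      ket2 (ltri β δ θ h') γ η ∘L ket2 δ θ τ := by
  refine extendFam_comp
    (fun p : γ.space × θ.space => ket2 (ltri δ β γ h) θ p.2 ∘L ket2 β γ p.1)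
    (fun p : γ.space × θ.space => ket2 (ltri β δ θ h') γ p.1 ∘L ket2 δ θ p.2)
    (ContinuousLinearMap.id ℂ H) ?_ (fun p q => ?_) (η, τ)
  · rw [← top_le_iff, ← ket2_total (ltri δ β γ h) θ]
    refine cspan_le (isClosed_cspan _) ?_
    rintro _ ⟨τ, x, rfl⟩
    have hx : x ∈ cspan {t : RTP β γ | ∃ (η : γ.space) (x : H), ket2 β γ η x = t} :=
      ket2_total β γ ▸ Submodule.mem_top
    refine map_mem_of_mem_cspan (ket2 (ltri δ β γ h) θ τ) (isClosed_cspan _) ?_ hx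
    rintro _ ⟨η, y, rfl⟩
    exact mem_cspan ⟨(η, τ), y, rfl⟩
  · have e1 : (ket2 (ltri β δ θ h') γ p.1 ∘L ket2 δ θ p.2)† ∘L
        (ket2 (ltri β δ θ h') γ q.1 ∘L ket2 δ θ q.2) =
        (ket2 δ θ p.2)† ∘L (((ket2 (ltri β δ θ h') γ p.1)† ∘L ket2 (ltri β δ θ h') γ q.1) ∘L
          ket2 δ θ q.2) := by
      rw [adjoint_comp]; rfl
    have e2 : (ket2 (ltri δ β γ h) θ p.2 ∘L ket2 β γ p.1)† ∘L
        (ket2 (ltri δ β γ h) θ q.2 ∘L ket2 β γ q.1) =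
        (ket2 β γ p.1)† ∘L (((ket2 (ltri δ β γ h) θ p.2)† ∘L ket2 (ltri δ β γ h) θ q.2) ∘L
          ket2 β γ q.1) := by
      rw [adjoint_comp]; rfl
    rw [adjoint_id, id_comp, id_comp, e1, e2, ket2_adjoint_comp_ket2, ket2_adjoint_comp_ket2,
      rho_ltri β δ θ h' (γ.inner_mem p.1.2 q.1.2), rho_ltri δ β γ h (θ.inner_mem p.2.2 q.2.2),
      ← comp_assoc, ← comp_assoc, ket2_adjoint_comp_ket2, ket2_adjoint_comp_ket2]
    exact h'.rho_comm (θ.inner_mem p.2.2 q.2.2) (γ.inner_mem p.1.2 q.1.2)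

end operators


/-! ### Morphisms and the fiber product -/

section fiber

variable {𝔎 : Type u} [NormedAddCommGroup 𝔎] [InnerProductSpace ℂ 𝔎] [CompleteSpace 𝔎]
  {b : CStarBase 𝔎}
  {H : Type v} [NormedAddCommGroup H] [InnerProductSpace ℂ H] [CompleteSpace H]
  {K : Type w} [NormedAddCommGroup K] [InnerProductSpace ℂ K] [CompleteSpace K]
  {L : Type x} [NormedAddCommGroup L] [InnerProductSpace ℂ L] [CompleteSpace L]

/-- `T : H → K` is a semi-morphism `(H, α) → (K, γ)` if `T α ⊆ γ`. -/
def IsSemiMorphism (α : BaseModule b H) (γ : BaseModule b K) (T : H →L[ℂ] K) : Prop :=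
  ∀ ξ ∈ α.space, T ∘L ξ ∈ γ.space

/-- `T : H → K` is a morphism `(H, α) → (K, γ)` if `T α ⊆ γ` and `T* γ ⊆ α`. -/
def IsMorphism (α : BaseModule b H) (γ : BaseModule b K) (T : H →L[ℂ] K) : Prop :=
  IsSemiMorphism α γ T ∧ IsSemiMorphism γ α (T†)

/-- `T : H → K` maps `α` onto `γ`, that is, `T α = γ`. -/
def MapsOnto (α : BaseModule b H) (γ : BaseModule b K) (T : H →L[ℂ] K) : Prop :=
  (fun ξ : 𝔎 →L[ℂ] H => T ∘L ξ) '' (α.space : Set (𝔎 →L[ℂ] H)) = (γ.space : Set (𝔎 →L[ℂ] K))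

/-- The space `L^π(H, K)` of operators `T` with `T a = π(a) T` for all `a ∈ A`. -/
def intertwiners {A : NonUnitalStarSubalgebra ℂ (H →L[ℂ] H)} (π : A →⋆ₙₐ[ℂ] (K →L[ℂ] K)) :
    Set (H →L[ℂ] K) :=
  {T | ∀ a : A, T ∘L (a : H →L[ℂ] H) = π a ∘L T}

/-- The underlying set of the fiber product of `A` (on `(H, β)`) and `B` (on `(K, γ)`):
all `x ∈ L(H ⊗ K)` with `x|β⟩₁, x*|β⟩₁ ⊆ [|β⟩₁ B]` and `x|γ⟩₂, x*|γ⟩₂ ⊆ [|γ⟩₂ A]`. -/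
def fiberProduct (β : BaseModule b H) (γ : BaseModule b.op K)
    (A : NonUnitalStarSubalgebra ℂ (H →L[ℂ] H)) (B : NonUnitalStarSubalgebra ℂ (K →L[ℂ] K)) :
    Set (RTP β γ →L[ℂ] RTP β γ) :=
  {x | (∀ ξ : β.space,
        x ∘L ket1 β γ ξ ∈ cspan {T | ∃ ξ' : β.space, ∃ y ∈ B, ket1 β γ ξ' ∘L y = T} ∧
        x† ∘L ket1 β γ ξ ∈ cspan {T | ∃ ξ' : β.space, ∃ y ∈ B, ket1 β γ ξ' ∘L y = T}) ∧
      ∀ η : γ.space,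
        x ∘L ket2 β γ η ∈ cspan {T | ∃ η' : γ.space, ∃ a ∈ A, ket2 β γ η' ∘L a = T} ∧
        x† ∘L ket2 β γ η ∈ cspan {T | ∃ η' : γ.space, ∃ a ∈ A, ket2 β γ η' ∘L a = T}}

/-- The map `φ ∗ Id` on the fiber product, for a semi-normal morphism `φ` of `C*`-`𝔟`-algebras
from `A` on `(H, β)` to operators on `(L, λ)`: the operator `(φ ∗ Id)(x)` is determined by
`(φ ∗ Id)(x) (S ⊗ Id) = (S ⊗ Id) x` for all semi-morphisms `S : (H, β) → (L, λ)` in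
`L^φ(H, L)`. -/
def mapLeft (β : BaseModule b H) (lam : BaseModule b L) (γ : BaseModule b.op K)
    {A : NonUnitalStarSubalgebra ℂ (H →L[ℂ] H)} (φ : A →⋆ₙₐ[ℂ] (L →L[ℂ] L))
    (x : RTP β γ →L[ℂ] RTP β γ) : RTP lam γ →L[ℂ] RTP lam γ :=
  extendFam
    (fun S : {S : H →L[ℂ] L // S ∈ intertwiners φ ∧ IsSemiMorphism β lam S} =>
      tensorId β lam γ S)
    (fun S : {S : H →L[ℂ] L // S ∈ intertwiners φ ∧ IsSemiMorphism β lam S} =>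
      tensorId β lam γ S ∘L x)

/-- The map `Id ∗ ψ` on the fiber product, for a semi-normal morphism `ψ` of `C*`-`𝔟†`-algebras
from `B` on `(K, γ)` to operators on `(L, μ)`: the operator `(Id ∗ ψ)(x)` is determined by
`(Id ∗ ψ)(x) (Id ⊗ S) = (Id ⊗ S) x` for all semi-morphisms `S : (K, γ) → (L, μ)` in
`L^ψ(K, L)`. -/
def mapRight (β : BaseModule b H) (γ : BaseModule b.op K) (μ : BaseModule b.op L)
    {B : NonUnitalStarSubalgebra ℂ (K →L[ℂ] K)} (ψ : B →⋆ₙₐ[ℂ] (L →L[ℂ] L))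
    (x : RTP β γ →L[ℂ] RTP β γ) : RTP β μ →L[ℂ] RTP β μ :=
  extendFam
    (fun S : {S : K →L[ℂ] L // S ∈ intertwiners ψ ∧ IsSemiMorphism γ μ S} =>
      idTensor β γ μ S)
    (fun S : {S : K →L[ℂ] L // S ∈ intertwiners ψ ∧ IsSemiMorphism γ μ S} =>
      idTensor β γ μ S ∘L x)

theorem IsSemiMorphism.comp_rho {α : BaseModule b H} {γ : BaseModule b K} {S : H →L[ℂ] K}
    (hS : IsSemiMorphism α γ S) {c : 𝔎 →L[ℂ] 𝔎} (hc : c ∈ b.dual) :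
    S ∘L α.rho c = γ.rho c ∘L S := by
  refine eq_of_comp_eq α.total' fun ξ => ?_
  rw [comp_assoc, α.rho_comp hc ξ.2, comp_assoc, γ.rho_comp hc (hS ξ ξ.2), comp_assoc]

theorem adjoint_tensorId_comp_ket2 (β : BaseModule b H) (lam : BaseModule b L)
    (γ : BaseModule b.op K) {S : H →L[ℂ] L} (hS : IsSemiMorphism β lam S) (η : γ.space) :
    (tensorId β lam γ S)† ∘L ket2 lam γ η = ket2 β γ η ∘L S† := by
  have h1 : ∀ i : γ.space,
      ((tensorId β lam γ S)† ∘L ket2 lam γ η)† ∘L ket2 β γ i =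
        (ket2 β γ η ∘L S†)† ∘L ket2 β γ i := fun i => by
    rw [adjoint_comp, adjoint_comp, adjoint_adjoint, adjoint_adjoint, comp_assoc, comp_assoc,
      tensorId_comp_ket2 β lam γ (fun c hc => hS.comp_rho hc), ← comp_assoc,
      ket2_adjoint_comp_ket2, ket2_adjoint_comp_ket2]
    exact (hS.comp_rho (γ.inner_mem η.2 i.2)).symm
  exact ContinuousLinearMap.adjoint.injective (eq_of_comp_eq (ket2_total β γ) h1)

theorem adjoint_idTensor_comp_ket1 (β : BaseModule b H) (γ : BaseModule b.op K)
    (μ : BaseModule b.op L) {S : K →L[ℂ] L} (hS : IsSemiMorphism γ μ S) (ξ : β.space) :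
    (idTensor β γ μ S)† ∘L ket1 β μ ξ = ket1 β γ ξ ∘L S† := by
  have h1 : ∀ i : β.space,
      ((idTensor β γ μ S)† ∘L ket1 β μ ξ)† ∘L ket1 β γ i =
        (ket1 β γ ξ ∘L S†)† ∘L ket1 β γ i := fun i => by
    rw [adjoint_comp, adjoint_comp, adjoint_adjoint, adjoint_adjoint, comp_assoc, comp_assoc,
      idTensor_comp_ket1 β γ μ (fun c hc => hS.comp_rho hc), ← comp_assoc,
      ket1_adjoint_comp_ket1, ket1_adjoint_comp_ket1]
    exact (hS.comp_rho (β.inner_mem ξ.2 i.2)).symm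
  exact ContinuousLinearMap.adjoint.injective (eq_of_comp_eq (ket1_total β γ) h1)

/-- The defining property of `mapLeft`, for semi-normal `φ`. -/
theorem mapLeft_comp_tensorId (β : BaseModule b H) (lam : BaseModule b L) (γ : BaseModule b.op K)
    {A : NonUnitalStarSubalgebra ℂ (H →L[ℂ] H)} {B : NonUnitalStarSubalgebra ℂ (K →L[ℂ] K)}
    (φ : A →⋆ₙₐ[ℂ] (L →L[ℂ] L))
    (hφ : lam.space ≤ cspan {T : 𝔎 →L[ℂ] L | ∃ S ∈ intertwiners φ, IsSemiMorphism β lam S ∧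
      ∃ ξ ∈ β.space, S ∘L ξ = T})
    {x : RTP β γ →L[ℂ] RTP β γ} (hx : x ∈ fiberProduct β γ A B) {S : H →L[ℂ] L}
    (hS : S ∈ intertwiners φ) (hS' : IsSemiMorphism β lam S) :
    mapLeft β lam γ φ x ∘L tensorId β lam γ S = tensorId β lam γ S ∘L x := by
  have hcomm : ∀ S S' : {S : H →L[ℂ] L // S ∈ intertwiners φ ∧ IsSemiMorphism β lam S},
      ((tensorId β lam γ S)† ∘L tensorId β lam γ S') ∘L x =
        x ∘L ((tensorId β lam γ S)† ∘L tensorId β lam γ S') := by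
    intro S S'
    have hk : ∀ η, ((tensorId β lam γ S)† ∘L tensorId β lam γ S') ∘L ket2 β γ η =
        ket2 β γ η ∘L ((S : H →L[ℂ] L)† ∘L (S' : H →L[ℂ] L)) := fun η => by
      rw [comp_assoc, tensorId_comp_ket2 β lam γ (fun c hc => S'.2.2.comp_rho hc), ← comp_assoc,
        adjoint_tensorId_comp_ket2 β lam γ S.2.2, comp_assoc]
    have hA : ∀ a ∈ A, ((S : H →L[ℂ] L)† ∘L (S' : H →L[ℂ] L)) ∘L a =
        a ∘L ((S : H →L[ℂ] L)† ∘L (S' : H →L[ℂ] L)) := fun a ha => by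
      have e1 := S'.2.1 ⟨a, ha⟩
      have e2 := congrArg ContinuousLinearMap.adjoint (S.2.1 (star ⟨a, ha⟩))
      rw [adjoint_comp, adjoint_comp, map_star, star_eq_adjoint, adjoint_adjoint] at e2
      have e3 : (((star (⟨a, ha⟩ : A) : A) : H →L[ℂ] H))† = a := adjoint_adjoint a
      rw [e3] at e2
      rw [comp_assoc, e1, ← comp_assoc, ← e2, comp_assoc]
    refine eq_of_comp_eq (ket2_total β γ) fun η => ?_
    set Q := (tensorId β lam γ S)† ∘L tensorId β lam γ S'
    set q := (S : H →L[ℂ] L)† ∘L (S' : H →L[ℂ] L)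
    have h0 : x ∘L ket2 β γ η ∈ LinearMap.ker
        ((compL ℂ H (RTP β γ) (RTP β γ) Q - (compL ℂ H H (RTP β γ)).flip q :
          (H →L[ℂ] RTP β γ) →L[ℂ] (H →L[ℂ] RTP β γ)) :
            (H →L[ℂ] RTP β γ) →ₗ[ℂ] (H →L[ℂ] RTP β γ)) := by
      refine cspan_le (ContinuousLinearMap.isClosed_ker _) ?_ ((hx.2 η).1)
      rintro _ ⟨η', a, ha, rfl⟩
      show Q ∘L (ket2 β γ η' ∘L a) - (ket2 β γ η' ∘L a) ∘L q = 0
      rw [← comp_assoc, hk, comp_assoc, hA a ha, comp_assoc, sub_self]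
    have h1 : Q ∘L (x ∘L ket2 β γ η) - (x ∘L ket2 β γ η) ∘L q = 0 := h0
    rw [comp_assoc, sub_eq_zero.1 h1, comp_assoc, ← hk]
    rfl
  refine extendFam_comp
    (fun S : {S : H →L[ℂ] L // S ∈ intertwiners φ ∧ IsSemiMorphism β lam S} =>
      tensorId β lam γ S)
    (fun S : {S : H →L[ℂ] L // S ∈ intertwiners φ ∧ IsSemiMorphism β lam S} =>
      tensorId β lam γ S ∘L x) x ?_ (fun i j => ?_) ⟨S, hS, hS'⟩
  · rw [← top_le_iff, ← tmul_total lam γ]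
    refine cspan_le (isClosed_cspan _) ?_
    rintro _ ⟨⟨l, η⟩, ζ, rfl⟩
    have e : tmul lam γ l η ζ = ket2 lam γ η ((l : 𝔎 →L[ℂ] L) ζ) :=
      (DFunLike.congr_fun (ket2_comp lam γ l η) ζ).symm
    show tmul lam γ l η ζ ∈ _
    rw [e]
    refine map_mem_of_mem_cspan ((ket2 lam γ η).comp (ContinuousLinearMap.apply ℂ L ζ))
      (isClosed_cspan _) ?_ (hφ l.2)
    rintro _ ⟨T, hT, hT', ξ, hξ, rfl⟩
    refine mem_cspan ⟨⟨T, hT, hT'⟩, ket2 β γ η (ξ ζ), ?_⟩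
    exact DFunLike.congr_fun
      (tensorId_comp_ket2 β lam γ (fun c hc => hT'.comp_rho hc) η) (ξ ζ)
  · rw [adjoint_comp, comp_assoc, ← comp_assoc _ _ x, hcomm, ← comp_assoc]

/-- The defining property of `mapRight`, for semi-normal `ψ`. -/
theorem mapRight_comp_idTensor (β : BaseModule b H) (γ : BaseModule b.op K)
    (μ : BaseModule b.op L)
    {A : NonUnitalStarSubalgebra ℂ (H →L[ℂ] H)} {B : NonUnitalStarSubalgebra ℂ (K →L[ℂ] K)}
    (ψ : B →⋆ₙₐ[ℂ] (L →L[ℂ] L))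
    (hψ : μ.space ≤ cspan {T : 𝔎 →L[ℂ] L | ∃ S ∈ intertwiners ψ, IsSemiMorphism γ μ S ∧
      ∃ η ∈ γ.space, S ∘L η = T})
    {x : RTP β γ →L[ℂ] RTP β γ} (hx : x ∈ fiberProduct β γ A B) {S : K →L[ℂ] L}
    (hS : S ∈ intertwiners ψ) (hS' : IsSemiMorphism γ μ S) :
    mapRight β γ μ ψ x ∘L idTensor β γ μ S = idTensor β γ μ S ∘L x := by
  have hcomm : ∀ S S' : {S : K →L[ℂ] L // S ∈ intertwiners ψ ∧ IsSemiMorphism γ μ S},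
      ((idTensor β γ μ S)† ∘L idTensor β γ μ S') ∘L x =
        x ∘L ((idTensor β γ μ S)† ∘L idTensor β γ μ S') := by
    intro S S'
    have hk : ∀ ξ, ((idTensor β γ μ S)† ∘L idTensor β γ μ S') ∘L ket1 β γ ξ =
        ket1 β γ ξ ∘L ((S : K →L[ℂ] L)† ∘L (S' : K →L[ℂ] L)) := fun ξ => by
      rw [comp_assoc, idTensor_comp_ket1 β γ μ (fun c hc => S'.2.2.comp_rho hc), ← comp_assoc,
        adjoint_idTensor_comp_ket1 β γ μ S.2.2, comp_assoc]
    have hB : ∀ a ∈ B, ((S : K →L[ℂ] L)† ∘L (S' : K →L[ℂ] L)) ∘L a =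
        a ∘L ((S : K →L[ℂ] L)† ∘L (S' : K →L[ℂ] L)) := fun a ha => by
      have e1 := S'.2.1 ⟨a, ha⟩
      have e2 := congrArg ContinuousLinearMap.adjoint (S.2.1 (star ⟨a, ha⟩))
      rw [adjoint_comp, adjoint_comp, map_star, star_eq_adjoint, adjoint_adjoint] at e2
      have e3 : (((star (⟨a, ha⟩ : B) : B) : K →L[ℂ] K))† = a := adjoint_adjoint a
      rw [e3] at e2
      rw [comp_assoc, e1, ← comp_assoc, ← e2, comp_assoc]
    refine eq_of_comp_eq (ket1_total β γ) fun ξ => ?_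
    set Q := (idTensor β γ μ S)† ∘L idTensor β γ μ S'
    set q := (S : K →L[ℂ] L)† ∘L (S' : K →L[ℂ] L)
    have h0 : x ∘L ket1 β γ ξ ∈ LinearMap.ker
        ((compL ℂ K (RTP β γ) (RTP β γ) Q - (compL ℂ K K (RTP β γ)).flip q :
          (K →L[ℂ] RTP β γ) →L[ℂ] (K →L[ℂ] RTP β γ)) :
            (K →L[ℂ] RTP β γ) →ₗ[ℂ] (K →L[ℂ] RTP β γ)) := by
      refine cspan_le (ContinuousLinearMap.isClosed_ker _) ?_ ((hx.1 ξ).1)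
      rintro _ ⟨ξ', a, ha, rfl⟩
      show Q ∘L (ket1 β γ ξ' ∘L a) - (ket1 β γ ξ' ∘L a) ∘L q = 0
      rw [← comp_assoc, hk, comp_assoc, hB a ha, comp_assoc, sub_self]
    have h1 : Q ∘L (x ∘L ket1 β γ ξ) - (x ∘L ket1 β γ ξ) ∘L q = 0 := h0
    rw [comp_assoc, sub_eq_zero.1 h1, comp_assoc, ← hk]
    rfl
  refine extendFam_comp
    (fun S : {S : K →L[ℂ] L // S ∈ intertwiners ψ ∧ IsSemiMorphism γ μ S} =>
      idTensor β γ μ S)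
    (fun S : {S : K →L[ℂ] L // S ∈ intertwiners ψ ∧ IsSemiMorphism γ μ S} =>
      idTensor β γ μ S ∘L x) x ?_ (fun i j => ?_) ⟨S, hS, hS'⟩
  · rw [← top_le_iff, ← tmul_total β μ]
    refine cspan_le (isClosed_cspan _) ?_
    rintro _ ⟨⟨ξ, l⟩, ζ, rfl⟩
    have e : tmul β μ ξ l ζ = ket1 β μ ξ ((l : 𝔎 →L[ℂ] L) ζ) :=
      (DFunLike.congr_fun (ket1_comp β μ ξ l) ζ).symm
    show tmul β μ ξ l ζ ∈ _
    rw [e]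
    refine map_mem_of_mem_cspan ((ket1 β μ ξ).comp (ContinuousLinearMap.apply ℂ L ζ))
      (isClosed_cspan _) ?_ (hψ l.2)
    rintro _ ⟨T, hT, hT', η, hη, rfl⟩
    refine mem_cspan ⟨⟨T, hT, hT'⟩, ket1 β γ ξ (η ζ), ?_⟩
    exact DFunLike.congr_fun
      (idTensor_comp_ket1 β γ μ (fun c hc => hT'.comp_rho hc) ξ) (η ζ)
  · rw [adjoint_comp, comp_assoc, ← comp_assoc _ _ x, hcomm, ← comp_assoc]

end fiber

/-! ### Hopf `C*`-bimodules -/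

/-- A normal (concrete) Hopf `C*`-bimodule over the `C*`-base `𝔟`, on the
`C*`-`(𝔟†, 𝔟)`-module `(H, β, α)`: a `C*`-`(𝔟†, 𝔟)`-algebra `alg` on `(H, β, α)` with a
coassociative jointly normal morphism `comul` into its fiber product with itself. -/
structure NormalHopfBimodule {𝔎 : Type u} [NormedAddCommGroup 𝔎] [InnerProductSpace ℂ 𝔎]
    [CompleteSpace 𝔎] (b : CStarBase 𝔎) {H : Type v} [NormedAddCommGroup H]
    [InnerProductSpace ℂ H] [CompleteSpace H] (β : BaseModule b.op H) (α : BaseModule b H)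
    (hβα : β.Preserves α) (hαβ : α.Preserves β) where
  alg : NonUnitalStarSubalgebra ℂ (H →L[ℂ] H)
  isClosed_alg : IsClosed (alg : Set (H →L[ℂ] H))
  rho_mul_mem_left : ∀ c ∈ b.alg, ∀ a ∈ alg, β.rho c ∘L a ∈ alg
  rho_mul_mem_right : ∀ c ∈ b.dual, ∀ a ∈ alg, α.rho c ∘L a ∈ alg
  comul : alg →⋆ₙₐ[ℂ] (RTP α β →L[ℂ] RTP α β)
  comul_mem : ∀ a, comul a ∈ fiberProduct α β alg alg
  normal_left : cspan {T : 𝔎 →L[ℂ] RTP α β | ∃ S ∈ intertwiners comul,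
      IsMorphism β (ltri β α β hαβ) S ∧ IsMorphism α (rtri α β α hβα) S ∧
      ∃ ξ ∈ β.space, S ∘L ξ = T} = (ltri β α β hαβ).space
  normal_right : cspan {T : 𝔎 →L[ℂ] RTP α β | ∃ S ∈ intertwiners comul,
      IsMorphism β (ltri β α β hαβ) S ∧ IsMorphism α (rtri α β α hβα) S ∧
      ∃ ξ ∈ α.space, S ∘L ξ = T} = (rtri α β α hβα).space
  coassoc : ∀ a,
    assoc α β α β hβα hαβ ∘L mapLeft α (rtri α β α hβα) β comul (comul a) =
      mapRight α β (ltri β α β hαβ) comul (comul a) ∘L assoc α β α β hβα hαβ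

/-! ### `C*`-pseudo-multiplicative unitaries -/

/-- The structure `(β̂, α, β)` of a `C*`-`(𝔟†, 𝔟, 𝔟†)`-module on `H`. -/
structure TriModule {𝔎 : Type u} [NormedAddCommGroup 𝔎] [InnerProductSpace ℂ 𝔎]
    [CompleteSpace 𝔎] (b : CStarBase 𝔎) (H : Type v) [NormedAddCommGroup H]
    [InnerProductSpace ℂ H] [CompleteSpace H] where
  βhat : BaseModule b.op H
  α : BaseModule b H
  β : BaseModule b.op H
  βhat_α : βhat.Preserves α
  βhat_β : βhat.Preserves β
  α_βhat : α.Preserves βhat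
  α_β : α.Preserves β
  β_βhat : β.Preserves βhat
  β_α : β.Preserves α

section PMU

variable {𝔎 : Type u} [NormedAddCommGroup 𝔎] [InnerProductSpace ℂ 𝔎] [CompleteSpace 𝔎]
  {b : CStarBase 𝔎}
  {H : Type v} [NormedAddCommGroup H] [InnerProductSpace ℂ H] [CompleteSpace H]

namespace TriModule

/-- The space `H ⊗ H` formed with respect to `β̂` and `α`, over `𝔟†`. -/
abbrev Source (M : TriModule b H) : Type (max u v) := RTP (b := b.op) M.βhat M.α

/-- The space `H ⊗ H` formed with respect to `α` and `β`, over `𝔟`. -/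
abbrev Target (M : TriModule b H) : Type (max u v) := RTP M.α M.β

/-- The relations `V(α ◁ α) = α ▷ α`, `V(β̂ ▷ β) = β̂ ◁ β`, `V(β̂ ▷ β̂) = α ▷ β̂` and
`V(β ◁ α) = β ◁ β`. -/
def Intertwines (M : TriModule b H) (V : M.Source →L[ℂ] M.Target) : Prop :=
  MapsOnto (ltri (b := b.op) M.α M.βhat M.α M.βhat_α) (rtri M.α M.β M.α M.β_α) V ∧
  MapsOnto (rtri (b := b.op) M.βhat M.α M.β M.α_β) (ltri M.βhat M.α M.β M.α_βhat) V ∧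
  MapsOnto (rtri (b := b.op) M.βhat M.α M.βhat M.α_βhat) (rtri M.α M.β M.βhat M.β_βhat) V ∧
  MapsOnto (ltri (b := b.op) M.β M.βhat M.α M.βhat_β) (ltri M.β M.α M.β M.α_β) V

/-- The pentagon equation `V₂₃ V₁₂ = V₁₂ V₁₃ V₂₃` with `V₁₃ = Σ₂₃ (V ⊗ Id)(Id ⊗ Σ)`, as an
equality of operators from `(H ⊗ H) ⊗ H` (formed with respect to `β̂, α` and `β̂ ▷ β̂, α`) to
`H ⊗ (H ⊗ H)` (formed with respect to `α, β ◁ β` and `α, β`). -/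
def Pentagon (M : TriModule b H) (V : M.Source →L[ℂ] M.Target) : Prop :=
  idTensor M.α (ltri (b := b.op) M.β M.βhat M.α M.βhat_β) (ltri M.β M.α M.β M.α_β) V ∘L
    assoc (d := b.op) M.α M.β M.βhat M.α M.β_βhat M.βhat_β ∘L
    tensorId (b := b.op) (rtri (b := b.op) M.βhat M.α M.βhat M.α_βhat)
      (rtri M.α M.β M.βhat M.β_βhat) M.α V =
  assoc M.α M.β M.α M.β M.β_α M.α_β ∘L
    tensorId (ltri (b := b.op) M.α M.βhat M.α M.βhat_α) (rtri M.α M.β M.α M.β_α) M.β V ∘L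
    sigma23 (d := b.op) M.α M.β M.βhat M.α M.α_βhat M.βhat_α ∘L
    tensorId (b := b.op) (rtri (b := b.op) M.βhat M.α M.β M.α_β)
      (ltri M.βhat M.α M.β M.α_βhat) M.α V ∘L
    assocSymm (b := b.op) (d := b.op) M.βhat M.α M.β M.α M.α_β M.β_α ∘L
    idTensor (b := b.op) M.βhat (rtri M.α M.β M.α M.β_α)
      (ltri (b := b.op) M.α M.β M.α M.β_α) (flip M.α M.β) ∘L
    idTensor (b := b.op) M.βhat (ltri (b := b.op) M.α M.βhat M.α M.βhat_α)
      (rtri M.α M.β M.α M.β_α) V ∘L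
    assoc (b := b.op) (d := b.op) M.βhat M.α M.βhat M.α M.α_βhat M.βhat_α

end TriModule

variable (b H) in
/-- A `C*`-pseudo-multiplicative unitary `(𝔟, H, β̂, α, β, V)`. -/
structure PseudoMultUnitary extends TriModule b H where
  V : toTriModule.Source ≃ₗᵢ[ℂ] toTriModule.Target
  intertwines : toTriModule.Intertwines V.toContinuousLinearEquiv.toContinuousLinearMap
  pentagon : toTriModule.Pentagon V.toContinuousLinearEquiv.toContinuousLinearMap

namespace PseudoMultUnitary

variable (P : PseudoMultUnitary b H)

/-- `V` as a bounded operator. -/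
abbrev op : P.Source →L[ℂ] P.Target := P.V.toContinuousLinearEquiv.toContinuousLinearMap

/-- `Â_V = [⟨β|₂ V |α⟩₂]`. -/
def legHat : Submodule ℂ (H →L[ℂ] H) :=
  cspan {T | ∃ (η : P.β.space) (ξ : P.α.space),
    (ket2 P.α P.β η)† ∘L P.op ∘L ket2 (b := b.op) P.βhat P.α ξ = T}

/-- `A_V = [⟨α|₁ V |β̂⟩₁]`. -/
def leg : Submodule ℂ (H →L[ℂ] H) :=
  cspan {T | ∃ (η : P.α.space) (ξ : P.βhat.space),
    (ket1 P.α P.β η)† ∘L P.op ∘L ket1 (b := b.op) P.βhat P.α ξ = T}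

/-- `C_V = [⟨α|₁ V |α⟩₂]`. -/
def cSpace : Submodule ℂ (H →L[ℂ] H) :=
  cspan {T | ∃ (η : P.α.space) (ξ : P.α.space),
    (ket1 P.α P.β η)† ∘L P.op ∘L ket2 (b := b.op) P.βhat P.α ξ = T}

/-- `V` is semi-regular if `C_V ⊇ [α α*]`. -/
def SemiRegular : Prop :=
  cspan {T : H →L[ℂ] H | ∃ ξ ∈ P.α.space, ∃ ξ' ∈ P.α.space, ξ ∘L ξ'† = T} ≤ P.cSpace

/-- The map `Δ̂_V : y ↦ V* (Id ⊗ y) V` on the commutant of `ρ_β(𝔅)`. -/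
def comulHat (y : Set.centralizer (P.β.rho '' (b.alg : Set (𝔎 →L[ℂ] 𝔎)))) :
    P.Source →L[ℂ] P.Source :=
  P.op† ∘L idTensor P.α P.β P.β y ∘L P.op

/-- The map `Δ_V : z ↦ V (z ⊗ Id) V*` on the commutant of `ρ_β̂(𝔅)`. -/
def comul (z : Set.centralizer (P.βhat.rho '' (b.alg : Set (𝔎 →L[ℂ] 𝔎)))) :
    P.Target →L[ℂ] P.Target :=
  P.op ∘L tensorId (b := b.op) P.βhat P.βhat P.α z ∘L P.op†

end PseudoMultUnitary

end PMU

end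

end CStarPMU

/-!
The proof reduces everything to the slices `⟨a|₁ V |x⟩₂`, `⟨η|₂ V |x⟩₂` and `⟨a|₁ V |z⟩₁` of `V`,
which generate `C_V`, `Â_V` and `A_V`, and to the pentagon equation in sliced form. Cancelling
isometries in `V₂₃ V₁₂ = V₁₂ V₁₃ V₂₃` expresses the conjugates `V (Id ⊗ c) V*` and `V* (c ⊗ Id) V`
of a generator `c` of `C_V` by products of an operator built from the first two tensor factors with
one built from the last two (`op_comp_idTensor_cElt`, `adjoint_op_comp_tensorId_cElt`).
Slicing once more shows, for `c ∈ C_V`: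

* `⟨α|₁ V (Id ⊗ c) V* |α⟩₁` and `⟨α|₂ V* (c ⊗ Id) V |α⟩₂` lie in `C_V`;
* the slices `⟨β|₂ V (Id ⊗ c) V* |β⟩₂` span the adjoint of `Â_V`, and the slices
  `⟨β̂|₁ V* (c ⊗ Id) V |β̂⟩₁` span the adjoint of `A_V`.

Semi-regularity allows `c = ξ ξ'*` with `ξ, ξ' ∈ α`. For such `c` the tensor factors split, and the
first item becomes `C_V C_V* ⊆ C_V` and `C_V* C_V ⊆ C_V`. A closed subspace with these two
properties is self-adjoint (`star_mem_of_mul_star_mem`), so `C_V* = C_V`. As taking the adjoint of a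
slice amounts to replacing `c` by `c*`, the second item now shows that `Â_V` and `A_V` are
self-adjoint, and for `c = ξ ξ'*` that they are closed under products.

For the Hopf structure, slicing the pentagon equation also gives
`V* (Id ⊗ ⟨η|₂ V |y⟩₂) V = ⟨η|₃ V₁₃ (Id ⊗ V |y⟩₂)` and a similar formula for the conjugates
`V (a ⊗ Id) V*`, from which membership in the fiber products can be read off, since `V` maps the
distinguished module structures onto each other. The operators `V* |ξ⟩₁` intertwine `Δ̂_V` and the
operators `V |ξ⟩₂` intertwine `Δ_V`; they are morphisms with the right spans, which is joint
normality. They also determine `Δ ∗ Id` and `Id ∗ Δ`. Testing on them, both sides of the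
coassociativity equation turn out to be the conjugate of `Id ⊗ Id ⊗ a`, respectively `a ⊗ Id ⊗ Id`,
by the operator `V₁₂ V₁₃ V₂₃`.
-/

namespace CStarPMU

noncomputable section

universe u v w x y

open scoped InnerProduct
open ContinuousLinearMap

/-! ### Self-adjointness of a subspace `N` of a `C*`-algebra with `N N* ⊆ N` and `N* N ⊆ N` -/

theorem mul_one_sub_pow_le {x : ℝ} (h0 : 0 ≤ x) (h1 : x ≤ 1) (n : ℕ) :
    x * (1 - x) ^ n ≤ 1 / (n + 1) := by
  have hB : 1 + ((n : ℝ) + 1) * x ≤ (1 + x) ^ (n + 1) := by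
    have := one_add_mul_le_pow (a := x) (by linarith) (n + 1)
    exact_mod_cast this
  have h2 : (1 - x) ^ n * (1 + x) ^ n ≤ 1 := by
    rw [← mul_pow]
    exact pow_le_one₀ (by nlinarith) (by nlinarith)
  have h3 : 0 ≤ (1 - x) ^ n := pow_nonneg (by linarith) n
  have h4 : 1 + (n : ℝ) * x ≤ (1 + x) ^ n := one_add_mul_le_pow (by linarith) n
  rw [le_div_iff₀ (by positivity)]
  have h5 : (1 - x) ^ n * (1 + n * x) ≤ 1 := (mul_le_mul_of_nonneg_left h4 h3).trans h2
  have h6 : (1 - x) ^ n ≤ 1 := pow_le_one₀ (by linarith) (by linarith)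
  nlinarith

theorem one_sub_smul_pow_mul_mul_pow {A : Type u} [CStarAlgebra A] {h : A}
    (hsa : IsSelfAdjoint h) (m : ℝ) (n : ℕ) :
    (1 - m • h) ^ n * h * (1 - m • h) ^ n =
      cfc (fun t : ℝ => (1 - m * t) ^ n * t * (1 - m * t) ^ n) h := by
  have c1 : ContinuousOn (fun t : ℝ => m * t) (spectrum ℝ h) := by fun_prop
  have c2 : ContinuousOn (fun t : ℝ => 1 - m * t) (spectrum ℝ h) := by fun_prop
  have c3 : ContinuousOn (fun t : ℝ => (1 - m * t) ^ n) (spectrum ℝ h) := by fun_prop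
  have c4 : ContinuousOn (fun t : ℝ => t) (spectrum ℝ h) := by fun_prop
  have hwc : 1 - m • h = cfc (fun t : ℝ => 1 - m * t) h := by
    rw [cfc_sub (fun _ : ℝ => (1 : ℝ)) (fun t : ℝ => m * t) h continuousOn_const c1,
      cfc_const_one ℝ h hsa, cfc_const_mul m (fun t : ℝ => t) h c4, cfc_id' ℝ h hsa]
  rw [cfc_mul (fun t : ℝ => (1 - m * t) ^ n * t) (fun t : ℝ => (1 - m * t) ^ n) h (c3.mul c4) c3,
    cfc_mul (fun t : ℝ => (1 - m * t) ^ n) (fun t : ℝ => t) h c3 c4,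
    cfc_pow (fun t : ℝ => 1 - m * t) n h c2 hsa, ← hwc, cfc_id' ℝ h hsa]

/-- A closed subspace `N` of a `C*`-algebra with `N N* ⊆ N` and `N* N ⊆ N` is self-adjoint: for
`c ∈ N`, the element `h = c* c` of `N` yields polynomials `p` without constant term such that
`p(h) c*`, an element of `N N*`, approximates `c*`. -/
theorem star_mem_of_mul_star_mem {A : Type u} [CStarAlgebra A] {N : Submodule ℂ A}
    (hN : IsClosed (N : Set A)) (h1 : ∀ x ∈ N, ∀ y ∈ N, x * star y ∈ N)
    (h2 : ∀ x ∈ N, ∀ y ∈ N, star x * y ∈ N) {c : A} (hc : c ∈ N) : star c ∈ N := by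
  rcases eq_or_ne c 0 with rfl | hc0
  · simp
  set h : A := star c * c with hh
  set M : ℝ := ‖h‖ with hM
  have hM0 : 0 < M := norm_pos_iff.2 (by rw [hh]; simpa using hc0)
  have hsa : IsSelfAdjoint h := IsSelfAdjoint.star_mul_self c
  set w : A := ((M⁻¹ : ℝ) : ℂ) • h with hw
  have hwN : w ∈ N := N.smul_mem _ (h2 c hc c hc)
  have hwsa : star w = w := by
    rw [hw, star_smul, hsa.star_eq]
    simp
  have hp : ∀ n : ℕ, 1 - (1 - w) ^ n ∈ N := by
    intro n
    induction n with
    | zero => simp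
    | succ n ih =>
      have e : 1 - (1 - w) ^ (n + 1) = (1 - (1 - w) ^ n) + w - (1 - (1 - w) ^ n) * star w := by
        rw [hwsa, pow_succ]
        noncomm_ring
      rw [e]
      exact N.sub_mem (N.add_mem ih hwN) (h1 _ ih _ hwN)
  have hq : ∀ n : ℕ, (1 - (1 - w) ^ n) * star c ∈ N := fun n => h1 _ (hp n) _ hc
  refine hN.mem_of_tendsto (b := Filter.atTop) (f := fun n : ℕ => (1 - (1 - w) ^ n) * star c) ?_
    (Filter.Eventually.of_forall hq)
  -- by the `C*`-identity, this is the norm of a continuous function of `h`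
  have hnorm : ∀ n : ℕ,
      ‖(1 - (1 - w) ^ n) * star c - star c‖ ^ 2 ≤ M * (1 / ((n + n : ℕ) + 1)) := by
    intro n
    have e1 : (1 - (1 - w) ^ n) * star c - star c = -((1 - w) ^ n * star c) := by noncomm_ring
    have hs : star ((1 - w) ^ n) = (1 - w) ^ n := by rw [star_pow, star_sub, star_one, hwsa]
    have e2 : ((1 - w) ^ n * star c) * star ((1 - w) ^ n * star c) =
        (1 - w) ^ n * h * (1 - w) ^ n := by
      rw [star_mul, star_star, hs, hh]
      simp only [mul_assoc]
    have e3 : (1 - w) ^ n * h * (1 - w) ^ n =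
        cfc (fun t : ℝ => (1 - M⁻¹ * t) ^ n * t * (1 - M⁻¹ * t) ^ n) h := by
      have hw' : w = M⁻¹ • h := by
        rw [hw]
        exact Complex.coe_smul _ _
      rw [hw']
      exact one_sub_smul_pow_mul_mul_pow hsa _ n
    rw [e1, norm_neg, sq, ← CStarRing.norm_self_mul_star, e2, e3]
    refine norm_cfc_le (by positivity) fun t ht => ?_
    have ht0 : 0 ≤ t := by
      let := CStarAlgebra.spectralOrder A
      let := CStarAlgebra.spectralOrderedRing A
      exact spectrum_nonneg_of_nonneg (star_mul_self_nonneg c) ht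
    have : Nontrivial A := ⟨c, 0, hc0⟩
    have : NormOneClass A := ⟨CStarRing.norm_one⟩
    have htM : t ≤ M := (le_abs_self t).trans (by simpa using spectrum.norm_le_norm_of_mem ht)
    have hx0 : 0 ≤ M⁻¹ * t := by positivity
    have hx1 : M⁻¹ * t ≤ 1 := by
      rw [inv_mul_le_iff₀ hM0]; simpa using htM
    have e4 : (1 - M⁻¹ * t) ^ n * t * (1 - M⁻¹ * t) ^ n =
        M * (M⁻¹ * t * (1 - M⁻¹ * t) ^ (n + n)) := by
      rw [pow_add]; field_simp
    rw [e4, Real.norm_of_nonneg (by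
      have : 0 ≤ 1 - M⁻¹ * t := by linarith
      positivity)]
    exact mul_le_mul_of_nonneg_left (mul_one_sub_pow_le hx0 hx1 _) hM0.le
  have hlim : Filter.Tendsto (fun n : ℕ => M * (1 / (((n + n : ℕ) : ℝ) + 1))) Filter.atTop
      (nhds 0) := by
    have h5 : Filter.Tendsto (fun n : ℕ => n + n) Filter.atTop Filter.atTop :=
      Filter.tendsto_atTop_mono (fun n => Nat.le_add_left n n) Filter.tendsto_id
    have := (tendsto_one_div_add_atTop_nhds_zero_nat (𝕜 := ℝ)).comp h5
    simpa using this.const_mul M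
  rw [tendsto_iff_norm_sub_tendsto_zero]
  have h6 := squeeze_zero (fun n => sq_nonneg _) hnorm hlim
  have h7 := (Real.continuous_sqrt.tendsto 0).comp h6
  simpa [Function.comp_def, Real.sqrt_sq (norm_nonneg _)] using h7

/-! ### Closed spans -/

/-- A bounded map that is linear on a closed subspace `D` only: membership of its values in a
closed subspace passes from a generating set contained in `D` to the closed span. -/
theorem map_mem_of_mem_cspan_of_linearOn {σ : ℂ →+* ℂ} [RingHomSurjective σ]
    {E : Type u} [NormedAddCommGroup E] [NormedSpace ℂ E]
    {F : Type v} [NormedAddCommGroup F] [NormedSpace ℂ F] (f : E → F) {D : Submodule ℂ E}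
    (hD : IsClosed (D : Set E)) (hadd : ∀ x ∈ D, ∀ y ∈ D, f (x + y) = f x + f y)
    (hsmul : ∀ (r : ℂ), ∀ x ∈ D, f (r • x) = σ r • f x) {C : ℝ} (hC : ∀ x ∈ D, ‖f x‖ ≤ C * ‖x‖)
    {N : Submodule ℂ F} (hN : IsClosed (N : Set F)) {s : Set E}
    (hs : ∀ x ∈ s, x ∈ D ∧ f x ∈ N) {x : E} (hx : x ∈ cspan s) : x ∈ D ∧ f x ∈ N := by
  let g : D →SL[σ] F := LinearMap.mkContinuous
    { toFun := fun x => f x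
      map_add' := fun x y => hadd x x.2 y y.2
      map_smul' := fun r x => hsmul r x x.2 } C (fun x => hC x x.2)
  have hcl : IsClosed ((((N.comap (g : D →ₛₗ[σ] F)).map D.subtype : Submodule ℂ E)) : Set E) := by
    rw [Submodule.map_coe]
    exact hD.isClosedMap_subtype_val _ (hN.preimage g.continuous)
  have hle : cspan s ≤ (N.comap (g : D →ₛₗ[σ] F)).map D.subtype :=
    cspan_le hcl fun x hx => ⟨⟨x, (hs x hx).1⟩, (hs x hx).2, rfl⟩
  obtain ⟨z, hz, rfl⟩ := hle hx
  exact ⟨z.2, hz⟩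

section sandwich

variable {V : Type u} {T : Type v} {T' : Type w} {W : Type x}
  [NormedAddCommGroup V] [InnerProductSpace ℂ V] [CompleteSpace V]
  [NormedAddCommGroup T] [InnerProductSpace ℂ T] [CompleteSpace T]
  [NormedAddCommGroup T'] [InnerProductSpace ℂ T'] [CompleteSpace T']
  [NormedAddCommGroup W] [InnerProductSpace ℂ W] [CompleteSpace W]

/-- The bounded linear map `R ↦ A R B`. -/
def sandwich (A : T →L[ℂ] T') (B : V →L[ℂ] W) : (W →L[ℂ] T) →L[ℂ] (V →L[ℂ] T') :=
  (compL ℂ V T T' A).comp ((compL ℂ V W T).flip B)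

theorem sandwich_apply (A : T →L[ℂ] T') (B : V →L[ℂ] W) (R : W →L[ℂ] T) :
    sandwich A B R = A ∘L R ∘L B := rfl

/-- The bounded conjugate-linear map `R ↦ A R* B`. -/
def sandwichAdjoint (A : T →L[ℂ] T') (B : V →L[ℂ] W) :
    (T →L[ℂ] W) →L⋆[ℂ] (V →L[ℂ] T') :=
  (sandwich A B).comp (ContinuousLinearMap.adjoint (𝕜 := ℂ) (E := T)
    (F := W)).toContinuousLinearEquiv.toContinuousLinearMap

theorem sandwichAdjoint_apply (A : T →L[ℂ] T') (B : V →L[ℂ] W) (R : T →L[ℂ] W) :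
    sandwichAdjoint A B R = A ∘L R† ∘L B := rfl

end sandwich

theorem adjoint_mem_of_mem_cspan {H : Type u} {K : Type v}
    [NormedAddCommGroup H] [InnerProductSpace ℂ H] [CompleteSpace H]
    [NormedAddCommGroup K] [InnerProductSpace ℂ K] [CompleteSpace K]
    {s : Set (H →L[ℂ] K)} {N : Submodule ℂ (K →L[ℂ] H)}
    (hN : IsClosed (N : Set (K →L[ℂ] H))) (h : ∀ S ∈ s, S† ∈ N)
    {S : H →L[ℂ] K} (hS : S ∈ cspan s) : S† ∈ N :=
  map_mem_of_mem_cspan (ContinuousLinearMap.adjoint (𝕜 := ℂ) (E := H)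
    (F := K)).toContinuousLinearEquiv.toContinuousLinearMap hN h hS

theorem comp_adjoint_mem_of_mem_cspan {H : Type u} {K : Type v} {L : Type w}
    [NormedAddCommGroup H] [InnerProductSpace ℂ H] [CompleteSpace H]
    [NormedAddCommGroup K] [InnerProductSpace ℂ K] [CompleteSpace K]
    [NormedAddCommGroup L] [InnerProductSpace ℂ L] [CompleteSpace L]
    {s : Set (K →L[ℂ] L)} {t : Set (K →L[ℂ] H)} {N : Submodule ℂ (H →L[ℂ] L)}
    (hN : IsClosed (N : Set (H →L[ℂ] L))) (h : ∀ S ∈ s, ∀ T ∈ t, S ∘L T† ∈ N)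
    {S : K →L[ℂ] L} (hS : S ∈ cspan s) {T : K →L[ℂ] H} (hT : T ∈ cspan t) : S ∘L T† ∈ N :=
  map_mem_of_mem_cspan (sandwichAdjoint S (ContinuousLinearMap.id ℂ H)) hN
    (fun T hT => map_mem_of_mem_cspan ((compL ℂ H K L).flip (T†)) hN (fun S hS => h S hS T hT) hS)
    hT

theorem adjoint_comp_mem_of_mem_cspan {H : Type u} {K : Type v} {L : Type w}
    [NormedAddCommGroup H] [InnerProductSpace ℂ H] [CompleteSpace H]
    [NormedAddCommGroup K] [InnerProductSpace ℂ K] [CompleteSpace K]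
    [NormedAddCommGroup L] [InnerProductSpace ℂ L] [CompleteSpace L]
    {s : Set (L →L[ℂ] K)} {t : Set (H →L[ℂ] K)} {N : Submodule ℂ (H →L[ℂ] L)}
    (hN : IsClosed (N : Set (H →L[ℂ] L))) (h : ∀ S ∈ s, ∀ T ∈ t, S† ∘L T ∈ N)
    {S : L →L[ℂ] K} (hS : S ∈ cspan s) {T : H →L[ℂ] K} (hT : T ∈ cspan t) : S† ∘L T ∈ N :=
  map_mem_of_mem_cspan (compL ℂ H K L (S†)) hN
    (fun T hT => map_mem_of_mem_cspan (sandwichAdjoint (ContinuousLinearMap.id ℂ L) T) hN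
      (fun S hS => h S hS T hT) hS) hT

/-- Associativity of composition, with a proof other than `rfl`: `simp` then rewrites with it
instead of appealing to definitional equality, which is expensive to check for composites of
operators on iterated tensor products. -/
theorem comp_assoc_nondefeq {E : Type*} {F : Type*} {G : Type*} {K : Type*}
    [NormedAddCommGroup E] [InnerProductSpace ℂ E] [NormedAddCommGroup F] [InnerProductSpace ℂ F]
    [NormedAddCommGroup G] [InnerProductSpace ℂ G] [NormedAddCommGroup K] [InnerProductSpace ℂ K]
    (h : G →L[ℂ] K) (g : F →L[ℂ] G) (f : E →L[ℂ] F) : (h ∘L g) ∘L f = h ∘L (g ∘L f) := by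
  ext
  simp only [comp_apply]

section isometry

variable {ι : Type w} {V : Type u} {T : Type v} {T' : Type x}
  [NormedAddCommGroup V] [InnerProductSpace ℂ V] [CompleteSpace V]
  [NormedAddCommGroup T] [InnerProductSpace ℂ T] [CompleteSpace T]
  [NormedAddCommGroup T'] [InnerProductSpace ℂ T'] [CompleteSpace T']

/-- An operator that preserves the inner products of a total family of operators is an isometry. -/
theorem adjoint_comp_self_eq_id {f : ι → V →L[ℂ] T} {g : ι → V →L[ℂ] T'}
    (hf : cspan {t : T | ∃ i z, f i z = t} = ⊤) {R : T →L[ℂ] T'} (hR : ∀ i, R ∘L f i = g i)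
    (h : ∀ i j, (g i)† ∘L g j = (f i)† ∘L f j) : R† ∘L R = ContinuousLinearMap.id ℂ T := by
  refine eq_of_comp_eq hf fun j => ContinuousLinearMap.adjoint.injective
    (eq_of_comp_eq hf fun i => ?_)
  rw [id_comp, ← adjoint_adjoint (f i), ← adjoint_comp, ← adjoint_comp]
  congr 1
  rw [← h i j, ← hR i, ← hR j, adjoint_comp, comp_assoc, comp_assoc]

end isometry

/-! ### Operators intertwining the representations `ρ` -/

section intertwiner

variable {𝔎 : Type u} [NormedAddCommGroup 𝔎] [InnerProductSpace ℂ 𝔎] [CompleteSpace 𝔎]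
  {b : CStarBase 𝔎}
  {𝔎' : Type y} [NormedAddCommGroup 𝔎'] [InnerProductSpace ℂ 𝔎'] [CompleteSpace 𝔎']
  {d : CStarBase 𝔎'}
  {H : Type v} [NormedAddCommGroup H] [InnerProductSpace ℂ H] [CompleteSpace H]
  {K : Type w} [NormedAddCommGroup K] [InnerProductSpace ℂ K] [CompleteSpace K]
  {L : Type x} [NormedAddCommGroup L] [InnerProductSpace ℂ L] [CompleteSpace L]

/-- `S` intertwines the representations `ρ_α` and `ρ_γ` of `𝔅†`. -/
def IsIntertwiner (α : BaseModule b H) (γ : BaseModule b K) (S : H →L[ℂ] K) : Prop :=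
  ∀ c ∈ b.dual, S ∘L α.rho c = γ.rho c ∘L S

theorem adjoint_mem_dual {c : 𝔎 →L[ℂ] 𝔎} (hc : c ∈ b.dual) : c† ∈ b.dual :=
  star_mem (S := NonUnitalStarSubalgebra ℂ (𝔎 →L[ℂ] 𝔎)) hc

theorem adjoint_mem_alg {c : 𝔎 →L[ℂ] 𝔎} (hc : c ∈ b.alg) : c† ∈ b.alg :=
  star_mem (S := NonUnitalStarSubalgebra ℂ (𝔎 →L[ℂ] 𝔎)) hc

theorem BaseModule.rho_adjoint (α : BaseModule b H) {c : 𝔎 →L[ℂ] 𝔎} (hc : c ∈ b.dual) :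
    (α.rho c)† = α.rho (c†) := by
  refine (α.rho_unique (adjoint_mem_dual hc) fun ξ hξ =>
    ContinuousLinearMap.adjoint.injective (eq_of_comp_eq α.total' fun ξ' => ?_)).symm
  rw [adjoint_comp, adjoint_adjoint, comp_assoc, α.rho_comp hc ξ'.2, adjoint_comp,
    adjoint_adjoint, ← comp_assoc, comp_assoc]
  exact b.commute _ (α.inner_mem hξ ξ'.2) _ hc

theorem IsIntertwiner.adjoint {α : BaseModule b H} {γ : BaseModule b K} {S : H →L[ℂ] K}
    (hS : IsIntertwiner α γ S) : IsIntertwiner γ α (S†) := by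
  intro c hc
  have h := congrArg ContinuousLinearMap.adjoint (hS _ (adjoint_mem_dual hc))
  rw [adjoint_comp, adjoint_comp, α.rho_adjoint (adjoint_mem_dual hc),
    γ.rho_adjoint (adjoint_mem_dual hc), adjoint_adjoint] at h
  exact h.symm

theorem IsIntertwiner.comp {α : BaseModule b H} {γ : BaseModule b K} {ε : BaseModule b L}
    {S : H →L[ℂ] K} {R : K →L[ℂ] L} (hR : IsIntertwiner γ ε R) (hS : IsIntertwiner α γ S) :
    IsIntertwiner α ε (R ∘L S) := by
  intro c hc
  rw [comp_assoc, hS c hc, ← comp_assoc, hR c hc, comp_assoc]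

theorem isIntertwiner_id (α : BaseModule b H) :
    IsIntertwiner α α (ContinuousLinearMap.id ℂ H) := fun _ _ => rfl

theorem IsIntertwiner.add {α : BaseModule b H} {γ : BaseModule b K} {S R : H →L[ℂ] K}
    (hS : IsIntertwiner α γ S) (hR : IsIntertwiner α γ R) : IsIntertwiner α γ (S + R) := by
  intro c hc
  rw [add_comp, hS c hc, hR c hc, comp_add]

theorem IsIntertwiner.smul {α : BaseModule b H} {γ : BaseModule b K} {S : H →L[ℂ] K} (r : ℂ)
    (hS : IsIntertwiner α γ S) : IsIntertwiner α γ (r • S) := by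
  intro c hc
  rw [smul_comp, hS c hc, comp_smul]

/-- The closed space of operators that intertwine `ρ_α` and `ρ_γ`. -/
def intertwinerSpace (α : BaseModule b H) (γ : BaseModule b K) : Submodule ℂ (H →L[ℂ] K) where
  carrier := {S | IsIntertwiner α γ S}
  add_mem' hS hR := hS.add hR
  zero_mem' c _ := by rw [zero_comp, comp_zero]
  smul_mem' r _ hS := hS.smul r

theorem isClosed_intertwinerSpace (α : BaseModule b H) (γ : BaseModule b K) :
    IsClosed (intertwinerSpace α γ : Set (H →L[ℂ] K)) := by
  have : (intertwinerSpace α γ : Set (H →L[ℂ] K)) =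
      ⋂ c ∈ b.dual, {S | S ∘L α.rho c = γ.rho c ∘L S} := by
    ext S
    simp [intertwinerSpace, IsIntertwiner]
  rw [this]
  refine isClosed_biInter fun c _ => isClosed_eq ?_ ?_
  · exact ((compL ℂ H H K).flip (α.rho c)).continuous
  · exact (compL ℂ H K K (γ.rho c)).continuous

theorem IsSemiMorphism.isIntertwiner {α : BaseModule b H} {γ : BaseModule b K} {S : H →L[ℂ] K}
    (hS : IsSemiMorphism α γ S) : IsIntertwiner α γ S := fun _ hc => hS.comp_rho hc

theorem IsSemiMorphism.comp {α : BaseModule b H} {γ : BaseModule b K} {ε : BaseModule b L}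
    {S : H →L[ℂ] K} {R : K →L[ℂ] L} (hR : IsSemiMorphism γ ε R) (hS : IsSemiMorphism α γ S) :
    IsSemiMorphism α ε (R ∘L S) := fun ξ hξ => by
  rw [comp_assoc]
  exact hR _ (hS ξ hξ)

theorem IsMorphism.comp {α : BaseModule b H} {γ : BaseModule b K} {ε : BaseModule b L}
    {S : H →L[ℂ] K} {R : K →L[ℂ] L} (hR : IsMorphism γ ε R) (hS : IsMorphism α γ S) :
    IsMorphism α ε (R ∘L S) :=
  ⟨hR.1.comp hS.1, by rw [adjoint_comp]; exact hS.2.comp hR.2⟩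

theorem IsMorphism.adjoint {α : BaseModule b H} {γ : BaseModule b K} {S : H →L[ℂ] K}
    (hS : IsMorphism α γ S) : IsMorphism γ α (S†) :=
  ⟨hS.2, by rw [adjoint_adjoint]; exact hS.1⟩

theorem BaseModule.Preserves.isSemiMorphism {β : BaseModule b H} {α : BaseModule d H}
    (h : β.Preserves α) {c : 𝔎 →L[ℂ] 𝔎} (hc : c ∈ b.dual) : IsSemiMorphism α α (β.rho c) :=
  fun _ hξ => h.mem hc hξ

end intertwiner

/-! ### The operators `|ξ⟩₁` and `|η⟩₂` -/

section kets

variable {𝔎 : Type u} [NormedAddCommGroup 𝔎] [InnerProductSpace ℂ 𝔎] [CompleteSpace 𝔎]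
  {b : CStarBase 𝔎}
  {𝔎' : Type y} [NormedAddCommGroup 𝔎'] [InnerProductSpace ℂ 𝔎'] [CompleteSpace 𝔎']
  {d : CStarBase 𝔎'}
  {H : Type v} [NormedAddCommGroup H] [InnerProductSpace ℂ H] [CompleteSpace H]
  {K : Type w} [NormedAddCommGroup K] [InnerProductSpace ℂ K] [CompleteSpace K]
  {L : Type x} [NormedAddCommGroup L] [InnerProductSpace ℂ L] [CompleteSpace L]

theorem ket1_comp_eq_ket2_comp (β : BaseModule b H) (γ : BaseModule b.op K) (ξ : β.space)
    (η : γ.space) :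
    ket1 β γ ξ ∘L (η : 𝔎 →L[ℂ] K) = ket2 β γ η ∘L (ξ : 𝔎 →L[ℂ] H) := by
  rw [ket1_comp, ket2_comp]

theorem ket1_add (β : BaseModule b H) (γ : BaseModule b.op K) (ξ ξ' : β.space) :
    ket1 β γ (ξ + ξ') = ket1 β γ ξ + ket1 β γ ξ' := by
  refine eq_of_comp_eq γ.total' fun η => ?_
  rw [add_comp, ket1_comp_eq_ket2_comp, ket1_comp_eq_ket2_comp, ket1_comp_eq_ket2_comp,
    Submodule.coe_add, comp_add]

theorem ket1_smul (β : BaseModule b H) (γ : BaseModule b.op K) (r : ℂ) (ξ : β.space) :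
    ket1 β γ (r • ξ) = r • ket1 β γ ξ := by
  refine eq_of_comp_eq γ.total' fun η => ?_
  rw [smul_comp, ket1_comp_eq_ket2_comp, ket1_comp_eq_ket2_comp, Submodule.coe_smul, comp_smul]

theorem ket2_add (β : BaseModule b H) (γ : BaseModule b.op K) (η η' : γ.space) :
    ket2 β γ (η + η') = ket2 β γ η + ket2 β γ η' := by
  refine eq_of_comp_eq β.total' fun ξ => ?_
  rw [add_comp, ← ket1_comp_eq_ket2_comp, ← ket1_comp_eq_ket2_comp, ← ket1_comp_eq_ket2_comp,
    Submodule.coe_add, comp_add]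

theorem ket2_smul (β : BaseModule b H) (γ : BaseModule b.op K) (r : ℂ) (η : γ.space) :
    ket2 β γ (r • η) = r • ket2 β γ η := by
  refine eq_of_comp_eq β.total' fun ξ => ?_
  rw [smul_comp, ← ket1_comp_eq_ket2_comp, ← ket1_comp_eq_ket2_comp, Submodule.coe_smul,
    comp_smul]

theorem norm_ket1_le (β : BaseModule b H) (γ : BaseModule b.op K) (ξ : β.space) :
    ‖ket1 β γ ξ‖ ≤ ‖(ξ : 𝔎 →L[ℂ] H)‖ := by
  have h := γ.norm_rho_le (β.inner_mem ξ.2 ξ.2)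
  rw [← ket1_adjoint_comp_ket1, ContinuousLinearMap.norm_adjoint_comp_self,
    ContinuousLinearMap.norm_adjoint_comp_self] at h
  exact abs_le_of_sq_le_sq' (by nlinarith) (norm_nonneg _) |>.2

theorem norm_ket2_le (β : BaseModule b H) (γ : BaseModule b.op K) (η : γ.space) :
    ‖ket2 β γ η‖ ≤ ‖(η : 𝔎 →L[ℂ] K)‖ := by
  have h := β.norm_rho_le (γ.inner_mem η.2 η.2)
  rw [← ket2_adjoint_comp_ket2, ContinuousLinearMap.norm_adjoint_comp_self,
    ContinuousLinearMap.norm_adjoint_comp_self] at h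
  exact abs_le_of_sq_le_sq' (by nlinarith) (norm_nonneg _) |>.2

/-- A closed linear condition on `|ξ⟩₁` holds for all `ξ ∈ β` as soon as it holds for the
elements `ξ` of a set with closed span `β`. -/
theorem ket1_mem_of_cspan (β : BaseModule b H) (γ : BaseModule b.op K) {F : Type*}
    [NormedAddCommGroup F] [NormedSpace ℂ F] {σ : ℂ →+* ℂ}
    [RingHomSurjective σ] [RingHomIsometric σ] (Φ : (K →L[ℂ] RTP β γ) →SL[σ] F)
    {N : Submodule ℂ F} (hN : IsClosed (N : Set F)) {s : Set (𝔎 →L[ℂ] H)}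
    (hs : cspan s = β.space) (h : ∀ ξ : β.space, (ξ : 𝔎 →L[ℂ] H) ∈ s → Φ (ket1 β γ ξ) ∈ N)
    (ξ : β.space) : Φ (ket1 β γ ξ) ∈ N := by
  classical
  have key := map_mem_of_mem_cspan_of_linearOn (σ := σ)
    (fun T => if hT : T ∈ β.space then Φ (ket1 β γ ⟨T, hT⟩) else 0) β.isClosed_space
    (fun T hT T' hT' => by
      simp only [dif_pos hT, dif_pos hT', dif_pos (add_mem hT hT'), ← map_add, ← ket1_add]; rfl)
    (fun r T hT => by
      simp only [dif_pos hT, dif_pos (β.space.smul_mem r hT), ← map_smulₛₗ, ← ket1_smul]; rfl)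
    (C := ‖Φ‖) (fun T hT => by
      simp only [dif_pos hT]
      exact (Φ.le_opNorm _).trans (by gcongr; exact norm_ket1_le β γ ⟨T, hT⟩))
    hN (s := s) (fun T hT => by
      have hT' : T ∈ β.space := hs.le (mem_cspan hT)
      exact ⟨hT', by simpa only [dif_pos hT'] using h ⟨T, hT'⟩ hT⟩) (hs.ge ξ.2)
  simpa using key.2

/-- A closed linear condition on `|η⟩₂` holds for all `η ∈ γ` as soon as it holds for the
elements `η` of a set with closed span `γ`. -/
theorem ket2_mem_of_cspan (β : BaseModule b H) (γ : BaseModule b.op K) {F : Type*}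
    [NormedAddCommGroup F] [NormedSpace ℂ F] {σ : ℂ →+* ℂ}
    [RingHomSurjective σ] [RingHomIsometric σ] (Φ : (H →L[ℂ] RTP β γ) →SL[σ] F)
    {N : Submodule ℂ F} (hN : IsClosed (N : Set F)) {s : Set (𝔎 →L[ℂ] K)}
    (hs : cspan s = γ.space) (h : ∀ η : γ.space, (η : 𝔎 →L[ℂ] K) ∈ s → Φ (ket2 β γ η) ∈ N)
    (η : γ.space) : Φ (ket2 β γ η) ∈ N := by
  classical
  have key := map_mem_of_mem_cspan_of_linearOn (σ := σ)
    (fun T => if hT : T ∈ γ.space then Φ (ket2 β γ ⟨T, hT⟩) else 0) γ.isClosed_space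
    (fun T hT T' hT' => by
      simp only [dif_pos hT, dif_pos hT', dif_pos (add_mem hT hT'), ← map_add, ← ket2_add]; rfl)
    (fun r T hT => by
      simp only [dif_pos hT, dif_pos (γ.space.smul_mem r hT), ← map_smulₛₗ, ← ket2_smul]; rfl)
    (C := ‖Φ‖) (fun T hT => by
      simp only [dif_pos hT]
      exact (Φ.le_opNorm _).trans (by gcongr; exact norm_ket2_le β γ ⟨T, hT⟩))
    hN (s := s) (fun T hT => by
      have hT' : T ∈ γ.space := hs.le (mem_cspan hT)
      exact ⟨hT', by simpa only [dif_pos hT'] using h ⟨T, hT'⟩ hT⟩) (hs.ge η.2)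
  simpa using key.2

theorem isMorphism_ket1 (β : BaseModule b H) (γ : BaseModule b.op K) (δ : BaseModule d K)
    (h : γ.Preserves δ) (ξ : β.space) : IsMorphism δ (rtri β γ δ h) (ket1 β γ ξ) := by
  refine ⟨fun η hη => mem_cspan ⟨ξ, η, hη, rfl⟩, fun X hX => ?_⟩
  refine map_mem_of_mem_cspan (compL ℂ 𝔎' (RTP β γ) K ((ket1 β γ ξ)†)) δ.isClosed_space ?_ hX
  rintro _ ⟨ξ', η, hη, rfl⟩
  show (ket1 β γ ξ)† ∘L (ket1 β γ ξ' ∘L η) ∈ δ.space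
  rw [← comp_assoc, ket1_adjoint_comp_ket1]
  exact h.mem (β.inner_mem ξ.2 ξ'.2) hη

theorem isMorphism_ket2 (β : BaseModule b H) (γ : BaseModule b.op K) (δ : BaseModule d H)
    (h : β.Preserves δ) (η : γ.space) : IsMorphism δ (ltri δ β γ h) (ket2 β γ η) := by
  refine ⟨fun ξ hξ => mem_cspan ⟨η, ξ, hξ, rfl⟩, fun X hX => ?_⟩
  refine map_mem_of_mem_cspan (compL ℂ 𝔎' (RTP β γ) H ((ket2 β γ η)†)) δ.isClosed_space ?_ hX
  rintro _ ⟨η', ξ, hξ, rfl⟩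
  show (ket2 β γ η)† ∘L (ket2 β γ η' ∘L ξ) ∈ δ.space
  rw [← comp_assoc, ket2_adjoint_comp_ket2]
  exact h.mem (γ.inner_mem η.2 η'.2) hξ

theorem rho_rtri_comp_ket2 (β : BaseModule b H) (γ : BaseModule b.op K) (δ : BaseModule d K)
    (h : γ.Preserves δ) (h' : δ.Preserves γ) {c : 𝔎' →L[ℂ] 𝔎'} (hc : c ∈ d.dual) (η : γ.space) :
    (rtri β γ δ h).rho c ∘L ket2 β γ η = ket2 β γ ⟨δ.rho c ∘L η, h'.mem hc η.2⟩ := by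
  refine eq_of_comp_eq β.total' fun ξ => ?_
  rw [comp_assoc, ← ket1_comp_eq_ket2_comp, ← ket1_comp_eq_ket2_comp, ← comp_assoc,
    rho_rtri β γ δ h hc, comp_assoc]

theorem rho_ltri_comp_ket1 (δ : BaseModule d H) (β : BaseModule b H) (γ : BaseModule b.op K)
    (h : β.Preserves δ) (h' : δ.Preserves β) {c : 𝔎' →L[ℂ] 𝔎'} (hc : c ∈ d.dual) (ξ : β.space) :
    (ltri δ β γ h).rho c ∘L ket1 β γ ξ = ket1 β γ ⟨δ.rho c ∘L ξ, h'.mem hc ξ.2⟩ := by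
  refine eq_of_comp_eq γ.total' fun η => ?_
  rw [comp_assoc, ket1_comp_eq_ket2_comp, ket1_comp_eq_ket2_comp, ← comp_assoc,
    rho_ltri δ β γ h hc, comp_assoc]

end kets

/-! ### Functoriality of the relative tensor product -/

section functoriality

variable {𝔎 : Type u} [NormedAddCommGroup 𝔎] [InnerProductSpace ℂ 𝔎] [CompleteSpace 𝔎]
  {b : CStarBase 𝔎}
  {H : Type v} [NormedAddCommGroup H] [InnerProductSpace ℂ H] [CompleteSpace H]
  {K : Type w} [NormedAddCommGroup K] [InnerProductSpace ℂ K] [CompleteSpace K]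
  {L : Type x} [NormedAddCommGroup L] [InnerProductSpace ℂ L] [CompleteSpace L]
  {M : Type z} [NormedAddCommGroup M] [InnerProductSpace ℂ M] [CompleteSpace M]

theorem IsIntertwiner.tensorId_comp_ket2 {β : BaseModule b H} {β' : BaseModule b L}
    (γ : BaseModule b.op K) {S : H →L[ℂ] L} (hS : IsIntertwiner β β' S) (η : γ.space) :
    tensorId β β' γ S ∘L ket2 β γ η = ket2 β' γ η ∘L S :=
  CStarPMU.tensorId_comp_ket2 β β' γ hS η

theorem IsIntertwiner.idTensor_comp_ket1 (β : BaseModule b H) {γ : BaseModule b.op K}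
    {γ' : BaseModule b.op L} {S : K →L[ℂ] L} (hS : IsIntertwiner γ γ' S) (ξ : β.space) :
    idTensor β γ γ' S ∘L ket1 β γ ξ = ket1 β γ' ξ ∘L S :=
  CStarPMU.idTensor_comp_ket1 β γ γ' hS ξ

theorem IsSemiMorphism.tensorId_comp_ket1 {β : BaseModule b H} {β' : BaseModule b L}
    (γ : BaseModule b.op K) {S : H →L[ℂ] L} (hS : IsSemiMorphism β β' S) (ξ : β.space) :
    tensorId β β' γ S ∘L ket1 β γ ξ = ket1 β' γ ⟨S ∘L ξ, hS ξ ξ.2⟩ := by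
  refine eq_of_comp_eq γ.total' fun η => ?_
  rw [comp_assoc, ket1_comp_eq_ket2_comp, ket1_comp_eq_ket2_comp, ← comp_assoc,
    hS.isIntertwiner.tensorId_comp_ket2, comp_assoc]

theorem IsSemiMorphism.idTensor_comp_ket2 (β : BaseModule b H) {γ : BaseModule b.op K}
    {γ' : BaseModule b.op L} {S : K →L[ℂ] L} (hS : IsSemiMorphism γ γ' S) (η : γ.space) :
    idTensor β γ γ' S ∘L ket2 β γ η = ket2 β γ' ⟨S ∘L η, hS η η.2⟩ := by
  refine eq_of_comp_eq β.total' fun ξ => ?_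
  rw [comp_assoc, ← ket1_comp_eq_ket2_comp, ← ket1_comp_eq_ket2_comp, ← comp_assoc,
    hS.isIntertwiner.idTensor_comp_ket1, comp_assoc]

theorem tensorId_unique {β : BaseModule b H} {β' : BaseModule b L} {γ : BaseModule b.op K}
    {S : H →L[ℂ] L} (hS : IsIntertwiner β β' S) {R : RTP β γ →L[ℂ] RTP β' γ}
    (h : ∀ η, R ∘L ket2 β γ η = ket2 β' γ η ∘L S) : tensorId β β' γ S = R :=
  eq_of_comp_eq (ket2_total β γ) fun η => (hS.tensorId_comp_ket2 γ η).trans (h η).symm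

theorem idTensor_unique {β : BaseModule b H} {γ : BaseModule b.op K} {γ' : BaseModule b.op L}
    {S : K →L[ℂ] L} (hS : IsIntertwiner γ γ' S) {R : RTP β γ →L[ℂ] RTP β γ'}
    (h : ∀ ξ, R ∘L ket1 β γ ξ = ket1 β γ' ξ ∘L S) : idTensor β γ γ' S = R :=
  eq_of_comp_eq (ket1_total β γ) fun ξ => (hS.idTensor_comp_ket1 β ξ).trans (h ξ).symm

theorem tensorId_comp_tensorId {β : BaseModule b H} {β' : BaseModule b L} {β'' : BaseModule b M}
    (γ : BaseModule b.op K) {S : H →L[ℂ] L} {R : L →L[ℂ] M} (hR : IsIntertwiner β' β'' R)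
    (hS : IsIntertwiner β β' S) :
    tensorId β' β'' γ R ∘L tensorId β β' γ S = tensorId β β'' γ (R ∘L S) :=
  (tensorId_unique (hR.comp hS) fun η => by
    rw [comp_assoc, hS.tensorId_comp_ket2, ← comp_assoc, hR.tensorId_comp_ket2, comp_assoc]).symm

theorem idTensor_comp_idTensor (β : BaseModule b H) {γ : BaseModule b.op K}
    {γ' : BaseModule b.op L} {γ'' : BaseModule b.op M} {S : K →L[ℂ] L} {R : L →L[ℂ] M}
    (hR : IsIntertwiner γ' γ'' R) (hS : IsIntertwiner γ γ' S) :
    idTensor β γ' γ'' R ∘L idTensor β γ γ' S = idTensor β γ γ'' (R ∘L S) :=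
  (idTensor_unique (hR.comp hS) fun η => by
    rw [comp_assoc, hS.idTensor_comp_ket1, ← comp_assoc, hR.idTensor_comp_ket1, comp_assoc]).symm

theorem tensorId_id (β : BaseModule b H) (γ : BaseModule b.op K) :
    tensorId β β γ (ContinuousLinearMap.id ℂ H) = ContinuousLinearMap.id ℂ (RTP β γ) :=
  tensorId_unique (isIntertwiner_id β) fun _ => rfl

theorem idTensor_id (β : BaseModule b H) (γ : BaseModule b.op K) :
    idTensor β γ γ (ContinuousLinearMap.id ℂ K) = ContinuousLinearMap.id ℂ (RTP β γ) :=
  idTensor_unique (isIntertwiner_id γ) fun _ => rfl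

theorem tensorId_add {β : BaseModule b H} {β' : BaseModule b L} (γ : BaseModule b.op K)
    {S R : H →L[ℂ] L} (hS : IsIntertwiner β β' S) (hR : IsIntertwiner β β' R) :
    tensorId β β' γ (S + R) = tensorId β β' γ S + tensorId β β' γ R :=
  tensorId_unique (hS.add hR) fun η => by
    rw [add_comp, hS.tensorId_comp_ket2, hR.tensorId_comp_ket2, comp_add]

theorem idTensor_add (β : BaseModule b H) {γ : BaseModule b.op K} {γ' : BaseModule b.op L}
    {S R : K →L[ℂ] L} (hS : IsIntertwiner γ γ' S) (hR : IsIntertwiner γ γ' R) :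
    idTensor β γ γ' (S + R) = idTensor β γ γ' S + idTensor β γ γ' R :=
  idTensor_unique (hS.add hR) fun η => by
    rw [add_comp, hS.idTensor_comp_ket1, hR.idTensor_comp_ket1, comp_add]

theorem tensorId_smul {β : BaseModule b H} {β' : BaseModule b L} (γ : BaseModule b.op K) (r : ℂ)
    {S : H →L[ℂ] L} (hS : IsIntertwiner β β' S) :
    tensorId β β' γ (r • S) = r • tensorId β β' γ S :=
  tensorId_unique (hS.smul r) fun η => by
    rw [smul_comp, hS.tensorId_comp_ket2, comp_smul]

theorem idTensor_smul (β : BaseModule b H) {γ : BaseModule b.op K} {γ' : BaseModule b.op L}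
    (r : ℂ) {S : K →L[ℂ] L} (hS : IsIntertwiner γ γ' S) :
    idTensor β γ γ' (r • S) = r • idTensor β γ γ' S :=
  idTensor_unique (hS.smul r) fun η => by
    rw [smul_comp, hS.idTensor_comp_ket1, comp_smul]

theorem tensorId_adjoint {β : BaseModule b H} {β' : BaseModule b L} (γ : BaseModule b.op K)
    {S : H →L[ℂ] L} (hS : IsIntertwiner β β' S) :
    (tensorId β β' γ S)† = tensorId β' β γ (S†) := by
  refine (tensorId_unique hS.adjoint fun η =>
    ContinuousLinearMap.adjoint.injective (eq_of_comp_eq (ket2_total β γ) fun η' => ?_)).symm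
  rw [adjoint_comp, adjoint_comp, adjoint_adjoint, adjoint_adjoint, comp_assoc, comp_assoc,
    hS.tensorId_comp_ket2, ← comp_assoc, ket2_adjoint_comp_ket2, ket2_adjoint_comp_ket2]
  exact (hS _ (γ.inner_mem η.2 η'.2)).symm

theorem idTensor_adjoint (β : BaseModule b H) {γ : BaseModule b.op K} {γ' : BaseModule b.op L}
    {S : K →L[ℂ] L} (hS : IsIntertwiner γ γ' S) :
    (idTensor β γ γ' S)† = idTensor β γ' γ (S†) := by
  refine (idTensor_unique hS.adjoint fun ξ =>
    ContinuousLinearMap.adjoint.injective (eq_of_comp_eq (ket1_total β γ) fun ξ' => ?_)).symm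
  rw [adjoint_comp, adjoint_comp, adjoint_adjoint, adjoint_adjoint, comp_assoc, comp_assoc,
    hS.idTensor_comp_ket1, ← comp_assoc, ket1_adjoint_comp_ket1, ket1_adjoint_comp_ket1]
  exact (hS _ (β.inner_mem ξ.2 ξ'.2)).symm

theorem norm_tensorId_le {β : BaseModule b H} {β' : BaseModule b L} (γ : BaseModule b.op K)
    {S : H →L[ℂ] L} (hS : IsIntertwiner β β' S) : ‖tensorId β β' γ S‖ ≤ ‖S‖ := by
  refine norm_extendFam_le _ _ S (ket2_total β γ) fun i j => ?_
  rw [ket2_adjoint_comp_ket2, adjoint_comp, comp_assoc, comp_assoc, hS _ (γ.inner_mem i.2 j.2),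
    ← ket2_adjoint_comp_ket2, comp_assoc]

theorem norm_idTensor_le (β : BaseModule b H) {γ : BaseModule b.op K} {γ' : BaseModule b.op L}
    {S : K →L[ℂ] L} (hS : IsIntertwiner γ γ' S) : ‖idTensor β γ γ' S‖ ≤ ‖S‖ := by
  refine norm_extendFam_le _ _ S (ket1_total β γ) fun i j => ?_
  rw [ket1_adjoint_comp_ket1, adjoint_comp, comp_assoc, comp_assoc, hS _ (β.inner_mem i.2 j.2),
    ← ket1_adjoint_comp_ket1, comp_assoc]

/-- A closed linear condition on `S ⊗ Id` passes from a set of intertwiners to its closed span. -/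
theorem tensorId_mem_of_mem_cspan (β : BaseModule b H) (β' : BaseModule b L)
    (γ : BaseModule b.op K) {F : Type*} [NormedAddCommGroup F] [NormedSpace ℂ F]
    (Φ : (RTP β γ →L[ℂ] RTP β' γ) →L[ℂ] F) {N : Submodule ℂ F} (hN : IsClosed (N : Set F))
    {s : Set (H →L[ℂ] L)}
    (hs : ∀ S ∈ s, IsIntertwiner β β' S ∧ Φ (tensorId β β' γ S) ∈ N) {S : H →L[ℂ] L}
    (hS : S ∈ cspan s) : Φ (tensorId β β' γ S) ∈ N :=
  (map_mem_of_mem_cspan_of_linearOn (σ := RingHom.id ℂ) (D := intertwinerSpace β β')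
    (fun S => Φ (tensorId β β' γ S)) (isClosed_intertwinerSpace β β')
    (fun S hS R hR => by rw [tensorId_add γ hS hR, map_add])
    (fun r S hS => by rw [tensorId_smul γ r hS, map_smul, RingHom.id_apply])
    (C := ‖Φ‖) (fun S hS => (Φ.le_opNorm _).trans (by gcongr; exact norm_tensorId_le γ hS))
    hN hs hS).2

/-- A closed linear condition on `Id ⊗ S` passes from a set of intertwiners to its closed span. -/
theorem idTensor_mem_of_mem_cspan (β : BaseModule b H) (γ : BaseModule b.op K)
    (γ' : BaseModule b.op L) {F : Type*} [NormedAddCommGroup F] [NormedSpace ℂ F]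
    (Φ : (RTP β γ →L[ℂ] RTP β γ') →L[ℂ] F) {N : Submodule ℂ F} (hN : IsClosed (N : Set F))
    {s : Set (K →L[ℂ] L)}
    (hs : ∀ S ∈ s, IsIntertwiner γ γ' S ∧ Φ (idTensor β γ γ' S) ∈ N) {S : K →L[ℂ] L}
    (hS : S ∈ cspan s) : Φ (idTensor β γ γ' S) ∈ N :=
  (map_mem_of_mem_cspan_of_linearOn (σ := RingHom.id ℂ) (D := intertwinerSpace γ γ')
    (fun S => Φ (idTensor β γ γ' S)) (isClosed_intertwinerSpace γ γ')
    (fun S hS R hR => by rw [idTensor_add β hS hR, map_add])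
    (fun r S hS => by rw [idTensor_smul β r hS, map_smul, RingHom.id_apply])
    (C := ‖Φ‖) (fun S hS => (Φ.le_opNorm _).trans (by gcongr; exact norm_idTensor_le β hS))
    hN hs hS).2

/-- The operators `S ⊗ Id` and `Id ⊗ R` commute. -/
theorem tensorId_comp_idTensor {β : BaseModule b H} {β' : BaseModule b L} {γ : BaseModule b.op K}
    {γ' : BaseModule b.op M} {S : H →L[ℂ] L} {R : K →L[ℂ] M} (hS : IsSemiMorphism β β' S)
    (hR : IsIntertwiner γ γ' R) :
    tensorId β β' γ' S ∘L idTensor β γ γ' R = idTensor β' γ γ' R ∘L tensorId β β' γ S := by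
  refine eq_of_comp_eq (ket1_total β γ) fun ξ => ?_
  rw [comp_assoc, hR.idTensor_comp_ket1, ← comp_assoc, hS.tensorId_comp_ket1, comp_assoc,
    hS.tensorId_comp_ket1, hR.idTensor_comp_ket1]

theorem tensorId_comp_idTensor' {β : BaseModule b H} {β' : BaseModule b L}
    {γ : BaseModule b.op K} {γ' : BaseModule b.op M} {S : H →L[ℂ] L} {R : K →L[ℂ] M}
    (hS : IsIntertwiner β β' S) (hR : IsSemiMorphism γ γ' R) :
    tensorId β β' γ' S ∘L idTensor β γ γ' R = idTensor β' γ γ' R ∘L tensorId β β' γ S := by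
  refine eq_of_comp_eq (ket2_total β γ) fun η => ?_
  rw [comp_assoc, hR.idTensor_comp_ket2, hS.tensorId_comp_ket2, comp_assoc,
    hS.tensorId_comp_ket2, ← comp_assoc, hR.idTensor_comp_ket2]

/-- The operator `|ξ ξ'*⟩ ⊗ Id` equals `|ξ⟩₁⟨ξ'|₁`. -/
theorem tensorId_comp_adjoint (β : BaseModule b H) (β' : BaseModule b L) (γ : BaseModule b.op K)
    (ξ : β'.space) (ξ' : β.space) : IsIntertwiner β β' ((ξ : 𝔎 →L[ℂ] L) ∘L (ξ' : 𝔎 →L[ℂ] H)†) ∧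
      tensorId β β' γ ((ξ : 𝔎 →L[ℂ] L) ∘L (ξ' : 𝔎 →L[ℂ] H)†) =
        ket1 β' γ ξ ∘L (ket1 β γ ξ')† := by
  have hi : IsIntertwiner β β' ((ξ : 𝔎 →L[ℂ] L) ∘L (ξ' : 𝔎 →L[ℂ] H)†) := by
    intro c hc
    have h := congrArg ContinuousLinearMap.adjoint (β.rho_comp (adjoint_mem_dual hc) ξ'.2)
    rw [adjoint_comp, adjoint_comp, β.rho_adjoint (adjoint_mem_dual hc), adjoint_adjoint] at h
    rw [comp_assoc, h, ← comp_assoc, ← β'.rho_comp hc ξ.2, comp_assoc]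
  refine ⟨hi, tensorId_unique hi fun η => ?_⟩
  have h2 : (ket1 β γ ξ')† ∘L ket2 β γ η = (η : 𝔎 →L[ℂ] K) ∘L (ξ' : 𝔎 →L[ℂ] H)† := by
    refine ContinuousLinearMap.adjoint.injective (eq_of_comp_eq γ.total' fun η' => ?_)
    rw [adjoint_comp, adjoint_comp, adjoint_adjoint, adjoint_adjoint, comp_assoc,
      ket1_comp_eq_ket2_comp, ← comp_assoc, ket2_adjoint_comp_ket2, comp_assoc,
      β.rho_comp (γ.inner_mem η.2 η'.2) ξ'.2]
  rw [comp_assoc, h2, ← comp_assoc, ket1_comp_eq_ket2_comp, comp_assoc]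

/-- The operator `Id ⊗ |η η'*⟩` equals `|η⟩₂⟨η'|₂`. -/
theorem idTensor_comp_adjoint (β : BaseModule b H) (γ : BaseModule b.op K)
    (γ' : BaseModule b.op L) (η : γ'.space) (η' : γ.space) :
    IsIntertwiner γ γ' ((η : 𝔎 →L[ℂ] L) ∘L (η' : 𝔎 →L[ℂ] K)†) ∧
      idTensor β γ γ' ((η : 𝔎 →L[ℂ] L) ∘L (η' : 𝔎 →L[ℂ] K)†) =
        ket2 β γ' η ∘L (ket2 β γ η')† := by
  have hi : IsIntertwiner γ γ' ((η : 𝔎 →L[ℂ] L) ∘L (η' : 𝔎 →L[ℂ] K)†) := by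
    intro c hc
    have h := congrArg ContinuousLinearMap.adjoint (γ.rho_comp (adjoint_mem_dual hc) η'.2)
    rw [adjoint_comp, adjoint_comp, γ.rho_adjoint (adjoint_mem_dual hc), adjoint_adjoint] at h
    rw [comp_assoc, h, ← comp_assoc, ← γ'.rho_comp hc η.2, comp_assoc]
  refine ⟨hi, idTensor_unique hi fun ξ => ?_⟩
  have h2 : (ket2 β γ η')† ∘L ket1 β γ ξ = (ξ : 𝔎 →L[ℂ] H) ∘L (η' : 𝔎 →L[ℂ] K)† := by
    refine ContinuousLinearMap.adjoint.injective (eq_of_comp_eq β.total' fun ξ' => ?_)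
    rw [adjoint_comp, adjoint_comp, adjoint_adjoint, adjoint_adjoint, comp_assoc,
      ← ket1_comp_eq_ket2_comp, ← comp_assoc, ket1_adjoint_comp_ket1, comp_assoc]
    exact γ.rho_comp (β.inner_mem ξ.2 ξ'.2) η'.2
  rw [comp_assoc, h2, ← comp_assoc, ← ket1_comp_eq_ket2_comp, comp_assoc]

end functoriality

/-! ### The flip and the associativity isomorphisms -/

section structural

variable {𝔎 : Type u} [NormedAddCommGroup 𝔎] [InnerProductSpace ℂ 𝔎] [CompleteSpace 𝔎]
  {b : CStarBase 𝔎}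
  {𝔎' : Type y} [NormedAddCommGroup 𝔎'] [InnerProductSpace ℂ 𝔎'] [CompleteSpace 𝔎']
  {d : CStarBase 𝔎'}
  {H : Type v} [NormedAddCommGroup H] [InnerProductSpace ℂ H] [CompleteSpace H]
  {K : Type w} [NormedAddCommGroup K] [InnerProductSpace ℂ K] [CompleteSpace K]
  {L : Type x} [NormedAddCommGroup L] [InnerProductSpace ℂ L] [CompleteSpace L]

theorem flip_comp_ket1 (β : BaseModule b H) (γ : BaseModule b.op K) (ξ : β.space) :
    flip β γ ∘L ket1 β γ ξ = ket2 (b := b.op) γ β ξ := by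
  refine eq_of_comp_eq γ.total' fun η => ?_
  rw [comp_assoc, ket1_comp, flip_comp_tmul]
  exact (ket2_comp (b := b.op) γ β η ξ).symm

theorem flip_comp_ket2 (β : BaseModule b H) (γ : BaseModule b.op K) (η : γ.space) :
    flip β γ ∘L ket2 β γ η = ket1 (b := b.op) γ β η := by
  refine eq_of_comp_eq β.total' fun ξ => ?_
  rw [comp_assoc, ket2_comp, flip_comp_tmul]
  exact (ket1_comp (b := b.op) γ β η ξ).symm

theorem flip_adjoint_comp_flip (β : BaseModule b H) (γ : BaseModule b.op K) :
    (flip β γ)† ∘L flip β γ = ContinuousLinearMap.id ℂ (RTP β γ) :=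
  adjoint_comp_self_eq_id (ket1_total β γ) (flip_comp_ket1 β γ) fun ξ ξ' => by
    rw [ket1_adjoint_comp_ket1]
    exact ket2_adjoint_comp_ket2 (b := b.op) γ β ξ ξ'

theorem assoc_comp_ket2 (β : BaseModule b H) (γ : BaseModule b.op K) (ε : BaseModule d K)
    (φ : BaseModule d.op L) (h : γ.Preserves ε) (h' : ε.Preserves γ) (θ : φ.space) :
    assoc β γ ε φ h h' ∘L ket2 (rtri β γ ε h) φ θ =
      idTensor β γ (ltri γ ε φ h') (ket2 ε φ θ) := by
  refine (idTensor_unique (isMorphism_ket2 ε φ γ h' θ).1.isIntertwiner fun ξ => ?_).symm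
  rw [comp_assoc, assoc_comp]

theorem assoc_comp_tensorId (β : BaseModule b H) (γ : BaseModule b.op K) (ε : BaseModule d K)
    (φ : BaseModule d.op L) (h : γ.Preserves ε) (h' : ε.Preserves γ) (ξ : β.space) :
    assoc β γ ε φ h h' ∘L tensorId ε (rtri β γ ε h) φ (ket1 β γ ξ) =
      ket1 β (ltri γ ε φ h') ξ := by
  refine eq_of_comp_eq (ket2_total ε φ) fun θ => ?_
  rw [comp_assoc, (isMorphism_ket1 β γ ε h ξ).1.isIntertwiner.tensorId_comp_ket2, assoc_comp]

theorem assoc_adjoint_comp_assoc (β : BaseModule b H) (γ : BaseModule b.op K)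
    (ε : BaseModule d K) (φ : BaseModule d.op L) (h : γ.Preserves ε) (h' : ε.Preserves γ) :
    (assoc β γ ε φ h h')† ∘L assoc β γ ε φ h h' = ContinuousLinearMap.id ℂ _ :=
  adjoint_comp_self_eq_id (assoc_total β γ ε φ h) (fun p => assoc_comp β γ ε φ h h' p.1 p.2)
    (assoc_kernel β γ ε φ h h')

theorem assocSymm_comp_assoc (β : BaseModule b H) (γ : BaseModule b.op K) (ε : BaseModule d K)
    (φ : BaseModule d.op L) (h : γ.Preserves ε) (h' : ε.Preserves γ) :
    assocSymm β γ ε φ h h' ∘L assoc β γ ε φ h h' = ContinuousLinearMap.id ℂ _ :=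
  eq_of_comp_eq (assoc_total β γ ε φ h) fun p => by
    rw [comp_assoc, assoc_comp, assocSymm_comp, id_comp]

theorem assoc_comp_assocSymm (β : BaseModule b H) (γ : BaseModule b.op K) (ε : BaseModule d K)
    (φ : BaseModule d.op L) (h : γ.Preserves ε) (h' : ε.Preserves γ) :
    assoc β γ ε φ h h' ∘L assocSymm β γ ε φ h h' = ContinuousLinearMap.id ℂ _ := by
  refine eq_of_comp_eq (ket1_total β (ltri γ ε φ h')) fun ξ =>
    eq_of_comp_eq (ket2_total ε φ) fun θ => ?_
  rw [comp_assoc, comp_assoc, assocSymm_comp, assoc_comp, id_comp]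

theorem assoc_adjoint (β : BaseModule b H) (γ : BaseModule b.op K) (ε : BaseModule d K)
    (φ : BaseModule d.op L) (h : γ.Preserves ε) (h' : ε.Preserves γ) :
    (assoc β γ ε φ h h')† = assocSymm β γ ε φ h h' := by
  rw [← id_comp (assocSymm β γ ε φ h h'), ← assoc_adjoint_comp_assoc β γ ε φ h h', comp_assoc,
    assoc_comp_assocSymm, comp_id]

theorem assocSymm_comp_idTensor (β : BaseModule b H) (γ : BaseModule b.op K)
    (ε : BaseModule d K) (φ : BaseModule d.op L) (h : γ.Preserves ε) (h' : ε.Preserves γ)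
    (θ : φ.space) :
    assocSymm β γ ε φ h h' ∘L idTensor β γ (ltri γ ε φ h') (ket2 ε φ θ) =
      ket2 (rtri β γ ε h) φ θ := by
  rw [← assoc_comp_ket2 β γ ε φ h h', ← comp_assoc, assocSymm_comp_assoc, id_comp]

theorem assocSymm_comp_ket1 (β : BaseModule b H) (γ : BaseModule b.op K)
    (ε : BaseModule d K) (φ : BaseModule d.op L) (h : γ.Preserves ε) (h' : ε.Preserves γ)
    (ξ : β.space) :
    assocSymm β γ ε φ h h' ∘L ket1 β (ltri γ ε φ h') ξ =
      tensorId ε (rtri β γ ε h) φ (ket1 β γ ξ) := by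
  rw [← assoc_comp_tensorId β γ ε φ h h', ← comp_assoc, assocSymm_comp_assoc, id_comp]

theorem assoc_comp_ket1 (β : BaseModule b H) (γ : BaseModule b.op K) (ε : BaseModule d K)
    (φ : BaseModule d.op L) (h : γ.Preserves ε) (h' : ε.Preserves γ) (ξ : β.space) (κ : ε.space)
    {X : (rtri β γ ε h).space} (hX : ket1 β γ ξ ∘L (κ : 𝔎' →L[ℂ] K) = X) :
    assoc β γ ε φ h h' ∘L ket1 (rtri β γ ε h) φ X =
      ket1 β (ltri γ ε φ h') ξ ∘L ket1 ε φ κ := by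
  have hk := (isMorphism_ket1 β γ ε h ξ).1
  have e : X = ⟨ket1 β γ ξ ∘L κ, hk _ κ.2⟩ := Subtype.ext hX.symm
  rw [e, ← hk.tensorId_comp_ket1 φ κ, ← comp_assoc, assoc_comp_tensorId]

theorem assocSymm_comp_ket2 (β : BaseModule b H) (γ : BaseModule b.op K) (ε : BaseModule d K)
    (φ : BaseModule d.op L) (h : γ.Preserves ε) (h' : ε.Preserves γ) (θ : φ.space) (κ : γ.space)
    {X : (ltri γ ε φ h').space} (hX : ket2 ε φ θ ∘L (κ : 𝔎 →L[ℂ] K) = X) :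
    assocSymm β γ ε φ h h' ∘L ket2 β (ltri γ ε φ h') X =
      ket2 (rtri β γ ε h) φ θ ∘L ket2 β γ κ := by
  have hk := (isMorphism_ket2 ε φ γ h' θ).1
  have e : X = ⟨ket2 ε φ θ ∘L κ, hk _ κ.2⟩ := Subtype.ext hX.symm
  have e2 := IsSemiMorphism.idTensor_comp_ket2 β hk κ
  rw [e, ← e2, ← comp_assoc, assocSymm_comp_idTensor]

/-- The operator `assoc` is natural in the third tensor factor. -/
theorem assoc_comp_idTensor (β : BaseModule b H) (γ : BaseModule b.op K) (ε : BaseModule d K)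
    (φ : BaseModule d.op L) (h : γ.Preserves ε) (h' : ε.Preserves γ) {S : L →L[ℂ] L}
    (hS : IsIntertwiner φ φ S)
    (hS' : IsIntertwiner (ltri γ ε φ h') (ltri γ ε φ h') (idTensor ε φ φ S)) :
    assoc β γ ε φ h h' ∘L idTensor (rtri β γ ε h) φ φ S =
      idTensor β (ltri γ ε φ h') (ltri γ ε φ h') (idTensor ε φ φ S) ∘L assoc β γ ε φ h h' := by
  have hc : assoc β γ ε φ h h' ∘L idTensor (rtri β γ ε h) φ φ S ∘L assocSymm β γ ε φ h h' =
      idTensor β (ltri γ ε φ h') (ltri γ ε φ h') (idTensor ε φ φ S) := by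
    refine (idTensor_unique hS' fun ξ => ?_).symm
    rw [comp_assoc, comp_assoc, assocSymm_comp_ket1,
      ← tensorId_comp_idTensor (isMorphism_ket1 β γ ε h ξ).1 hS, ← comp_assoc,
      assoc_comp_tensorId]
  rw [← hc, comp_assoc, comp_assoc, assocSymm_comp_assoc, comp_id]

theorem sigma23_comp_ket2 (β : BaseModule b H) (γ : BaseModule b.op K) (δ : BaseModule d H)
    (θ : BaseModule d.op L) (h : β.Preserves δ) (h' : δ.Preserves β) (τ : θ.space) :
    sigma23 β γ δ θ h h' ∘L ket2 (ltri δ β γ h) θ τ =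
      tensorId β (ltri β δ θ h') γ (ket2 δ θ τ) := by
  refine (tensorId_unique (isMorphism_ket2 δ θ β h' τ).1.isIntertwiner fun η => ?_).symm
  rw [comp_assoc, sigma23_comp]

theorem sigma23_comp_tensorId (β : BaseModule b H) (γ : BaseModule b.op K) (δ : BaseModule d H)
    (θ : BaseModule d.op L) (h : β.Preserves δ) (h' : δ.Preserves β) (η : γ.space) :
    sigma23 β γ δ θ h h' ∘L tensorId δ (ltri δ β γ h) θ (ket2 β γ η) =
      ket2 (ltri β δ θ h') γ η := by
  refine eq_of_comp_eq (ket2_total δ θ) fun τ => ?_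
  rw [comp_assoc, (isMorphism_ket2 β γ δ h η).1.isIntertwiner.tensorId_comp_ket2, sigma23_comp]

theorem sigma23_comp_ket1 (β : BaseModule b H) (γ : BaseModule b.op K) (δ : BaseModule d H)
    (θ : BaseModule d.op L) (h : β.Preserves δ) (h' : δ.Preserves β) (η : γ.space) (ξ : δ.space)
    {X : (ltri δ β γ h).space} (hX : ket2 β γ η ∘L (ξ : 𝔎' →L[ℂ] H) = X) :
    sigma23 β γ δ θ h h' ∘L ket1 (ltri δ β γ h) θ X =
      ket2 (ltri β δ θ h') γ η ∘L ket1 δ θ ξ := by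
  have hk := (isMorphism_ket2 β γ δ h η).1
  have e : X = ⟨ket2 β γ η ∘L ξ, hk _ ξ.2⟩ := Subtype.ext hX.symm
  rw [e, ← hk.tensorId_comp_ket1 θ ξ, ← comp_assoc, sigma23_comp_tensorId]

theorem tensorId_rho (δ : BaseModule d H) (β : BaseModule b H) (γ : BaseModule b.op K)
    (h : β.Preserves δ) (h' : δ.Preserves β) {c : 𝔎' →L[ℂ] 𝔎'} (hc : c ∈ d.dual) :
    tensorId β β γ (δ.rho c) = (ltri δ β γ h).rho c :=
  tensorId_unique (h'.isSemiMorphism hc).isIntertwiner fun η => rho_ltri δ β γ h hc η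

theorem sigma23_adjoint_comp_sigma23 (β : BaseModule b H) (γ : BaseModule b.op K)
    (δ : BaseModule d H) (θ : BaseModule d.op L) (h : β.Preserves δ) (h' : δ.Preserves β) :
    (sigma23 β γ δ θ h h')† ∘L sigma23 β γ δ θ h h' = ContinuousLinearMap.id ℂ _ :=
  adjoint_comp_self_eq_id (ket2_total (ltri δ β γ h) θ) (sigma23_comp_ket2 β γ δ θ h h')
    fun τ τ' => by
      have hτ := fun τ => (isMorphism_ket2 δ θ β h' τ).1.isIntertwiner
      rw [tensorId_adjoint γ (hτ τ), tensorId_comp_tensorId γ (hτ τ).adjoint (hτ τ'),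
        ket2_adjoint_comp_ket2, ket2_adjoint_comp_ket2,
        tensorId_rho δ β γ h h' (θ.inner_mem τ.2 τ'.2)]

end structural

section rho

variable {𝔎 : Type u} [NormedAddCommGroup 𝔎] [InnerProductSpace ℂ 𝔎] [CompleteSpace 𝔎]
  {b : CStarBase 𝔎}
  {𝔎' : Type y} [NormedAddCommGroup 𝔎'] [InnerProductSpace ℂ 𝔎'] [CompleteSpace 𝔎']
  {d : CStarBase 𝔎'}
  {H : Type v} [NormedAddCommGroup H] [InnerProductSpace ℂ H] [CompleteSpace H]
  {K : Type w} [NormedAddCommGroup K] [InnerProductSpace ℂ K] [CompleteSpace K]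

theorem IsIntertwiner.idTensor_ltri (δ : BaseModule d H) (β : BaseModule b H)
    (γ : BaseModule b.op K) (h : β.Preserves δ) (h' : δ.Preserves β) {S : K →L[ℂ] K}
    (hS : IsIntertwiner γ γ S) :
    IsIntertwiner (ltri δ β γ h) (ltri δ β γ h) (idTensor β γ γ S) := by
  intro c hc
  rw [← tensorId_rho δ β γ h h' hc, tensorId_comp_idTensor (h'.isSemiMorphism hc) hS]

end rho

/-! ### Bras and the representations `ρ` -/

section slices

variable {𝔎 : Type u} [NormedAddCommGroup 𝔎] [InnerProductSpace ℂ 𝔎] [CompleteSpace 𝔎]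
  {b : CStarBase 𝔎}
  {𝔎' : Type y} [NormedAddCommGroup 𝔎'] [InnerProductSpace ℂ 𝔎'] [CompleteSpace 𝔎']
  {d : CStarBase 𝔎'}
  {H : Type v} [NormedAddCommGroup H] [InnerProductSpace ℂ H] [CompleteSpace H]
  {K : Type w} [NormedAddCommGroup K] [InnerProductSpace ℂ K] [CompleteSpace K]

theorem adjoint_ket1_comp_rho_ltri (δ : BaseModule d H) (β : BaseModule b H)
    (γ : BaseModule b.op K) (h : β.Preserves δ) (h' : δ.Preserves β) {c : 𝔎' →L[ℂ] 𝔎'}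
    (hc : c ∈ d.dual) (ξ : β.space) : (ket1 β γ ξ)† ∘L (ltri δ β γ h).rho c =
      (ket1 β γ ⟨δ.rho (c†) ∘L ξ, h'.mem (adjoint_mem_dual hc) ξ.2⟩)† := by
  rw [← rho_ltri_comp_ket1 δ β γ h h' (adjoint_mem_dual hc), adjoint_comp,
    BaseModule.rho_adjoint _ (adjoint_mem_dual hc), adjoint_adjoint]

theorem adjoint_ket2_comp_rho_rtri (β : BaseModule b H) (γ : BaseModule b.op K)
    (δ : BaseModule d K) (h : γ.Preserves δ) (h' : δ.Preserves γ) {c : 𝔎' →L[ℂ] 𝔎'}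
    (hc : c ∈ d.dual) (η : γ.space) : (ket2 β γ η)† ∘L (rtri β γ δ h).rho c =
      (ket2 β γ ⟨δ.rho (c†) ∘L η, h'.mem (adjoint_mem_dual hc) η.2⟩)† := by
  rw [← rho_rtri_comp_ket2 β γ δ h h' (adjoint_mem_dual hc), adjoint_comp,
    BaseModule.rho_adjoint _ (adjoint_mem_dual hc), adjoint_adjoint]

theorem MapsOnto.adjoint {α : BaseModule b H} {γ : BaseModule b K} {T : H →L[ℂ] K}
    (h : MapsOnto α γ T) (hT : T† ∘L T = ContinuousLinearMap.id ℂ H) : MapsOnto γ α (T†) := by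
  have h' : (fun ξ : 𝔎 →L[ℂ] H => T ∘L ξ) '' (α.space : Set (𝔎 →L[ℂ] H)) =
    (γ.space : Set (𝔎 →L[ℂ] K)) := h
  rw [MapsOnto, ← h', Set.image_image]
  simp only [← comp_assoc, hT, id_comp, Set.image_id']

theorem MapsOnto.cspan_eq {α : BaseModule b H} {γ : BaseModule b K} {T : H →L[ℂ] K}
    (h : MapsOnto α γ T) {s : Set (𝔎 →L[ℂ] H)} (hs : cspan s = α.space) :
    cspan ((fun ξ : 𝔎 →L[ℂ] H => T ∘L ξ) '' s) = γ.space := by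
  have h' : (fun ξ : 𝔎 →L[ℂ] H => T ∘L ξ) '' (α.space : Set (𝔎 →L[ℂ] H)) =
    (γ.space : Set (𝔎 →L[ℂ] K)) := h
  refine le_antisymm (cspan_le γ.isClosed_space ?_) fun X hX => ?_
  · rintro _ ⟨ξ, hξ, rfl⟩
    have hm : T ∘L ξ ∈ (fun ξ : 𝔎 →L[ℂ] H => T ∘L ξ) '' (α.space : Set (𝔎 →L[ℂ] H)) :=
      ⟨ξ, hs.le (mem_cspan hξ), rfl⟩
    exact h'.le hm
  · obtain ⟨ξ, hξ, rfl⟩ := h'.ge hX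
    refine map_mem_of_mem_cspan (compL ℂ 𝔎 H K T) (isClosed_cspan _) ?_ (hs.ge hξ)
    exact fun ξ hξ => mem_cspan ⟨ξ, hξ, rfl⟩

theorem BaseModule.Preserves.cspan_inner_eq {β : BaseModule b H} {α : BaseModule d H}
    (h : β.Preserves α) (γ : BaseModule b.op K) :
    cspan {T : 𝔎' →L[ℂ] H | ∃ i j : γ.space, ∃ ξ ∈ α.space,
      β.rho ((i : 𝔎 →L[ℂ] K)† ∘L (j : 𝔎 →L[ℂ] K)) ∘L ξ = T} = α.space := by
  refine le_antisymm (cspan_le α.isClosed_space ?_)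
    (h.le_cspan (fun i j : γ.space => (i : 𝔎 →L[ℂ] K)† ∘L (j : 𝔎 →L[ℂ] K)) γ.inner_eq')
  rintro _ ⟨i, j, ξ, hξ, rfl⟩
  exact h.mem (γ.inner_mem i.2 j.2) hξ

end slices

/-! ### The pentagon equation on elementary operators -/

section PMU

variable {𝔎 : Type u} [NormedAddCommGroup 𝔎] [InnerProductSpace ℂ 𝔎] [CompleteSpace 𝔎]
  {b : CStarBase 𝔎}
  {H : Type v} [NormedAddCommGroup H] [InnerProductSpace ℂ H] [CompleteSpace H]

theorem MapsOnto.isMorphism {K : Type w} [NormedAddCommGroup K] [InnerProductSpace ℂ K]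
    [CompleteSpace K] {α : BaseModule b H} {γ : BaseModule b K} {T : H →L[ℂ] K}
    (h : MapsOnto α γ T) (hT : T† ∘L T = ContinuousLinearMap.id ℂ H) : IsMorphism α γ T := by
  have h' : (fun ξ : 𝔎 →L[ℂ] H => T ∘L ξ) '' (α.space : Set (𝔎 →L[ℂ] H)) =
    (γ.space : Set (𝔎 →L[ℂ] K)) := h
  refine ⟨fun ξ hξ => ?_, fun η hη => ?_⟩
  · exact h'.le ⟨ξ, hξ, rfl⟩
  · obtain ⟨ξ, hξ, rfl⟩ := h'.ge hη
    show T† ∘L (T ∘L ξ) ∈ α.space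
    rwa [← comp_assoc, hT, id_comp]

/-- The pentagon equation as an equation that can be used for rewriting. -/
theorem TriModule.Pentagon.eq {M : TriModule b H} {V : M.Source →L[ℂ] M.Target}
    (h : M.Pentagon V) :
    idTensor M.α (ltri (b := b.op) M.β M.βhat M.α M.βhat_β) (ltri M.β M.α M.β M.α_β) V ∘L
      assoc (d := b.op) M.α M.β M.βhat M.α M.β_βhat M.βhat_β ∘L
      tensorId (b := b.op) (rtri (b := b.op) M.βhat M.α M.βhat M.α_βhat)
        (rtri M.α M.β M.βhat M.β_βhat) M.α V =
    assoc M.α M.β M.α M.β M.β_α M.α_β ∘L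
      tensorId (ltri (b := b.op) M.α M.βhat M.α M.βhat_α) (rtri M.α M.β M.α M.β_α) M.β V ∘L
      sigma23 (d := b.op) M.α M.β M.βhat M.α M.α_βhat M.βhat_α ∘L
      tensorId (b := b.op) (rtri (b := b.op) M.βhat M.α M.β M.α_β)
        (ltri M.βhat M.α M.β M.α_βhat) M.α V ∘L
      assocSymm (b := b.op) (d := b.op) M.βhat M.α M.β M.α M.α_β M.β_α ∘L
      idTensor (b := b.op) M.βhat (rtri M.α M.β M.α M.β_α)
        (ltri (b := b.op) M.α M.β M.α M.β_α) (flip M.α M.β) ∘L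
      idTensor (b := b.op) M.βhat (ltri (b := b.op) M.α M.βhat M.α M.βhat_α)
        (rtri M.α M.β M.α M.β_α) V ∘L
      assoc (b := b.op) (d := b.op) M.βhat M.α M.βhat M.α M.α_βhat M.βhat_α :=
  h

namespace PseudoMultUnitary

variable (P : PseudoMultUnitary b H)

/-- The module structure `α ◁ α` on the domain of `V`. -/
abbrev srcα : BaseModule b P.Source := ltri (b := b.op) P.α P.βhat P.α P.βhat_α

/-- The module structure `α ▷ α` on the range of `V`. -/
abbrev tgtα : BaseModule b P.Target := rtri P.α P.β P.α P.β_α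

/-- The module structure `β̂ ▷ β` on the domain of `V`. -/
abbrev srcMix : BaseModule b.op P.Source := rtri (b := b.op) P.βhat P.α P.β P.α_β

/-- The module structure `β̂ ◁ β` on the range of `V`. -/
abbrev tgtMix : BaseModule b.op P.Target := ltri P.βhat P.α P.β P.α_βhat

/-- The module structure `β̂ ▷ β̂` on the domain of `V`. -/
abbrev srcβhat : BaseModule b.op P.Source := rtri (b := b.op) P.βhat P.α P.βhat P.α_βhat

/-- The module structure `α ▷ β̂` on the range of `V`. -/
abbrev tgtβhat : BaseModule b.op P.Target := rtri P.α P.β P.βhat P.β_βhat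

/-- The module structure `β ◁ α` on the domain of `V`. -/
abbrev srcβ : BaseModule b.op P.Source := ltri (b := b.op) P.β P.βhat P.α P.βhat_β

/-- The module structure `β ◁ β` on the range of `V`. -/
abbrev tgtβ : BaseModule b.op P.Target := ltri P.β P.α P.β P.α_β

theorem adjoint_op_comp_op : P.op† ∘L P.op = ContinuousLinearMap.id ℂ P.Source := by
  refine ContinuousLinearMap.ext fun s => ext_inner_left ℂ fun t => ?_
  rw [comp_apply, adjoint_inner_right]
  exact P.V.inner_map_map t s

theorem op_comp_adjoint_op : P.op ∘L P.op† = ContinuousLinearMap.id ℂ P.Target := by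
  refine ContinuousLinearMap.ext fun t => ?_
  obtain ⟨s, rfl⟩ := P.V.surjective t
  have h := DFunLike.congr_fun P.adjoint_op_comp_op s
  exact congrArg P.V h

theorem isMorphism_op_α : IsMorphism P.srcα P.tgtα P.op :=
  P.intertwines.1.isMorphism P.adjoint_op_comp_op

theorem isMorphism_op_mix : IsMorphism P.srcMix P.tgtMix P.op :=
  P.intertwines.2.1.isMorphism P.adjoint_op_comp_op

theorem isMorphism_op_βhat : IsMorphism P.srcβhat P.tgtβhat P.op :=
  P.intertwines.2.2.1.isMorphism P.adjoint_op_comp_op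

theorem isMorphism_op_β : IsMorphism P.srcβ P.tgtβ P.op :=
  P.intertwines.2.2.2.isMorphism P.adjoint_op_comp_op

/-- The operator `|ξ⟩₁` into the domain of `V`. -/
abbrev sket1 (ξ : P.βhat.space) : H →L[ℂ] P.Source := ket1 (b := b.op) P.βhat P.α ξ

/-- The operator `|η⟩₂` into the domain of `V`. -/
abbrev sket2 (η : P.α.space) : H →L[ℂ] P.Source := ket2 (b := b.op) P.βhat P.α η

/-- The operator `|ξ⟩₁` into the range of `V`. -/
abbrev tket1 (ξ : P.α.space) : H →L[ℂ] P.Target := ket1 P.α P.β ξ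

/-- The operator `|η⟩₂` into the range of `V`. -/
abbrev tket2 (η : P.β.space) : H →L[ℂ] P.Target := ket2 P.α P.β η

theorem isMorphism_sket1 (ξ : P.βhat.space) :
    IsMorphism P.β P.srcMix (P.sket1 ξ) ∧ IsMorphism P.βhat P.srcβhat (P.sket1 ξ) :=
  ⟨isMorphism_ket1 (b := b.op) _ _ _ _ ξ, isMorphism_ket1 (b := b.op) _ _ _ _ ξ⟩

theorem isMorphism_sket2 (η : P.α.space) :
    IsMorphism P.α P.srcα (P.sket2 η) ∧ IsMorphism P.β P.srcβ (P.sket2 η) :=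
  ⟨isMorphism_ket2 (b := b.op) _ _ _ _ η, isMorphism_ket2 (b := b.op) _ _ _ _ η⟩

theorem isMorphism_tket1 (ξ : P.α.space) :
    IsMorphism P.α P.tgtα (P.tket1 ξ) ∧ IsMorphism P.βhat P.tgtβhat (P.tket1 ξ) :=
  ⟨isMorphism_ket1 _ _ _ _ ξ, isMorphism_ket1 _ _ _ _ ξ⟩

theorem isMorphism_tket2 (η : P.β.space) :
    IsMorphism P.βhat P.tgtMix (P.tket2 η) ∧ IsMorphism P.β P.tgtβ (P.tket2 η) :=
  ⟨isMorphism_ket2 _ _ _ _ η, isMorphism_ket2 _ _ _ _ η⟩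

/-- The operator `V₁₃ = Σ₂₃ (V ⊗ Id)(Id ⊗ Σ)`. -/
def V13 : RTP (b := b.op) P.βhat P.tgtα →L[ℂ] RTP P.srcα P.β :=
  sigma23 (d := b.op) P.α P.β P.βhat P.α P.α_βhat P.βhat_α ∘L
    tensorId (b := b.op) P.srcMix P.tgtMix P.α P.op ∘L
    assocSymm (b := b.op) (d := b.op) P.βhat P.α P.β P.α P.α_β P.β_α ∘L
    idTensor (b := b.op) P.βhat P.tgtα (ltri (b := b.op) P.α P.β P.α P.β_α) (flip P.α P.β)

theorem isSemiMorphism_flip :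
    IsSemiMorphism P.tgtα (ltri (b := b.op) P.α P.β P.α P.β_α) (flip P.α P.β) := by
  intro X hX
  refine map_mem_of_mem_cspan (compL ℂ 𝔎 P.Target _ (flip P.α P.β)) (isClosed_cspan _) ?_ hX
  rintro _ ⟨ξ, η, hη, rfl⟩
  refine mem_cspan ⟨ξ, η, hη, ?_⟩
  show ket2 (b := b.op) P.β P.α ξ ∘L η = flip P.α P.β ∘L ket1 P.α P.β ξ ∘L η
  rw [← comp_assoc, flip_comp_ket1]

/-- The operator `V₁₃` commutes with the operators `|x⟩` that create the second tensor factor. -/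
theorem V13_comp_idTensor (x : P.α.space) :
    P.V13 ∘L idTensor (b := b.op) P.βhat P.α P.tgtα (P.tket1 x) =
      tensorId P.α P.srcα P.β (P.sket2 x) ∘L P.op := by
  have e1 : idTensor (b := b.op) P.βhat P.tgtα (ltri (b := b.op) P.α P.β P.α P.β_α)
      (flip P.α P.β) ∘L idTensor (b := b.op) P.βhat P.α P.tgtα (P.tket1 x) =
      idTensor (b := b.op) P.βhat P.α (ltri (b := b.op) P.α P.β P.α P.β_α)
        (ket2 (b := b.op) P.β P.α x) := by
    rw [idTensor_comp_idTensor (b := b.op) _ P.isSemiMorphism_flip.isIntertwiner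
      (P.isMorphism_tket1 x).1.1.isIntertwiner, flip_comp_ket1]
  have e2 := assocSymm_comp_idTensor (b := b.op) (d := b.op) P.βhat P.α P.β P.α P.α_β P.β_α x
  have e3 := IsIntertwiner.tensorId_comp_ket2 (b := b.op) P.α P.isMorphism_op_mix.1.isIntertwiner x
  have e4 := sigma23_comp_ket2 (d := b.op) P.α P.β P.βhat P.α P.α_βhat P.βhat_α x
  rw [V13, comp_assoc, comp_assoc, comp_assoc, e1, e2, e3, ← comp_assoc, e4]

/-- The operator `V₁₃` maps `|p⟩₁|η⟩₃` to `V (p ⊗ η)` on the first and third tensor factor. -/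
theorem V13_comp_ket1_comp_ket2 (p : P.βhat.space) (η : P.β.space) {X : P.tgtMix.space}
    (hX : P.op ∘L P.sket1 p ∘L (η : 𝔎 →L[ℂ] H) = X) :
    P.V13 ∘L ket1 (b := b.op) P.βhat P.tgtα p ∘L P.tket2 η =
      sigma23 (d := b.op) P.α P.β P.βhat P.α P.α_βhat P.βhat_α ∘L
        ket1 (b := b.op) P.tgtMix P.α X := by
  have e1 : idTensor (b := b.op) P.βhat P.tgtα (ltri (b := b.op) P.α P.β P.α P.β_α)
      (flip P.α P.β) ∘L ket1 (b := b.op) P.βhat P.tgtα p ∘L P.tket2 η =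
      ket1 (b := b.op) P.βhat (ltri (b := b.op) P.α P.β P.α P.β_α) p ∘L
        ket1 (b := b.op) P.β P.α η := by
    rw [← comp_assoc, IsIntertwiner.idTensor_comp_ket1 (b := b.op) _
      P.isSemiMorphism_flip.isIntertwiner, comp_assoc, flip_comp_ket2]
  have e2 := assoc_comp_ket1 (b := b.op) (d := b.op) P.βhat P.α P.β P.α P.α_β P.β_α p η
    (X := ⟨P.sket1 p ∘L (η : 𝔎 →L[ℂ] H), (P.isMorphism_sket1 p).1.1 _ η.2⟩) rfl
  have e3 := IsSemiMorphism.tensorId_comp_ket1 (b := b.op) P.α P.isMorphism_op_mix.1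
    ⟨P.sket1 p ∘L (η : 𝔎 →L[ℂ] H), (P.isMorphism_sket1 p).1.1 _ η.2⟩
  have e4 : X = ⟨P.op ∘L P.sket1 p ∘L (η : 𝔎 →L[ℂ] H),
    P.isMorphism_op_mix.1 _ ((P.isMorphism_sket1 p).1.1 _ η.2)⟩ := Subtype.ext hX.symm
  rw [V13, comp_assoc, comp_assoc, comp_assoc, e1, ← e2, ← comp_assoc (assocSymm _ _ _ _ _ _),
    assocSymm_comp_assoc, id_comp, e3, e4]

theorem adjoint_V13_comp_V13 : P.V13† ∘L P.V13 = ContinuousLinearMap.id ℂ _ := by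
  have e1 := sigma23_adjoint_comp_sigma23 (d := b.op) P.α P.β P.βhat P.α P.α_βhat P.βhat_α
  have e2 : (tensorId (b := b.op) P.srcMix P.tgtMix P.α P.op)† ∘L
      tensorId (b := b.op) P.srcMix P.tgtMix P.α P.op = ContinuousLinearMap.id ℂ _ := by
    have hi := P.isMorphism_op_mix.1.isIntertwiner
    rw [tensorId_adjoint (b := b.op) P.α hi, tensorId_comp_tensorId (b := b.op) P.α hi.adjoint hi,
      P.adjoint_op_comp_op, tensorId_id (b := b.op)]
  have e3 : (assocSymm (b := b.op) (d := b.op) P.βhat P.α P.β P.α P.α_β P.β_α)† ∘L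
      assocSymm (b := b.op) (d := b.op) P.βhat P.α P.β P.α P.α_β P.β_α =
        ContinuousLinearMap.id ℂ _ := by
    rw [← assoc_adjoint, adjoint_adjoint, assoc_adjoint, assoc_comp_assocSymm]
  have e4 : (idTensor (b := b.op) P.βhat P.tgtα (ltri (b := b.op) P.α P.β P.α P.β_α)
      (flip P.α P.β))† ∘L idTensor (b := b.op) P.βhat P.tgtα
      (ltri (b := b.op) P.α P.β P.α P.β_α) (flip P.α P.β) = ContinuousLinearMap.id ℂ _ := by
    have hi := P.isSemiMorphism_flip.isIntertwiner
    rw [idTensor_adjoint (b := b.op) P.βhat hi,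
      idTensor_comp_idTensor (b := b.op) P.βhat hi.adjoint hi, flip_adjoint_comp_flip,
      idTensor_id (b := b.op)]
  rw [V13]
  simp only [adjoint_comp, comp_assoc_nondefeq]
  rw [← comp_assoc ((sigma23 _ _ _ _ _ _)†) _ _, e1, id_comp,
    ← comp_assoc ((tensorId _ _ _ _)†) _ _, e2, id_comp,
    ← comp_assoc ((assocSymm _ _ _ _ _ _)†) _ _, e3, id_comp, e4]

/-- The operator `V₁₂` from `(H ⊗ H) ⊗ H`, formed with respect to `α ◁ α` and `β`, to
`(H ⊗ H) ⊗ H`, formed with respect to `α ▷ α` and `β`, followed by the associativity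
isomorphism. -/
def V12 : RTP P.srcα P.β →L[ℂ] RTP P.α P.tgtβ :=
  assoc P.α P.β P.α P.β P.β_α P.α_β ∘L tensorId P.srcα P.tgtα P.β P.op

theorem adjoint_V12_comp_V12 : P.V12† ∘L P.V12 = ContinuousLinearMap.id ℂ _ := by
  have hi := P.isMorphism_op_α.1.isIntertwiner
  rw [V12, adjoint_comp, comp_assoc, ← comp_assoc ((assoc _ _ _ _ _ _)†) _ _,
    assoc_adjoint_comp_assoc, id_comp, tensorId_adjoint P.β hi,
    tensorId_comp_tensorId P.β hi.adjoint hi, P.adjoint_op_comp_op, tensorId_id]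

/-- The pentagon equation `V₂₃ V₁₂ = V₁₂ V₁₃ V₂₃`. -/
theorem pentagon_eq :
    idTensor P.α P.srcβ P.tgtβ P.op ∘L
      assoc (d := b.op) P.α P.β P.βhat P.α P.β_βhat P.βhat_β ∘L
      tensorId (b := b.op) P.srcβhat P.tgtβhat P.α P.op =
    P.V12 ∘L P.V13 ∘L idTensor (b := b.op) P.βhat P.srcα P.tgtα P.op ∘L
      assoc (b := b.op) (d := b.op) P.βhat P.α P.βhat P.α P.α_βhat P.βhat_α := by
  rw [V12, V13, comp_assoc, comp_assoc, comp_assoc, comp_assoc]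
  exact P.pentagon.eq

theorem isMorphism_op_comp_sket2 (y : P.α.space) :
    IsMorphism P.α P.tgtα (P.op ∘L P.sket2 y) ∧ IsMorphism P.β P.tgtβ (P.op ∘L P.sket2 y) :=
  ⟨P.isMorphism_op_α.comp (P.isMorphism_sket2 y).1, P.isMorphism_op_β.comp (P.isMorphism_sket2 y).2⟩

theorem isMorphism_adjoint_op_comp_tket1 (y : P.α.space) :
    IsMorphism P.α P.srcα (P.op† ∘L P.tket1 y) ∧
      IsMorphism P.βhat P.srcβhat (P.op† ∘L P.tket1 y) :=
  ⟨P.isMorphism_op_α.adjoint.comp (P.isMorphism_tket1 y).1,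
    P.isMorphism_op_βhat.adjoint.comp (P.isMorphism_tket1 y).2⟩

/-- The pentagon equation on operators `|y⟩₃`, in the form
`(Id ⊗ V |y⟩₂) V = V₁₂ V₁₃ (Id ⊗ V |y⟩₂)`. -/
theorem idTensor_comp_op (y : P.α.space) :
    idTensor P.α P.β P.tgtβ (P.op ∘L P.sket2 y) ∘L P.op =
      P.V12 ∘L P.V13 ∘L idTensor (b := b.op) P.βhat P.α P.tgtα (P.op ∘L P.sket2 y) := by
  have e1 := IsIntertwiner.tensorId_comp_ket2 (b := b.op) P.α
    P.isMorphism_op_βhat.1.isIntertwiner y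
  have e2 := assoc_comp_ket2 (d := b.op) P.α P.β P.βhat P.α P.β_βhat P.βhat_β y
  have e3 := assoc_comp_ket2 (b := b.op) (d := b.op) P.βhat P.α P.βhat P.α P.α_βhat P.βhat_α y
  have e4 := idTensor_comp_idTensor P.α P.isMorphism_op_β.1.isIntertwiner
    (P.isMorphism_sket2 y).2.1.isIntertwiner
  have e5 := idTensor_comp_idTensor (b := b.op) P.βhat P.isMorphism_op_α.1.isIntertwiner
    (P.isMorphism_sket2 y).1.1.isIntertwiner
  calc idTensor P.α P.β P.tgtβ (P.op ∘L P.sket2 y) ∘L P.op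
      = (idTensor P.α P.srcβ P.tgtβ P.op ∘L
          assoc (d := b.op) P.α P.β P.βhat P.α P.β_βhat P.βhat_β ∘L
          tensorId (b := b.op) P.srcβhat P.tgtβhat P.α P.op) ∘L
            ket2 (b := b.op) P.srcβhat P.α y := by
        rw [comp_assoc, comp_assoc, e1, ← comp_assoc (assoc _ _ _ _ _ _), e2, ← comp_assoc, e4]
    _ = (P.V12 ∘L P.V13 ∘L idTensor (b := b.op) P.βhat P.srcα P.tgtα P.op ∘L
          assoc (b := b.op) (d := b.op) P.βhat P.α P.βhat P.α P.α_βhat P.βhat_α) ∘L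
            ket2 (b := b.op) P.srcβhat P.α y := by rw [P.pentagon_eq]
    _ = _ := by rw [comp_assoc, comp_assoc, comp_assoc, e3, e5]

end PseudoMultUnitary

end PMU

/-! ### The spaces `C_V`, `Â_V` and `A_V` -/

section PMU

variable {𝔎 : Type u} [NormedAddCommGroup 𝔎] [InnerProductSpace ℂ 𝔎] [CompleteSpace 𝔎]
  {b : CStarBase 𝔎}
  {H : Type v} [NormedAddCommGroup H] [InnerProductSpace ℂ H] [CompleteSpace H]

namespace PseudoMultUnitary

variable (P : PseudoMultUnitary b H)

/-- The generator `⟨a|₁ V |x⟩₂` of `C_V`. -/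
def cElt (a x : P.α.space) : H →L[ℂ] H := (P.tket1 a)† ∘L P.op ∘L P.sket2 x

/-- The generator `⟨η|₂ V |x⟩₂` of `Â_V`. -/
def hatElt (η : P.β.space) (x : P.α.space) : H →L[ℂ] H := (P.tket2 η)† ∘L P.op ∘L P.sket2 x

/-- The generator `⟨a|₁ V |z⟩₁` of `A_V`. -/
def legElt (a : P.α.space) (z : P.βhat.space) : H →L[ℂ] H := (P.tket1 a)† ∘L P.op ∘L P.sket1 z

theorem cElt_mem (a x : P.α.space) : P.cElt a x ∈ P.cSpace := mem_cspan ⟨a, x, rfl⟩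

theorem hatElt_mem (η : P.β.space) (x : P.α.space) : P.hatElt η x ∈ P.legHat :=
  mem_cspan ⟨η, x, rfl⟩

theorem legElt_mem (a : P.α.space) (z : P.βhat.space) : P.legElt a z ∈ P.leg :=
  mem_cspan ⟨a, z, rfl⟩

theorem isMorphism_cElt (a x : P.α.space) : IsMorphism P.α P.α (P.cElt a x) :=
  (P.isMorphism_tket1 a).1.adjoint.comp (P.isMorphism_op_comp_sket2 x).1

theorem isMorphism_hatElt (η : P.β.space) (x : P.α.space) :
    IsMorphism P.β P.β (P.hatElt η x) :=
  (P.isMorphism_tket2 η).2.adjoint.comp (P.isMorphism_op_comp_sket2 x).2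

theorem isMorphism_legElt (a : P.α.space) (z : P.βhat.space) :
    IsMorphism P.βhat P.βhat (P.legElt a z) :=
  (P.isMorphism_tket1 a).2.adjoint.comp (P.isMorphism_op_βhat.comp (P.isMorphism_sket1 z).2)

theorem cElt_adjoint (a x : P.α.space) :
    (P.cElt a x)† = (P.sket2 x)† ∘L P.op† ∘L P.tket1 a := by
  rw [cElt, adjoint_comp, adjoint_comp, adjoint_adjoint, comp_assoc]

theorem hatElt_adjoint (η : P.β.space) (x : P.α.space) :
    (P.hatElt η x)† = (P.sket2 x)† ∘L P.op† ∘L P.tket2 η := by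
  rw [hatElt, adjoint_comp, adjoint_comp, adjoint_adjoint, comp_assoc]

theorem legElt_adjoint (a : P.α.space) (z : P.βhat.space) :
    (P.legElt a z)† = (P.sket1 z)† ∘L P.op† ∘L P.tket1 a := by
  rw [legElt, adjoint_comp, adjoint_comp, adjoint_adjoint, comp_assoc]

/-- The adjoint of `V₁₃ (Id ⊗ |x⟩₁) = (|x⟩₂ ⊗ Id) V`, solved for `V (Id ⊗ ⟨x|₁)`; this uses that
`V₁₃` is isometric. -/
theorem adjoint_idTensor_tket1 (x : P.α.space) :
    P.op ∘L (idTensor (b := b.op) P.βhat P.α P.tgtα (P.tket1 x))† =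
      (tensorId P.α P.srcα P.β (P.sket2 x))† ∘L P.V13 := by
  have h := congrArg ContinuousLinearMap.adjoint (P.V13_comp_idTensor x)
  rw [adjoint_comp, adjoint_comp] at h
  rw [← comp_id ((idTensor _ _ _ _)†), ← P.adjoint_V13_comp_V13, ← comp_assoc _ _ P.V13, h,
    ← comp_assoc, ← comp_assoc, P.op_comp_adjoint_op, id_comp]

theorem V12_comp_tensorId (x : P.α.space) : P.V12 ∘L tensorId P.α P.srcα P.β (P.sket2 x) =
    assoc P.α P.β P.α P.β P.β_α P.α_β ∘L tensorId P.α P.tgtα P.β (P.op ∘L P.sket2 x) := by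
  rw [V12, comp_assoc, tensorId_comp_tensorId P.β P.isMorphism_op_α.1.isIntertwiner
    (P.isMorphism_sket2 x).1.1.isIntertwiner]

/-- The conjugate `V (Id ⊗ c) V*` of a generator `c` of `C_V`, as a consequence of the pentagon
equation `V₁₃ V₂₃ V₁₂* = V₁₂* V₂₃`. -/
theorem op_comp_idTensor_cElt (x y : P.α.space) :
    P.op ∘L idTensor (b := b.op) P.βhat P.α P.α (P.cElt x y) ∘L P.op† =
      (assoc P.α P.β P.α P.β P.β_α P.α_β ∘L tensorId P.α P.tgtα P.β (P.op ∘L P.sket2 x))† ∘L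
        idTensor P.α P.β P.tgtβ (P.op ∘L P.sket2 y) := by
  have h1 : idTensor (b := b.op) P.βhat P.α P.α (P.cElt x y) =
      (idTensor (b := b.op) P.βhat P.α P.tgtα (P.tket1 x))† ∘L
        idTensor (b := b.op) P.βhat P.α P.tgtα (P.op ∘L P.sket2 y) := by
    have hx := (P.isMorphism_tket1 x).1.1.isIntertwiner
    rw [idTensor_adjoint (b := b.op) P.βhat hx, idTensor_comp_idTensor (b := b.op) P.βhat
      hx.adjoint (P.isMorphism_op_comp_sket2 y).1.1.isIntertwiner]
    rfl
  have h2 : P.V13 ∘L idTensor (b := b.op) P.βhat P.α P.tgtα (P.op ∘L P.sket2 y) ∘L P.op† =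
      P.V12† ∘L idTensor P.α P.β P.tgtβ (P.op ∘L P.sket2 y) := by
    rw [← comp_id (idTensor P.α _ _ _), ← P.op_comp_adjoint_op, ← comp_assoc _ P.op,
      P.idTensor_comp_op, comp_assoc, comp_assoc, ← comp_assoc (P.V12†), P.adjoint_V12_comp_V12,
      id_comp]
  rw [h1, comp_assoc, ← comp_assoc P.op, P.adjoint_idTensor_tket1, comp_assoc, h2,
    ← P.V12_comp_tensorId, adjoint_comp, comp_assoc]

/-- The conjugate `V* (c ⊗ Id) V` of a generator `c` of `C_V`, as a consequence of the pentagon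
equation `V₂₃* V₁₂ V₁₃ = V₁₂ V₂₃*`. -/
theorem adjoint_op_comp_tensorId_cElt (x y : P.α.space) :
    P.op† ∘L tensorId P.α P.α P.β (P.cElt x y) ∘L P.op =
      (tensorId (b := b.op) P.βhat P.srcβhat P.α (P.op† ∘L P.tket1 x))† ∘L
        assocSymm (b := b.op) (d := b.op) P.βhat P.α P.βhat P.α P.α_βhat P.βhat_α ∘L
          idTensor (b := b.op) P.βhat P.α P.srcα (P.op† ∘L P.tket1 y) := by
  have hx := (P.isMorphism_tket1 x).1.1.isIntertwiner
  have hx' := (P.isMorphism_tket1 x).2.1.isIntertwiner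
  have h1 : tensorId P.α P.α P.β (P.cElt x y) =
      (ket1 P.α P.tgtβ x)† ∘L P.V12 ∘L tensorId P.α P.srcα P.β (P.sket2 y) := by
    rw [V12_comp_tensorId, ← comp_assoc, ← adjoint_adjoint (assoc _ _ _ _ _ _), ← adjoint_comp,
      assoc_adjoint, assocSymm_comp_ket1, tensorId_adjoint P.β hx,
      tensorId_comp_tensorId P.β hx.adjoint (P.isMorphism_op_comp_sket2 y).1.1.isIntertwiner]
    rfl
  have h2 : P.V12 ∘L tensorId P.α P.srcα P.β (P.sket2 y) ∘L P.op =
      idTensor P.α P.srcβ P.tgtβ P.op ∘L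
      assoc (d := b.op) P.α P.β P.βhat P.α P.β_βhat P.βhat_β ∘L
      tensorId (b := b.op) P.srcβhat P.tgtβhat P.α P.op ∘L
      assocSymm (b := b.op) (d := b.op) P.βhat P.α P.βhat P.α P.α_βhat P.βhat_α ∘L
      idTensor (b := b.op) P.βhat P.α P.srcα (P.op† ∘L P.tket1 y) := by
    have e : idTensor (b := b.op) P.βhat P.α P.tgtα (P.tket1 y) =
        idTensor (b := b.op) P.βhat P.srcα P.tgtα P.op ∘L
          idTensor (b := b.op) P.βhat P.α P.srcα (P.op† ∘L P.tket1 y) := by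
      rw [idTensor_comp_idTensor (b := b.op) P.βhat P.isMorphism_op_α.1.isIntertwiner
        (P.isMorphism_adjoint_op_comp_tket1 y).1.1.isIntertwiner, ← comp_assoc,
        P.op_comp_adjoint_op, id_comp]
    have h := congrArg (sandwich (ContinuousLinearMap.id ℂ _)
      (assocSymm (b := b.op) (d := b.op) P.βhat P.α P.βhat P.α P.α_βhat P.βhat_α ∘L
      idTensor (b := b.op) P.βhat P.α P.srcα (P.op† ∘L P.tket1 y))) P.pentagon_eq
    rw [sandwich_apply, sandwich_apply, id_comp, id_comp, comp_assoc, comp_assoc, comp_assoc,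
      comp_assoc, comp_assoc,
      ← comp_assoc (assoc (b := b.op) (d := b.op) _ _ _ _ _ _) (assocSymm _ _ _ _ _ _),
      assoc_comp_assocSymm, id_comp] at h
    rw [h, ← P.V13_comp_idTensor, e]
  have h3 : (ket1 P.α P.tgtβ x)† ∘L idTensor P.α P.srcβ P.tgtβ P.op =
      P.op ∘L (ket1 P.α P.srcβ x)† := by
    have hi := P.isMorphism_op_β.1.isIntertwiner
    rw [← adjoint_adjoint (idTensor _ _ _ _), ← adjoint_comp, idTensor_adjoint _ hi,
      hi.adjoint.idTensor_comp_ket1, adjoint_comp, adjoint_adjoint]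
  have h4 : (ket1 P.α P.srcβ x)† ∘L assoc (d := b.op) P.α P.β P.βhat P.α P.β_βhat P.βhat_β ∘L
      tensorId (b := b.op) P.srcβhat P.tgtβhat P.α P.op =
      (tensorId (b := b.op) P.βhat P.srcβhat P.α (P.op† ∘L P.tket1 x))† := by
    have hi := P.isMorphism_op_βhat.1.isIntertwiner
    rw [← comp_assoc, ← adjoint_adjoint (assoc _ _ _ _ _ _), ← adjoint_comp, assoc_adjoint,
      assocSymm_comp_ket1, ← tensorId_comp_tensorId (b := b.op) P.α hi.adjoint hx', adjoint_comp,
      tensorId_adjoint (b := b.op) P.α hi.adjoint, adjoint_adjoint]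
  rw [h1, comp_assoc, comp_assoc, h2, ← comp_assoc _ (idTensor _ _ _ _), h3, comp_assoc,
    ← comp_assoc _ P.op, P.adjoint_op_comp_op, id_comp, ← h4]
  simp only [comp_assoc_nondefeq]

end PseudoMultUnitary

end PMU

section PMU

variable {𝔎 : Type u} [NormedAddCommGroup 𝔎] [InnerProductSpace ℂ 𝔎] [CompleteSpace 𝔎]
  {b : CStarBase 𝔎}
  {H : Type v} [NormedAddCommGroup H] [InnerProductSpace ℂ H] [CompleteSpace H]

namespace PseudoMultUnitary

variable (P : PseudoMultUnitary b H)

/-! ### Slices of `V (Id ⊗ C_V) V*` and `V* (C_V ⊗ Id) V` -/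

/-- With `k = η η'*`, this slice is a product of a generator of `C_V` and the adjoint of another
one. -/
theorem adjoint_tket1_comp_comp_tket1_mem_cSpace (ξ ξ' : P.α.space) {k : H →L[ℂ] H}
    (hk : k ∈ P.cSpace) : (P.tket1 ξ)† ∘L
      (P.op ∘L idTensor (b := b.op) P.βhat P.α P.α k ∘L P.op†) ∘L P.tket1 ξ' ∈ P.cSpace := by
  refine idTensor_mem_of_mem_cspan (b := b.op) P.βhat P.α P.α ((sandwich ((P.tket1 ξ)†)
    (P.tket1 ξ')).comp (sandwich P.op (P.op†))) (isClosed_cspan _) ?_ hk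
  rintro _ ⟨x, y, rfl⟩
  refine ⟨(P.isMorphism_cElt x y).1.isIntertwiner, ?_⟩
  show (P.tket1 ξ)† ∘L (P.op ∘L idTensor (b := b.op) P.βhat P.α P.α (P.cElt x y) ∘L P.op†) ∘L
    P.tket1 ξ' ∈ P.cSpace
  have hx := (P.isMorphism_op_comp_sket2 x).1.1
  have e1 := (P.isMorphism_op_comp_sket2 y).2.1.isIntertwiner.idTensor_comp_ket1 P.α ξ'
  have e2 := hx.tensorId_comp_ket1 P.β ξ
  have key : ∀ X : P.tgtα.space, (ket1 P.tgtα P.β X)† ∘L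
      (assoc P.α P.β P.α P.β P.β_α P.α_β)† ∘L ket1 P.α P.tgtβ ξ' ∘L P.op ∘L P.sket2 y ∈
        P.cSpace := by
    intro X
    refine ket1_mem_of_cspan P.tgtα P.β (sandwichAdjoint (ContinuousLinearMap.id ℂ H)
      ((assoc P.α P.β P.α P.β P.β_α P.α_β)† ∘L ket1 P.α P.tgtβ ξ' ∘L P.op ∘L P.sket2 y))
      (isClosed_cspan _) rfl ?_ X
    rintro X ⟨s, r, hr, hX⟩
    have e3 := assoc_comp_ket1 P.α P.β P.α P.β P.β_α P.α_β s ⟨r, hr⟩ hX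
    have hc := P.α.inner_mem s.2 ξ'.2
    rw [sandwichAdjoint_apply, id_comp, ← comp_assoc, ← adjoint_comp, e3, adjoint_comp,
      comp_assoc, ← comp_assoc _ (ket1 _ _ _), ket1_adjoint_comp_ket1, ← comp_assoc,
      adjoint_ket1_comp_rho_ltri P.β P.α P.β P.α_β P.β_α hc]
    exact P.cElt_mem _ y
  rw [P.op_comp_idTensor_cElt, comp_assoc, e1, ← comp_assoc, ← adjoint_comp, comp_assoc, e2,
    adjoint_comp, comp_assoc]
  exact key _

/-- With `k = ξ ξ'*`, this slice is a product of the adjoint of a generator of `C_V` and another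
generator. -/
theorem adjoint_sket2_comp_comp_sket2_mem_cSpace (η η' : P.α.space) {k : H →L[ℂ] H}
    (hk : k ∈ P.cSpace) : (P.sket2 η)† ∘L
      (P.op† ∘L tensorId P.α P.α P.β k ∘L P.op) ∘L P.sket2 η' ∈ P.cSpace := by
  refine tensorId_mem_of_mem_cspan P.α P.α P.β ((sandwich ((P.sket2 η)†)
    (P.sket2 η')).comp (sandwich (P.op†) P.op)) (isClosed_cspan _) ?_ hk
  rintro _ ⟨x, y, rfl⟩
  refine ⟨(P.isMorphism_cElt x y).1.isIntertwiner, ?_⟩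
  show (P.sket2 η)† ∘L (P.op† ∘L tensorId P.α P.α P.β (P.cElt x y) ∘L P.op) ∘L P.sket2 η' ∈
    P.cSpace
  have e1 := IsSemiMorphism.idTensor_comp_ket2 (b := b.op) P.βhat
    (P.isMorphism_adjoint_op_comp_tket1 y).1.1 η'
  have e2 := IsIntertwiner.tensorId_comp_ket2 (b := b.op) P.α
    (P.isMorphism_adjoint_op_comp_tket1 x).2.1.isIntertwiner η
  have key : ∀ X : P.srcα.space, (ket2 (b := b.op) P.srcβhat P.α η ∘L P.op† ∘L P.tket1 x)† ∘L
      assocSymm (b := b.op) (d := b.op) P.βhat P.α P.βhat P.α P.α_βhat P.βhat_α ∘L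
        ket2 (b := b.op) P.βhat P.srcα X ∈ P.cSpace := by
    intro X
    refine ket2_mem_of_cspan (b := b.op) P.βhat P.srcα
      ((sandwich ((ket2 (b := b.op) P.srcβhat P.α η ∘L P.op† ∘L P.tket1 x)† ∘L
        assocSymm (b := b.op) (d := b.op) P.βhat P.α P.βhat P.α P.α_βhat P.βhat_α)
        (ContinuousLinearMap.id ℂ H)))
      (isClosed_cspan _) rfl ?_ X
    rintro X ⟨s, r, hr, hX⟩
    have e3 := assocSymm_comp_ket2 (b := b.op) (d := b.op) P.βhat P.α P.βhat P.α P.α_βhat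
      P.βhat_α s ⟨r, hr⟩ hX
    have hc := BaseModule.inner_mem P.α η.2 s.2
    have e4 := ket2_adjoint_comp_ket2 (b := b.op) P.srcβhat P.α η s
    have e5 := rho_rtri_comp_ket2 (b := b.op) P.βhat P.α P.βhat P.α_βhat P.βhat_α hc ⟨r, hr⟩
    rw [sandwich_apply, comp_id, comp_assoc, e3, adjoint_comp, comp_assoc,
      ← comp_assoc _ (ket2 _ _ _), e4, e5, adjoint_comp, adjoint_adjoint, comp_assoc]
    exact P.cElt_mem x _
  rw [P.adjoint_op_comp_tensorId_cElt, comp_assoc, comp_assoc, e1, ← comp_assoc, ← adjoint_comp,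
    e2]
  exact key _

/-- The map behind the slices `⟨q|₂ V (Id ⊗ c) V* |p⟩₂`: at `X = |r⟩₂ s`, it has the adjoint of
an element of `Â_V` as value. -/
theorem adjoint_comp_assocSymm_comp_ket2 (q r s : P.β.space) (x : P.α.space)
    {X : P.tgtβ.space} (hX : P.tket2 r ∘L (s : 𝔎 →L[ℂ] H) = X) :
    (ket2 P.tgtα P.β q ∘L P.op ∘L P.sket2 x)† ∘L
      assocSymm P.α P.β P.α P.β P.β_α P.α_β ∘L ket2 P.α P.tgtβ X =
    (P.hatElt ⟨P.α.rho ((q : 𝔎 →L[ℂ] H)† ∘L (r : 𝔎 →L[ℂ] H)) ∘L s,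
      P.α_β.mem (P.β.inner_mem q.2 r.2) s.2⟩ x)† := by
  rw [assocSymm_comp_ket2 P.α P.β P.α P.β P.β_α P.α_β r s hX, adjoint_comp, comp_assoc,
    ← comp_assoc _ (ket2 P.tgtα P.β r), ket2_adjoint_comp_ket2,
    rho_rtri_comp_ket2 P.α P.β P.α P.β_α P.α_β (P.β.inner_mem q.2 r.2), adjoint_comp,
    hatElt_adjoint, comp_assoc]

theorem tket2_slice_cElt (q p : P.β.space) (x y : P.α.space) : (P.tket2 q)† ∘L
      (P.op ∘L idTensor (b := b.op) P.βhat P.α P.α (P.cElt x y) ∘L P.op†) ∘L P.tket2 p =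
    (ket2 P.tgtα P.β q ∘L P.op ∘L P.sket2 x)† ∘L
      assocSymm P.α P.β P.α P.β P.β_α P.α_β ∘L ket2 P.α P.tgtβ
        ⟨(P.op ∘L P.sket2 y) ∘L p, (P.isMorphism_op_comp_sket2 y).2.1 p p.2⟩ := by
  have e1 := (P.isMorphism_op_comp_sket2 y).2.1.idTensor_comp_ket2 P.α p
  have e2 := (P.isMorphism_op_comp_sket2 x).1.1.isIntertwiner.tensorId_comp_ket2 P.β q
  rw [P.op_comp_idTensor_cElt, comp_assoc, e1, ← comp_assoc, ← adjoint_comp, comp_assoc, e2,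
    adjoint_comp (assoc _ _ _ _ _ _), assoc_adjoint, comp_assoc]

/-- The slices `⟨q|₂ V (Id ⊗ k) V* |p⟩₂` lie in the adjoint of `Â_V`. -/
theorem tket2_slice_mem (q p : P.β.space) {k : H →L[ℂ] H} (hk : k ∈ P.cSpace) :
    (P.tket2 q)† ∘L (P.op ∘L idTensor (b := b.op) P.βhat P.α P.α k ∘L P.op†) ∘L P.tket2 p ∈
      cspan {T | ∃ η x, (P.hatElt η x)† = T} := by
  refine idTensor_mem_of_mem_cspan (b := b.op) P.βhat P.α P.α ((sandwich ((P.tket2 q)†)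
    (P.tket2 p)).comp (sandwich P.op (P.op†))) (isClosed_cspan _) ?_ hk
  rintro _ ⟨x, y, rfl⟩
  refine ⟨(P.isMorphism_cElt x y).1.isIntertwiner, ?_⟩
  show (P.tket2 q)† ∘L (P.op ∘L idTensor (b := b.op) P.βhat P.α P.α (P.cElt x y) ∘L P.op†) ∘L
    P.tket2 p ∈ cspan {T | ∃ η x, (P.hatElt η x)† = T}
  rw [tket2_slice_cElt]
  refine ket2_mem_of_cspan P.α P.tgtβ (sandwich ((ket2 P.tgtα P.β q ∘L P.op ∘L P.sket2 x)† ∘L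
      assocSymm P.α P.β P.α P.β P.β_α P.α_β) (ContinuousLinearMap.id ℂ H))
    (isClosed_cspan _) rfl ?_ _
  rintro X ⟨r, s, hs, hX⟩
  rw [sandwich_apply, comp_id, comp_assoc,
    P.adjoint_comp_assocSymm_comp_ket2 q r ⟨s, hs⟩ x hX]
  exact mem_cspan ⟨_, _, rfl⟩

/-- The slices `⟨q|₂ V (Id ⊗ c) V* |p⟩₂` of the generators `c` of `C_V` span the adjoint of
`Â_V`. -/
theorem hatElt_adjoint_mem_cspan (η : P.β.space) (x : P.α.space) : (P.hatElt η x)† ∈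
    cspan {T | ∃ q p : P.β.space, ∃ x y, (P.tket2 q)† ∘L (P.op ∘L idTensor (b := b.op) P.βhat P.α
      P.α (P.cElt x y) ∘L P.op†) ∘L P.tket2 p = T} := by
  set N := cspan {T | ∃ q p : P.β.space, ∃ x y, (P.tket2 q)† ∘L (P.op ∘L idTensor (b := b.op)
    P.βhat P.α P.α (P.cElt x y) ∘L P.op†) ∘L P.tket2 p = T} with hN
  have h1 : ∀ (q : P.β.space) (X : P.tgtβ.space), (ket2 P.tgtα P.β q ∘L P.op ∘L P.sket2 x)† ∘L
      assocSymm P.α P.β P.α P.β P.β_α P.α_β ∘L ket2 P.α P.tgtβ X ∈ N := by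
    intro q X
    refine ket2_mem_of_cspan P.α P.tgtβ (sandwich ((ket2 P.tgtα P.β q ∘L P.op ∘L P.sket2 x)† ∘L
      assocSymm P.α P.β P.α P.β P.β_α P.α_β) (ContinuousLinearMap.id ℂ H))
      (isClosed_cspan _) (P.intertwines.2.2.2.cspan_eq rfl) ?_ X
    rintro X ⟨_, ⟨y, p, hp, rfl⟩, hX⟩
    have e : X = ⟨(P.op ∘L P.sket2 y) ∘L p, (P.isMorphism_op_comp_sket2 y).2.1 p hp⟩ :=
      Subtype.ext hX.symm
    rw [sandwich_apply, comp_id, comp_assoc, e, ← P.tket2_slice_cElt q ⟨p, hp⟩ x y]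
    exact mem_cspan ⟨q, ⟨p, hp⟩, x, y, rfl⟩
  rw [hatElt_adjoint, ← comp_assoc, ← adjoint_comp]
  refine ket2_mem_of_cspan P.α P.β (sandwich ((P.op ∘L P.sket2 x)†) (ContinuousLinearMap.id ℂ H))
    (isClosed_cspan _) (P.α_β.cspan_inner_eq P.β) ?_ η
  rintro η ⟨q, r, s, hs, hη⟩
  have h2 := h1 q ⟨P.tket2 r ∘L s, (P.isMorphism_tket2 r).2.1 s hs⟩
  rw [P.adjoint_comp_assocSymm_comp_ket2 q r ⟨s, hs⟩ x rfl, hatElt_adjoint, ← comp_assoc,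
    ← adjoint_comp] at h2
  have e : η = ⟨_, P.α_β.mem (P.β.inner_mem q.2 r.2) hs⟩ := Subtype.ext hη.symm
  rw [sandwich_apply, comp_id, e]
  exact h2

/-- The map behind the slices `⟨q|₁ V* (c ⊗ Id) V |p⟩₁`: at `X = |s⟩₁ r`, it has the adjoint of
an element of `A_V` as value. -/
theorem adjoint_ket1_comp_assocSymm_comp_ket1 (p s r : P.βhat.space) (y : P.α.space)
    {X : P.srcβhat.space} (hX : P.sket1 s ∘L (r : 𝔎 →L[ℂ] H) = X) :
    (ket1 (b := b.op) P.srcβhat P.α X)† ∘L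
      assocSymm (b := b.op) (d := b.op) P.βhat P.α P.βhat P.α P.α_βhat P.βhat_α ∘L
        ket1 (b := b.op) P.βhat P.srcα p ∘L P.op† ∘L P.tket1 y =
    (P.legElt y ⟨P.α.rho ((p : 𝔎 →L[ℂ] H)† ∘L (s : 𝔎 →L[ℂ] H)) ∘L r,
      P.α_βhat.mem (P.βhat.inner_mem p.2 s.2) r.2⟩)† := by
  have e1 := assoc_comp_ket1 (b := b.op) (d := b.op) P.βhat P.α P.βhat P.α P.α_βhat P.βhat_α s r hX
  have e2 := ket1_adjoint_comp_ket1 (b := b.op) P.βhat P.srcα s p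
  have hc := P.βhat.inner_mem s.2 p.2
  have e3 := adjoint_ket1_comp_rho_ltri (b := b.op) P.α P.βhat P.α P.βhat_α P.α_βhat hc r
  rw [← assoc_adjoint, ← comp_assoc, ← adjoint_comp, e1, adjoint_comp, comp_assoc,
    ← comp_assoc _ (ket1 (b := b.op) P.βhat P.srcα p), e2, ← comp_assoc, e3, legElt_adjoint]
  simp only [adjoint_comp, adjoint_adjoint]

theorem sket1_slice_cElt (q p : P.βhat.space) (x y : P.α.space) : (P.sket1 q)† ∘L
      (P.op† ∘L tensorId P.α P.α P.β (P.cElt x y) ∘L P.op) ∘L P.sket1 p =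
    (ket1 (b := b.op) P.srcβhat P.α ⟨(P.op† ∘L P.tket1 x) ∘L q,
        (P.isMorphism_adjoint_op_comp_tket1 x).2.1 q q.2⟩)† ∘L
      assocSymm (b := b.op) (d := b.op) P.βhat P.α P.βhat P.α P.α_βhat P.βhat_α ∘L
        ket1 (b := b.op) P.βhat P.srcα p ∘L P.op† ∘L P.tket1 y := by
  have e1 := IsIntertwiner.idTensor_comp_ket1 (b := b.op) P.βhat
    (P.isMorphism_adjoint_op_comp_tket1 y).1.1.isIntertwiner p
  have e2 := IsSemiMorphism.tensorId_comp_ket1 (b := b.op) P.α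
    (P.isMorphism_adjoint_op_comp_tket1 x).2.1 q
  rw [P.adjoint_op_comp_tensorId_cElt, comp_assoc, comp_assoc, e1, ← comp_assoc, ← adjoint_comp,
    e2]

/-- The slices `⟨q|₁ V* (k ⊗ Id) V |p⟩₁` lie in the adjoint of `A_V`. -/
theorem sket1_slice_mem (q p : P.βhat.space) {k : H →L[ℂ] H} (hk : k ∈ P.cSpace) :
    (P.sket1 q)† ∘L (P.op† ∘L tensorId P.α P.α P.β k ∘L P.op) ∘L P.sket1 p ∈
      cspan {T | ∃ a z, (P.legElt a z)† = T} := by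
  refine tensorId_mem_of_mem_cspan P.α P.α P.β ((sandwich ((P.sket1 q)†)
    (P.sket1 p)).comp (sandwich (P.op†) P.op)) (isClosed_cspan _) ?_ hk
  rintro _ ⟨x, y, rfl⟩
  refine ⟨(P.isMorphism_cElt x y).1.isIntertwiner, ?_⟩
  show (P.sket1 q)† ∘L (P.op† ∘L tensorId P.α P.α P.β (P.cElt x y) ∘L P.op) ∘L P.sket1 p ∈
    cspan {T | ∃ a z, (P.legElt a z)† = T}
  rw [sket1_slice_cElt]
  refine ket1_mem_of_cspan (b := b.op) P.srcβhat P.α (sandwichAdjoint (ContinuousLinearMap.id ℂ H)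
      (assocSymm (b := b.op) (d := b.op) P.βhat P.α P.βhat P.α P.α_βhat P.βhat_α ∘L
        ket1 (b := b.op) P.βhat P.srcα p ∘L P.op† ∘L P.tket1 y))
    (isClosed_cspan _) rfl ?_ _
  rintro X ⟨s, r, hr, hX⟩
  rw [sandwichAdjoint_apply, id_comp, P.adjoint_ket1_comp_assocSymm_comp_ket1 p s ⟨r, hr⟩ y hX]
  exact mem_cspan ⟨_, _, rfl⟩

/-- The slices `⟨q|₁ V* (c ⊗ Id) V |p⟩₁` of the generators `c` of `C_V` span the adjoint of
`A_V`. -/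
theorem legElt_adjoint_mem_cspan (y : P.α.space) (z : P.βhat.space) : (P.legElt y z)† ∈
    cspan {T | ∃ q p : P.βhat.space, ∃ x y, (P.sket1 q)† ∘L (P.op† ∘L tensorId P.α P.α P.β
      (P.cElt x y) ∘L P.op) ∘L P.sket1 p = T} := by
  set N := cspan {T | ∃ q p : P.βhat.space, ∃ x y, (P.sket1 q)† ∘L (P.op† ∘L tensorId P.α P.α P.β
      (P.cElt x y) ∘L P.op) ∘L P.sket1 p = T} with hN
  have h1 : ∀ (p : P.βhat.space) (X : P.srcβhat.space), (ket1 (b := b.op) P.srcβhat P.α X)† ∘L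
      assocSymm (b := b.op) (d := b.op) P.βhat P.α P.βhat P.α P.α_βhat P.βhat_α ∘L
        ket1 (b := b.op) P.βhat P.srcα p ∘L P.op† ∘L P.tket1 y ∈ N := by
    intro p X
    refine ket1_mem_of_cspan (b := b.op) P.srcβhat P.α
      (sandwichAdjoint (ContinuousLinearMap.id ℂ H)
      (assocSymm (b := b.op) (d := b.op) P.βhat P.α P.βhat P.α P.α_βhat P.βhat_α ∘L
        ket1 (b := b.op) P.βhat P.srcα p ∘L P.op† ∘L P.tket1 y))
      (isClosed_cspan _)
      ((P.intertwines.2.2.1.adjoint P.adjoint_op_comp_op).cspan_eq rfl) ?_ X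
    rintro X ⟨_, ⟨x, q, hq, rfl⟩, hX⟩
    have e : X = ⟨(P.op† ∘L P.tket1 x) ∘L q,
      (P.isMorphism_adjoint_op_comp_tket1 x).2.1 q hq⟩ := Subtype.ext hX.symm
    rw [sandwichAdjoint_apply, id_comp, e, ← P.sket1_slice_cElt ⟨q, hq⟩ p x y]
    exact mem_cspan ⟨⟨q, hq⟩, p, x, y, rfl⟩
  rw [legElt_adjoint]
  refine ket1_mem_of_cspan (b := b.op) P.βhat P.α
    (sandwichAdjoint (ContinuousLinearMap.id ℂ H) (P.op† ∘L P.tket1 y))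
    (isClosed_cspan _) (BaseModule.Preserves.cspan_inner_eq P.α_βhat P.βhat) ?_ z
  rintro z ⟨p, s, r, hr, hz⟩
  have h2 := h1 p ⟨P.sket1 s ∘L r, (P.isMorphism_sket1 s).2.1 r hr⟩
  rw [P.adjoint_ket1_comp_assocSymm_comp_ket1 p s ⟨r, hr⟩ y rfl, legElt_adjoint] at h2
  have e : z = ⟨_, P.α_βhat.mem (P.βhat.inner_mem p.2 s.2) hr⟩ := Subtype.ext hz.symm
  rw [sandwichAdjoint_apply, id_comp, e]
  exact h2

end PseudoMultUnitary

end PMU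

section PMU

variable {𝔎 : Type u} [NormedAddCommGroup 𝔎] [InnerProductSpace ℂ 𝔎] [CompleteSpace 𝔎]
  {b : CStarBase 𝔎}
  {H : Type v} [NormedAddCommGroup H] [InnerProductSpace ℂ H] [CompleteSpace H]

namespace PseudoMultUnitary

variable {P : PseudoMultUnitary b H}

/-! ### The `C*`-algebras `C_V`, `Â_V` and `A_V` of a semi-regular unitary -/

theorem SemiRegular.comp_adjoint_mem (hP : P.SemiRegular) (ξ ξ' : P.α.space) :
    (ξ : 𝔎 →L[ℂ] H) ∘L (ξ' : 𝔎 →L[ℂ] H)† ∈ P.cSpace :=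
  hP (mem_cspan ⟨ξ, ξ.2, ξ', ξ'.2, rfl⟩)

theorem SemiRegular.cSpace_comp_adjoint_mem (hP : P.SemiRegular) {S T : H →L[ℂ] H}
    (hS : S ∈ P.cSpace) (hT : T ∈ P.cSpace) : S ∘L T† ∈ P.cSpace := by
  refine comp_adjoint_mem_of_mem_cspan (isClosed_cspan _) ?_ hS hT
  rintro _ ⟨a, x, rfl⟩ _ ⟨a', x', rfl⟩
  have h := P.adjoint_tket1_comp_comp_tket1_mem_cSpace a a' (hP.comp_adjoint_mem x x')
  rw [(idTensor_comp_adjoint (b := b.op) P.βhat P.α P.α x x').2] at h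
  have e := P.cElt_adjoint a' x'
  rw [cElt] at e
  rw [e]
  exact h

theorem SemiRegular.cSpace_adjoint_comp_mem (hP : P.SemiRegular) {S T : H →L[ℂ] H}
    (hS : S ∈ P.cSpace) (hT : T ∈ P.cSpace) : S† ∘L T ∈ P.cSpace := by
  refine adjoint_comp_mem_of_mem_cspan (isClosed_cspan _) ?_ hS hT
  rintro _ ⟨a, x, rfl⟩ _ ⟨a', x', rfl⟩
  have h := P.adjoint_sket2_comp_comp_sket2_mem_cSpace x x' (hP.comp_adjoint_mem a a')
  rw [(tensorId_comp_adjoint P.α P.α P.β a a').2] at h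
  have e := P.cElt_adjoint a x
  rw [cElt] at e
  rw [e]
  exact h

theorem SemiRegular.adjoint_mem_cSpace (hP : P.SemiRegular) {T : H →L[ℂ] H}
    (hT : T ∈ P.cSpace) : T† ∈ P.cSpace :=
  star_mem_of_mul_star_mem (isClosed_cspan _) (fun _ h _ h' => hP.cSpace_comp_adjoint_mem h h')
    (fun _ h _ h' => hP.cSpace_adjoint_comp_mem h h') hT

/-- A slice of `V (Id ⊗ c) V*` is the adjoint of a slice of `V (Id ⊗ c*) V*`. Hence slices of
operators in `C_V` lie in `Â_V` as well as in its adjoint. -/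
theorem SemiRegular.tket2_slice_mem_legHat (hP : P.SemiRegular) (q p : P.β.space)
    {k : H →L[ℂ] H} (hk : k ∈ P.cSpace) (hk' : IsIntertwiner P.α P.α k) :
    (P.tket2 q)† ∘L (P.op ∘L idTensor (b := b.op) P.βhat P.α P.α k ∘L P.op†) ∘L P.tket2 p ∈
      P.legHat := by
  have h := P.tket2_slice_mem p q (hP.adjoint_mem_cSpace hk)
  rw [← idTensor_adjoint (b := b.op) P.βhat hk'] at h
  have h2 := adjoint_mem_of_mem_cspan (N := P.legHat) (isClosed_cspan _)
    (by rintro _ ⟨η, x, rfl⟩; rw [adjoint_adjoint]; exact P.hatElt_mem η x) h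
  simpa only [adjoint_comp, adjoint_adjoint, comp_assoc_nondefeq] using h2

theorem SemiRegular.adjoint_mem_legHat (hP : P.SemiRegular) {T : H →L[ℂ] H}
    (hT : T ∈ P.legHat) : T† ∈ P.legHat := by
  refine adjoint_mem_of_mem_cspan (isClosed_cspan _) ?_ hT
  rintro _ ⟨η, x, rfl⟩
  refine cspan_le (isClosed_cspan _) ?_ (P.hatElt_adjoint_mem_cspan η x)
  rintro _ ⟨q, p, x, y, rfl⟩
  exact hP.tket2_slice_mem_legHat q p (P.cElt_mem x y) (P.isMorphism_cElt x y).1.isIntertwiner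

/-- For `c = x x'*` with `x, x' ∈ α`, the slices of `V (Id ⊗ c) V*` are the products of the
generators of `Â_V` with adjoints of generators. -/
theorem SemiRegular.comp_mem_legHat (hP : P.SemiRegular) {S T : H →L[ℂ] H}
    (hS : S ∈ P.legHat) (hT : T ∈ P.legHat) : S ∘L T ∈ P.legHat := by
  rw [← adjoint_adjoint T]
  refine comp_adjoint_mem_of_mem_cspan (isClosed_cspan _) ?_ hS (hP.adjoint_mem_legHat hT)
  rintro _ ⟨η, x, rfl⟩ _ ⟨η', x', rfl⟩
  have hi := idTensor_comp_adjoint (b := b.op) P.βhat P.α P.α x x'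
  have h := hP.tket2_slice_mem_legHat η η' (hP.comp_adjoint_mem x x') hi.1
  rw [hi.2] at h
  have e := P.hatElt_adjoint η' x'
  rw [hatElt] at e
  rw [e]
  exact h

/-- A slice of `V* (c ⊗ Id) V` is the adjoint of a slice of `V* (c* ⊗ Id) V`. Hence slices of
operators in `C_V` lie in `A_V` as well as in its adjoint. -/
theorem SemiRegular.sket1_slice_mem_leg (hP : P.SemiRegular) (q p : P.βhat.space)
    {k : H →L[ℂ] H} (hk : k ∈ P.cSpace) (hk' : IsIntertwiner P.α P.α k) :
    (P.sket1 q)† ∘L (P.op† ∘L tensorId P.α P.α P.β k ∘L P.op) ∘L P.sket1 p ∈ P.leg := by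
  have h := P.sket1_slice_mem p q (hP.adjoint_mem_cSpace hk)
  rw [← tensorId_adjoint P.β hk'] at h
  have h2 := adjoint_mem_of_mem_cspan (N := P.leg) (isClosed_cspan _)
    (by rintro _ ⟨a, z, rfl⟩; rw [adjoint_adjoint]; exact P.legElt_mem a z) h
  simpa only [adjoint_comp, adjoint_adjoint, comp_assoc_nondefeq] using h2

theorem SemiRegular.adjoint_mem_leg (hP : P.SemiRegular) {T : H →L[ℂ] H}
    (hT : T ∈ P.leg) : T† ∈ P.leg := by
  refine adjoint_mem_of_mem_cspan (isClosed_cspan _) ?_ hT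
  rintro _ ⟨a, z, rfl⟩
  refine cspan_le (isClosed_cspan _) ?_ (P.legElt_adjoint_mem_cspan a z)
  rintro _ ⟨q, p, x, y, rfl⟩
  exact hP.sket1_slice_mem_leg q p (P.cElt_mem x y) (P.isMorphism_cElt x y).1.isIntertwiner

/-- For `c = a a'*` with `a, a' ∈ α`, the slices of `V* (c ⊗ Id) V` are the products of adjoints of
generators of `A_V` with generators. -/
theorem SemiRegular.comp_mem_leg (hP : P.SemiRegular) {S T : H →L[ℂ] H}
    (hS : S ∈ P.leg) (hT : T ∈ P.leg) : S ∘L T ∈ P.leg := by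
  rw [← adjoint_adjoint S]
  refine adjoint_comp_mem_of_mem_cspan (isClosed_cspan _) ?_ (hP.adjoint_mem_leg hS) hT
  rintro _ ⟨a, z, rfl⟩ _ ⟨a', z', rfl⟩
  have hi := tensorId_comp_adjoint P.α P.α P.β a a'
  have h := hP.sket1_slice_mem_leg z z' (hP.comp_adjoint_mem a a') hi.1
  rw [hi.2] at h
  have e := P.legElt_adjoint a z
  rw [legElt] at e
  rw [e]
  exact h

/-- The `C*`-algebra `Â_V` of a semi-regular unitary. -/
def SemiRegular.hatAlg (hP : P.SemiRegular) : NonUnitalStarSubalgebra ℂ (H →L[ℂ] H) where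
  __ := P.legHat
  mul_mem' h h' := hP.comp_mem_legHat h h'
  star_mem' h := hP.adjoint_mem_legHat h

/-- The `C*`-algebra `A_V` of a semi-regular unitary. -/
def SemiRegular.legAlg (hP : P.SemiRegular) : NonUnitalStarSubalgebra ℂ (H →L[ℂ] H) where
  __ := P.leg
  mul_mem' h h' := hP.comp_mem_leg h h'
  star_mem' h := hP.adjoint_mem_leg h

/-! ### Compatibility with the representations `ρ` -/

theorem rho_βhat_comp_hatElt {c : 𝔎 →L[ℂ] 𝔎} (hc : c ∈ b.alg) (η : P.β.space) (x : P.α.space) :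
    P.βhat.rho c ∘L P.hatElt η x =
      P.hatElt η ⟨P.β.rho c ∘L x, P.β_α.mem hc x.2⟩ := by
  have e1 := (P.isMorphism_tket2 η).1.adjoint.1.isIntertwiner c hc
  have e2 := P.isMorphism_op_mix.1.isIntertwiner c hc
  have e3 := rho_rtri_comp_ket2 (b := b.op) P.βhat P.α P.β P.α_β P.β_α hc x
  rw [hatElt, hatElt, ← comp_assoc, ← e1, comp_assoc, ← comp_assoc _ P.op, ← e2, comp_assoc, e3]

theorem hatElt_comp_rho_α {c : 𝔎 →L[ℂ] 𝔎} (hc : c ∈ b.dual) (η : P.β.space) (x : P.α.space) :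
    P.hatElt η x ∘L P.α.rho c =
      P.hatElt ⟨P.α.rho (c†) ∘L η, P.α_β.mem (adjoint_mem_dual hc) η.2⟩ x := by
  have e1 := (P.isMorphism_op_comp_sket2 x).1.1.isIntertwiner c hc
  have e3 := adjoint_ket2_comp_rho_rtri P.α P.β P.α P.β_α P.α_β hc η
  rw [hatElt, hatElt, comp_assoc, e1, ← comp_assoc, e3]

theorem rho_α_comp_legElt {c : 𝔎 →L[ℂ] 𝔎} (hc : c ∈ b.dual) (a : P.α.space) (z : P.βhat.space) :
    P.α.rho c ∘L P.legElt a z =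
      P.legElt a ⟨P.α.rho c ∘L z, P.α_βhat.mem hc z.2⟩ := by
  have e1 := (P.isMorphism_tket1 a).1.adjoint.1.isIntertwiner c hc
  have e2 := P.isMorphism_op_α.1.isIntertwiner c hc
  have e3 := rho_ltri_comp_ket1 (b := b.op) P.α P.βhat P.α P.βhat_α P.α_βhat hc z
  rw [legElt, legElt, ← comp_assoc, ← e1, comp_assoc, ← comp_assoc _ P.op, ← e2, comp_assoc, e3]

theorem legElt_comp_rho_β {c : 𝔎 →L[ℂ] 𝔎} (hc : c ∈ b.alg) (a : P.α.space) (z : P.βhat.space) :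
    P.legElt a z ∘L P.β.rho c =
      P.legElt ⟨P.βhat.rho (c†) ∘L a, P.βhat_α.mem (adjoint_mem_alg hc) a.2⟩ z := by
  have e1 := (P.isMorphism_op_mix.comp (P.isMorphism_sket1 z).1).1.isIntertwiner c hc
  have e3 := adjoint_ket1_comp_rho_ltri P.βhat P.α P.β P.α_βhat P.βhat_α hc a
  rw [legElt, legElt, comp_assoc, e1, ← comp_assoc, e3]

theorem rho_βhat_comp_mem_legHat {c : 𝔎 →L[ℂ] 𝔎} (hc : c ∈ b.alg) {T : H →L[ℂ] H}
    (hT : T ∈ P.legHat) : P.βhat.rho c ∘L T ∈ P.legHat := by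
  refine map_mem_of_mem_cspan (compL ℂ H H H (P.βhat.rho c)) (isClosed_cspan _) ?_ hT
  rintro _ ⟨η, x, rfl⟩
  show P.βhat.rho c ∘L P.hatElt η x ∈ P.legHat
  rw [rho_βhat_comp_hatElt hc]
  exact P.hatElt_mem _ _

theorem comp_rho_α_mem_legHat {c : 𝔎 →L[ℂ] 𝔎} (hc : c ∈ b.dual) {T : H →L[ℂ] H}
    (hT : T ∈ P.legHat) : T ∘L P.α.rho c ∈ P.legHat := by
  refine map_mem_of_mem_cspan ((compL ℂ H H H).flip (P.α.rho c)) (isClosed_cspan _) ?_ hT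
  rintro _ ⟨η, x, rfl⟩
  show P.hatElt η x ∘L P.α.rho c ∈ P.legHat
  rw [hatElt_comp_rho_α hc]
  exact P.hatElt_mem _ _

theorem rho_α_comp_mem_leg {c : 𝔎 →L[ℂ] 𝔎} (hc : c ∈ b.dual) {T : H →L[ℂ] H}
    (hT : T ∈ P.leg) : P.α.rho c ∘L T ∈ P.leg := by
  refine map_mem_of_mem_cspan (compL ℂ H H H (P.α.rho c)) (isClosed_cspan _) ?_ hT
  rintro _ ⟨a, z, rfl⟩
  show P.α.rho c ∘L P.legElt a z ∈ P.leg
  rw [rho_α_comp_legElt hc]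
  exact P.legElt_mem _ _

theorem comp_rho_β_mem_leg {c : 𝔎 →L[ℂ] 𝔎} (hc : c ∈ b.alg) {T : H →L[ℂ] H}
    (hT : T ∈ P.leg) : T ∘L P.β.rho c ∈ P.leg := by
  refine map_mem_of_mem_cspan ((compL ℂ H H H).flip (P.β.rho c)) (isClosed_cspan _) ?_ hT
  rintro _ ⟨a, z, rfl⟩
  show P.legElt a z ∘L P.β.rho c ∈ P.leg
  rw [legElt_comp_rho_β hc]
  exact P.legElt_mem _ _

theorem SemiRegular.rho_α_comp_mem_legHat (hP : P.SemiRegular) {c : 𝔎 →L[ℂ] 𝔎}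
    (hc : c ∈ b.dual) {T : H →L[ℂ] H} (hT : T ∈ P.legHat) : P.α.rho c ∘L T ∈ P.legHat := by
  have h := hP.adjoint_mem_legHat
    (P.comp_rho_α_mem_legHat (adjoint_mem_dual hc) (hP.adjoint_mem_legHat hT))
  rwa [adjoint_comp, adjoint_adjoint, P.α.rho_adjoint (adjoint_mem_dual hc), adjoint_adjoint] at h

theorem SemiRegular.rho_β_comp_mem_leg (hP : P.SemiRegular) {c : 𝔎 →L[ℂ] 𝔎}
    (hc : c ∈ b.alg) {T : H →L[ℂ] H} (hT : T ∈ P.leg) : P.β.rho c ∘L T ∈ P.leg := by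
  have h := hP.adjoint_mem_leg
    (P.comp_rho_β_mem_leg (adjoint_mem_alg hc) (hP.adjoint_mem_leg hT))
  rwa [adjoint_comp, adjoint_adjoint, P.β.rho_adjoint (adjoint_mem_alg hc), adjoint_adjoint] at h

theorem legHat_le_intertwinerSpace : P.legHat ≤ intertwinerSpace P.β P.β := by
  refine cspan_le (isClosed_intertwinerSpace _ _) ?_
  rintro _ ⟨η, x, rfl⟩
  exact (P.isMorphism_hatElt η x).1.isIntertwiner

theorem leg_le_intertwinerSpace : P.leg ≤ intertwinerSpace P.βhat P.βhat := by
  refine cspan_le (isClosed_intertwinerSpace _ _) ?_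
  rintro _ ⟨a, z, rfl⟩
  exact (P.isMorphism_legElt a z).1.isIntertwiner

end PseudoMultUnitary

end PMU

/-! ### The comultiplications as `*`-homomorphisms -/

section hom

variable {𝔎 : Type u} [NormedAddCommGroup 𝔎] [InnerProductSpace ℂ 𝔎] [CompleteSpace 𝔎]
  {b : CStarBase 𝔎}
  {H : Type v} [NormedAddCommGroup H] [InnerProductSpace ℂ H] [CompleteSpace H]
  {K : Type w} [NormedAddCommGroup K] [InnerProductSpace ℂ K] [CompleteSpace K]
  {L : Type x} [NormedAddCommGroup L] [InnerProductSpace ℂ L] [CompleteSpace L]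

/-- The `*`-homomorphism `a ↦ U* (Id ⊗ a) U` for a coisometry `U`, on an algebra of operators that
commute with `ρ_γ`. -/
def idTensorHom (β : BaseModule b H) (γ : BaseModule b.op K)
    (A : NonUnitalStarSubalgebra ℂ (K →L[ℂ] K)) (hA : ∀ a ∈ A, IsIntertwiner γ γ a)
    (U : L →L[ℂ] RTP β γ) (hU : U ∘L U† = ContinuousLinearMap.id ℂ _) :
    A →⋆ₙₐ[ℂ] (L →L[ℂ] L) where
  toFun a := U† ∘L idTensor β γ γ a ∘L U
  map_smul' r a := by
    rw [NonUnitalStarSubalgebra.coe_smul, idTensor_smul β r (hA a a.2)]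
    simp only [smul_comp, comp_smul, MonoidHom.id_apply]
  map_zero' := by
    have h : idTensor β γ γ (0 : K →L[ℂ] K) = 0 :=
      idTensor_unique (fun c _ => by rw [zero_comp, comp_zero]) fun ξ => by
        rw [zero_comp, comp_zero]
    rw [ZeroMemClass.coe_zero, h, zero_comp, comp_zero]
  map_add' a a' := by
    rw [AddMemClass.coe_add, idTensor_add β (hA a a.2) (hA a' a'.2), add_comp, comp_add]
  map_mul' a a' := by
    have e := idTensor_comp_idTensor β (hA a a.2) (hA a' a'.2)
    show U† ∘L idTensor β γ γ ((a : K →L[ℂ] K) ∘L (a' : K →L[ℂ] K)) ∘L U =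
      (U† ∘L idTensor β γ γ a ∘L U) ∘L (U† ∘L idTensor β γ γ a' ∘L U)
    rw [← e]
    simp only [comp_assoc_nondefeq]
    rw [← comp_assoc U, hU, id_comp]
  map_star' a := by
    show U† ∘L idTensor β γ γ ((a : K →L[ℂ] K)†) ∘L U = (U† ∘L idTensor β γ γ a ∘L U)†
    rw [← idTensor_adjoint β (hA a a.2)]
    simp only [adjoint_comp, adjoint_adjoint, comp_assoc_nondefeq]

/-- The `*`-homomorphism `a ↦ U (a ⊗ Id) U*` for an isometry `U`, on an algebra of operators that
commute with `ρ_β`. -/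
def tensorIdHom (β : BaseModule b H) (γ : BaseModule b.op K)
    (A : NonUnitalStarSubalgebra ℂ (H →L[ℂ] H)) (hA : ∀ a ∈ A, IsIntertwiner β β a)
    (U : RTP β γ →L[ℂ] L) (hU : U† ∘L U = ContinuousLinearMap.id ℂ _) :
    A →⋆ₙₐ[ℂ] (L →L[ℂ] L) where
  toFun a := U ∘L tensorId β β γ a ∘L U†
  map_smul' r a := by
    rw [NonUnitalStarSubalgebra.coe_smul, tensorId_smul γ r (hA a a.2)]
    simp only [smul_comp, comp_smul, MonoidHom.id_apply]
  map_zero' := by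
    have h : tensorId β β γ (0 : H →L[ℂ] H) = 0 :=
      tensorId_unique (fun c _ => by rw [zero_comp, comp_zero]) fun ξ => by
        rw [zero_comp, comp_zero]
    rw [ZeroMemClass.coe_zero, h, zero_comp, comp_zero]
  map_add' a a' := by
    rw [AddMemClass.coe_add, tensorId_add γ (hA a a.2) (hA a' a'.2), add_comp, comp_add]
  map_mul' a a' := by
    have e := tensorId_comp_tensorId γ (hA a a.2) (hA a' a'.2)
    show U ∘L tensorId β β γ ((a : H →L[ℂ] H) ∘L (a' : H →L[ℂ] H)) ∘L U† =
      (U ∘L tensorId β β γ a ∘L U†) ∘L (U ∘L tensorId β β γ a' ∘L U†)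
    rw [← e]
    simp only [comp_assoc_nondefeq]
    rw [← comp_assoc (U†), hU, id_comp]
  map_star' a := by
    show U ∘L tensorId β β γ ((a : H →L[ℂ] H)†) ∘L U† = (U ∘L tensorId β β γ a ∘L U†)†
    rw [← tensorId_adjoint γ (hA a a.2)]
    simp only [adjoint_comp, adjoint_adjoint, comp_assoc_nondefeq]

end hom

section PMU

variable {𝔎 : Type u} [NormedAddCommGroup 𝔎] [InnerProductSpace ℂ 𝔎] [CompleteSpace 𝔎]
  {b : CStarBase 𝔎}
  {H : Type v} [NormedAddCommGroup H] [InnerProductSpace ℂ H] [CompleteSpace H]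

namespace PseudoMultUnitary

variable (P : PseudoMultUnitary b H)

/-! ### The comultiplications take values in the fiber products -/

/-- The conjugate `V* (Id ⊗ a) V` of a generator `a` of `Â_V`. -/
theorem adjoint_op_comp_idTensor_hatElt (η : P.β.space) (y : P.α.space) :
    P.op† ∘L idTensor P.α P.β P.β (P.hatElt η y) ∘L P.op =
      (ket2 P.srcα P.β η)† ∘L P.V13 ∘L
        idTensor (b := b.op) P.βhat P.α P.tgtα (P.op ∘L P.sket2 y) := by
  have hη := (P.isMorphism_tket2 η).2.1.isIntertwiner
  have h1 : idTensor P.α P.β P.β (P.hatElt η y) =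
      (idTensor P.α P.β P.tgtβ (P.tket2 η))† ∘L
        idTensor P.α P.β P.tgtβ (P.op ∘L P.sket2 y) := by
    rw [idTensor_adjoint P.α hη, idTensor_comp_idTensor P.α hη.adjoint
      (P.isMorphism_op_comp_sket2 y).2.1.isIntertwiner]
    rfl
  have h2 : P.V12 ∘L ket2 P.srcα P.β η = idTensor P.α P.β P.tgtβ (P.tket2 η) ∘L P.op := by
    rw [V12, comp_assoc, P.isMorphism_op_α.1.isIntertwiner.tensorId_comp_ket2, ← comp_assoc,
      assoc_comp_ket2]
  have h3 : P.op† ∘L (idTensor P.α P.β P.tgtβ (P.tket2 η))† ∘L P.V12 = (ket2 P.srcα P.β η)† := by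
    rw [← comp_assoc, ← adjoint_comp, ← h2, adjoint_comp, comp_assoc, P.adjoint_V12_comp_V12,
      comp_id]
  rw [h1, comp_assoc, P.idTensor_comp_op, ← h3]
  simp only [comp_assoc_nondefeq]

/-- Since `V |y⟩₂ ξ` lies in `α ▷ α = [|α⟩₁ α]`, the operator `V* (Id ⊗ ⟨η|₂ V |y⟩₂) V |ξ⟩₂` is a
limit of sums of operators `|x⟩₂ ⟨η|₂ V |y'⟩₂`. -/
theorem hatElt_slice_sket2_mem (η : P.β.space) (y ξ : P.α.space) :
    (P.op† ∘L idTensor P.α P.β P.β (P.hatElt η y) ∘L P.op) ∘L P.sket2 ξ ∈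
      cspan {T | ∃ ξ' : P.α.space, ∃ a ∈ P.legHat, P.sket2 ξ' ∘L a = T} := by
  set N := cspan {T | ∃ ξ' : P.α.space, ∃ a ∈ P.legHat, P.sket2 ξ' ∘L a = T}
  have key : ∀ X : P.tgtα.space, (ket2 P.srcα P.β η)† ∘L P.V13 ∘L
      ket2 (b := b.op) P.βhat P.tgtα X ∈ N := by
    intro X
    refine ket2_mem_of_cspan (b := b.op) P.βhat P.tgtα (sandwich ((ket2 P.srcα P.β η)† ∘L P.V13)
      (ContinuousLinearMap.id ℂ H)) (isClosed_cspan _) rfl ?_ X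
    rintro X ⟨x, y', hy', hX⟩
    have e1 := IsSemiMorphism.idTensor_comp_ket2 (b := b.op) P.βhat (P.isMorphism_tket1 x).1.1
      ⟨y', hy'⟩
    have e : X = ⟨P.tket1 x ∘L y', (P.isMorphism_tket1 x).1.1 y' hy'⟩ := Subtype.ext hX.symm
    have e2 := congrArg ContinuousLinearMap.adjoint
      (adjoint_tensorId_comp_ket2 P.α P.srcα P.β (P.isMorphism_sket2 x).1.1 η)
    rw [adjoint_comp, adjoint_comp, adjoint_adjoint, adjoint_adjoint] at e2
    rw [sandwich_apply, comp_id, e, ← e1, comp_assoc, ← comp_assoc P.V13, P.V13_comp_idTensor,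
      comp_assoc, ← comp_assoc _ (tensorId _ _ _ _), e2, comp_assoc]
    exact mem_cspan ⟨x, _, P.hatElt_mem η ⟨y', hy'⟩, rfl⟩
  have e := IsSemiMorphism.idTensor_comp_ket2 (b := b.op) P.βhat
    (P.isMorphism_op_comp_sket2 y).1.1 ξ
  rw [P.adjoint_op_comp_idTensor_hatElt, comp_assoc, comp_assoc, e]
  exact key _

/-- Since `V* |η⟩₂ ζ` lies in `β̂ ▷ β = [|β̂⟩₁ β]`, the operator
`V* (Id ⊗ (⟨η|₂ V |y⟩₂)*) V |ζ⟩₁` is a limit of sums of operators `|p⟩₁ (⟨η'|₂ V |y⟩₂)*`. -/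
theorem hatElt_adjoint_slice_sket1_mem (η : P.β.space) (y : P.α.space) (ζ : P.βhat.space) :
    (P.op† ∘L idTensor P.α P.β P.β ((P.hatElt η y)†) ∘L P.op) ∘L P.sket1 ζ ∈
      cspan {T | ∃ ζ' : P.βhat.space, ∃ η' y', P.sket1 ζ' ∘L (P.hatElt η' y')† = T} := by
  set N := cspan {T | ∃ ζ' : P.βhat.space, ∃ η' y', P.sket1 ζ' ∘L (P.hatElt η' y')† = T}
  have hR := (P.isMorphism_op_comp_sket2 y).1
  have h1 : P.op† ∘L idTensor P.α P.β P.β ((P.hatElt η y)†) ∘L P.op =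
      (idTensor (b := b.op) P.βhat P.α P.tgtα (P.op ∘L P.sket2 y))† ∘L P.V13† ∘L
        ket2 P.srcα P.β η := by
    have h := congrArg ContinuousLinearMap.adjoint (P.adjoint_op_comp_idTensor_hatElt η y)
    simp only [adjoint_comp (P.op†), adjoint_comp _ P.op, adjoint_comp _ (idTensor _ _ _ _),
      adjoint_comp _ (P.V13 ∘L _), adjoint_adjoint,
      idTensor_adjoint P.α (P.isMorphism_hatElt η y).1.isIntertwiner] at h
    rw [← comp_assoc, h, comp_assoc]
  have key : ∀ X : P.tgtMix.space, (idTensor (b := b.op) P.βhat P.α P.tgtα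
      (P.op ∘L P.sket2 y))† ∘L P.V13† ∘L
      sigma23 (d := b.op) P.α P.β P.βhat P.α P.α_βhat P.βhat_α ∘L
        ket1 (b := b.op) P.tgtMix P.α X ∈ N := by
    intro X
    refine ket1_mem_of_cspan (b := b.op) P.tgtMix P.α (sandwich ((idTensor (b := b.op) P.βhat P.α
      P.tgtα (P.op ∘L P.sket2 y))† ∘L P.V13† ∘L
        sigma23 (d := b.op) P.α P.β P.βhat P.α P.α_βhat P.βhat_α)
      (ContinuousLinearMap.id ℂ H)) (isClosed_cspan _) (P.intertwines.2.1.cspan_eq rfl) ?_ X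
    rintro X ⟨_, ⟨p, η', hη', rfl⟩, hX⟩
    have e1 := P.V13_comp_ket1_comp_ket2 p ⟨η', hη'⟩ hX
    have e2 := adjoint_idTensor_comp_ket1 (b := b.op) P.βhat P.α P.tgtα hR.1 p
    rw [sandwich_apply, comp_id, comp_assoc, comp_assoc, ← e1, ← comp_assoc _ P.V13,
      P.adjoint_V13_comp_V13, id_comp, ← comp_assoc, e2, comp_assoc]
    refine mem_cspan ⟨p, ⟨η', hη'⟩, y, ?_⟩
    rw [hatElt_adjoint, adjoint_comp, comp_assoc]
  have e := sigma23_comp_ket1 (d := b.op) P.α P.β P.βhat P.α P.α_βhat P.βhat_α η ζ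
    (X := ⟨P.tket2 η ∘L ζ, (P.isMorphism_tket2 η).1.1 ζ ζ.2⟩) rfl
  rw [h1, comp_assoc, comp_assoc, ← e]
  exact key _

/-- The conjugate `V (a ⊗ Id) V*` of a generator `a` of `A_V`. -/
theorem op_comp_tensorId_legElt (x : P.α.space) (p : P.βhat.space) :
    P.op ∘L tensorId (b := b.op) P.βhat P.βhat P.α (P.legElt x p) ∘L P.op† =
      (ket1 P.α P.tgtβ x)† ∘L P.V12 ∘L P.V13 ∘L ket1 (b := b.op) P.βhat P.tgtα p := by
  have hx := (P.isMorphism_tket1 x).2.1.isIntertwiner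
  have hp := (P.isMorphism_sket1 p).2.1.isIntertwiner
  have hV := P.isMorphism_op_βhat.1.isIntertwiner
  have h1 : tensorId (b := b.op) P.βhat P.βhat P.α (P.legElt x p) =
      (tensorId (b := b.op) P.βhat P.tgtβhat P.α (P.tket1 x))† ∘L
        tensorId (b := b.op) P.srcβhat P.tgtβhat P.α P.op ∘L
          tensorId (b := b.op) P.βhat P.srcβhat P.α (P.sket1 p) := by
    rw [tensorId_adjoint (b := b.op) P.α hx, tensorId_comp_tensorId (b := b.op) P.α hV hp,
      tensorId_comp_tensorId (b := b.op) P.α hx.adjoint (hV.comp hp)]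
    rfl
  have h2 : P.op ∘L (tensorId (b := b.op) P.βhat P.tgtβhat P.α (P.tket1 x))† =
      (ket1 P.α P.tgtβ x)† ∘L idTensor P.α P.srcβ P.tgtβ P.op ∘L
        assoc (d := b.op) P.α P.β P.βhat P.α P.β_βhat P.βhat_β := by
    have hi := P.isMorphism_op_β.1
    have e := congrArg ContinuousLinearMap.adjoint
      (adjoint_idTensor_comp_ket1 P.α P.srcβ P.tgtβ hi x)
    rw [adjoint_comp, adjoint_comp, adjoint_adjoint, adjoint_adjoint] at e
    rw [← comp_assoc, e, comp_assoc, ← assocSymm_comp_ket1, adjoint_comp, ← assoc_adjoint,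
      adjoint_adjoint]
  have h3 : (idTensor (b := b.op) P.βhat P.srcα P.tgtα P.op ∘L
      assoc (b := b.op) (d := b.op) P.βhat P.α P.βhat P.α P.α_βhat P.βhat_α) ∘L
        tensorId (b := b.op) P.βhat P.srcβhat P.α (P.sket1 p) =
      ket1 (b := b.op) P.βhat P.tgtα p ∘L P.op := by
    have e1 := assoc_comp_tensorId (b := b.op) (d := b.op) P.βhat P.α P.βhat P.α P.α_βhat
      P.βhat_α p
    have e2 := IsIntertwiner.idTensor_comp_ket1 (b := b.op) P.βhat
      P.isMorphism_op_α.1.isIntertwiner p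
    rw [comp_assoc, e1, e2]
  calc P.op ∘L tensorId (b := b.op) P.βhat P.βhat P.α (P.legElt x p) ∘L P.op†
      = (ket1 P.α P.tgtβ x)† ∘L (idTensor P.α P.srcβ P.tgtβ P.op ∘L
          assoc (d := b.op) P.α P.β P.βhat P.α P.β_βhat P.βhat_β ∘L
          tensorId (b := b.op) P.srcβhat P.tgtβhat P.α P.op) ∘L
          tensorId (b := b.op) P.βhat P.srcβhat P.α (P.sket1 p) ∘L P.op† := by
        rw [h1, comp_assoc, ← comp_assoc P.op, h2]
        simp only [comp_assoc_nondefeq]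
    _ = (ket1 P.α P.tgtβ x)† ∘L P.V12 ∘L P.V13 ∘L
          ((idTensor (b := b.op) P.βhat P.srcα P.tgtα P.op ∘L
          assoc (b := b.op) (d := b.op) P.βhat P.α P.βhat P.α P.α_βhat P.βhat_α) ∘L
          tensorId (b := b.op) P.βhat P.srcβhat P.α (P.sket1 p)) ∘L P.op† := by
        rw [P.pentagon_eq]
        simp only [comp_assoc_nondefeq]
    _ = _ := by rw [h3, comp_assoc, P.op_comp_adjoint_op, comp_id]

/-- Since `V |p⟩₁ η` lies in `β̂ ◁ β = [|β⟩₂ β̂]`, the operator `V (⟨x|₁ V |p⟩₁ ⊗ Id) V* |η⟩₂` is a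
limit of sums of operators `|η'⟩₂ ⟨x|₁ V |ζ⟩₁`. -/
theorem legElt_slice_tket2_mem (x : P.α.space) (p : P.βhat.space) (η : P.β.space) :
    (P.op ∘L tensorId (b := b.op) P.βhat P.βhat P.α (P.legElt x p) ∘L P.op†) ∘L P.tket2 η ∈
      cspan {T | ∃ η' : P.β.space, ∃ a ∈ P.leg, P.tket2 η' ∘L a = T} := by
  set N := cspan {T | ∃ η' : P.β.space, ∃ a ∈ P.leg, P.tket2 η' ∘L a = T}
  have key : ∀ X : P.tgtMix.space, (ket1 P.α P.tgtβ x)† ∘L P.V12 ∘L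
      sigma23 (d := b.op) P.α P.β P.βhat P.α P.α_βhat P.βhat_α ∘L
        ket1 (b := b.op) P.tgtMix P.α X ∈ N := by
    intro X
    refine ket1_mem_of_cspan (b := b.op) P.tgtMix P.α (sandwich ((ket1 P.α P.tgtβ x)† ∘L P.V12 ∘L
        sigma23 (d := b.op) P.α P.β P.βhat P.α P.α_βhat P.βhat_α)
      (ContinuousLinearMap.id ℂ H)) (isClosed_cspan _) rfl ?_ X
    rintro X ⟨η', ζ, hζ, hX⟩
    have e1 := sigma23_comp_ket1 (d := b.op) P.α P.β P.βhat P.α P.α_βhat P.βhat_α η' ⟨ζ, hζ⟩ hX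
    have e2 : P.V12 ∘L ket2 P.srcα P.β η' = idTensor P.α P.β P.tgtβ (P.tket2 η') ∘L P.op := by
      rw [V12, comp_assoc, P.isMorphism_op_α.1.isIntertwiner.tensorId_comp_ket2, ← comp_assoc,
        assoc_comp_ket2]
    have e3 := congrArg ContinuousLinearMap.adjoint
      (adjoint_idTensor_comp_ket1 P.α P.β P.tgtβ (P.isMorphism_tket2 η').2.1 x)
    rw [adjoint_comp, adjoint_comp, adjoint_adjoint, adjoint_adjoint] at e3
    rw [sandwich_apply, comp_id, comp_assoc, comp_assoc, e1, ← comp_assoc P.V12, e2, comp_assoc,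
      ← comp_assoc, e3, comp_assoc]
    exact mem_cspan ⟨η', _, P.legElt_mem x ⟨ζ, hζ⟩, rfl⟩
  have e := P.V13_comp_ket1_comp_ket2 p η
    (X := ⟨P.op ∘L P.sket1 p ∘L η, P.isMorphism_op_mix.1 _ ((P.isMorphism_sket1 p).1.1 η η.2)⟩) rfl
  rw [P.op_comp_tensorId_legElt, comp_assoc, comp_assoc, comp_assoc, e]
  exact key _

/-- Since `V* |x⟩₁ ξ` lies in `α ◁ α = [|α⟩₂ α]`, the operator
`V ((⟨x|₁ V |p⟩₁)* ⊗ Id) V* |ξ⟩₁` is a limit of sums of operators `|y⟩₁ (⟨ξ'|₁ V |p⟩₁)*`. -/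
theorem legElt_adjoint_slice_tket1_mem (x : P.α.space) (p : P.βhat.space) (ξ : P.α.space) :
    (P.op ∘L tensorId (b := b.op) P.βhat P.βhat P.α ((P.legElt x p)†) ∘L P.op†) ∘L P.tket1 ξ ∈
      cspan {T | ∃ ξ' : P.α.space, ∃ x' p', P.tket1 ξ' ∘L (P.legElt x' p')† = T} := by
  set N := cspan {T | ∃ ξ' : P.α.space, ∃ x' p', P.tket1 ξ' ∘L (P.legElt x' p')† = T}
  have h1 : P.op ∘L tensorId (b := b.op) P.βhat P.βhat P.α ((P.legElt x p)†) ∘L P.op† =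
      (ket1 (b := b.op) P.βhat P.tgtα p)† ∘L P.V13† ∘L P.V12† ∘L ket1 P.α P.tgtβ x := by
    have h := congrArg ContinuousLinearMap.adjoint (P.op_comp_tensorId_legElt x p)
    have e := tensorId_adjoint (b := b.op) P.α (P.isMorphism_legElt x p).1.isIntertwiner
    rw [adjoint_comp, adjoint_comp, adjoint_adjoint, e, adjoint_comp, adjoint_comp, adjoint_comp,
      adjoint_adjoint, comp_assoc, comp_assoc, comp_assoc] at h
    exact h
  have h2 : P.V12† ∘L ket1 P.α P.tgtβ x =
      tensorId P.α P.srcα P.β (P.op† ∘L P.tket1 x) := by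
    have hi := P.isMorphism_op_α.1.isIntertwiner
    rw [V12, adjoint_comp, comp_assoc, assoc_adjoint, assocSymm_comp_ket1,
      tensorId_adjoint P.β hi, tensorId_comp_tensorId P.β hi.adjoint
        (P.isMorphism_tket1 x).1.1.isIntertwiner]
  have key : ∀ X : P.srcα.space, (ket1 (b := b.op) P.βhat P.tgtα p)† ∘L P.V13† ∘L
      ket1 P.srcα P.β X ∈ N := by
    intro X
    refine ket1_mem_of_cspan P.srcα P.β (sandwich ((ket1 (b := b.op) P.βhat P.tgtα p)† ∘L P.V13†)
      (ContinuousLinearMap.id ℂ H)) (isClosed_cspan _) rfl ?_ X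
    rintro X ⟨y, ξ', hξ', hX⟩
    have e : X = ⟨P.sket2 y ∘L ξ', (P.isMorphism_sket2 y).1.1 ξ' hξ'⟩ := Subtype.ext hX.symm
    have e1 := (P.isMorphism_sket2 y).1.1.tensorId_comp_ket1 P.β ⟨ξ', hξ'⟩
    have e2 : P.V13† ∘L tensorId P.α P.srcα P.β (P.sket2 y) =
        idTensor (b := b.op) P.βhat P.α P.tgtα (P.tket1 y) ∘L P.op† := by
      rw [← comp_id (tensorId P.α P.srcα P.β (P.sket2 y)), ← P.op_comp_adjoint_op,
        ← comp_assoc _ P.op, ← P.V13_comp_idTensor, comp_assoc, ← comp_assoc _ P.V13,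
        P.adjoint_V13_comp_V13, id_comp]
    have e3 := congrArg ContinuousLinearMap.adjoint
      (adjoint_idTensor_comp_ket1 (b := b.op) P.βhat P.α P.tgtα (P.isMorphism_tket1 y).1.1 p)
    rw [adjoint_comp, adjoint_comp, adjoint_adjoint, adjoint_adjoint] at e3
    rw [sandwich_apply, comp_id, e, ← e1, comp_assoc, ← comp_assoc (P.V13†), e2, comp_assoc,
      ← comp_assoc, e3, comp_assoc]
    refine mem_cspan ⟨y, ⟨ξ', hξ'⟩, p, ?_⟩
    rw [legElt_adjoint]
  have e := (P.isMorphism_adjoint_op_comp_tket1 x).1.1.tensorId_comp_ket1 P.β ξ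
  rw [h1, h2, comp_assoc, comp_assoc, e]
  exact key _

variable {P}

theorem SemiRegular.comulHat_sket2_mem (hP : P.SemiRegular) {a : H →L[ℂ] H} (ha : a ∈ P.legHat)
    (ξ : P.α.space) : (P.op† ∘L idTensor P.α P.β P.β a ∘L P.op) ∘L P.sket2 ξ ∈
      cspan {T | ∃ ξ' : P.α.space, ∃ y ∈ hP.hatAlg, P.sket2 ξ' ∘L y = T} := by
  refine idTensor_mem_of_mem_cspan P.α P.β P.β ((sandwich (ContinuousLinearMap.id ℂ _)
    (P.sket2 ξ)).comp (sandwich (P.op†) P.op)) (isClosed_cspan _) ?_ ha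
  rintro _ ⟨η, y, rfl⟩
  exact ⟨(P.isMorphism_hatElt η y).1.isIntertwiner, P.hatElt_slice_sket2_mem η y ξ⟩

theorem SemiRegular.comulHat_sket1_mem (hP : P.SemiRegular) {a : H →L[ℂ] H} (ha : a ∈ P.legHat)
    (ζ : P.βhat.space) : (P.op† ∘L idTensor P.α P.β P.β a ∘L P.op) ∘L P.sket1 ζ ∈
      cspan {T | ∃ ζ' : P.βhat.space, ∃ y ∈ hP.hatAlg, P.sket1 ζ' ∘L y = T} := by
  have ha' : a ∈ cspan {T | ∃ η y, (P.hatElt η y)† = T} := by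
    rw [← adjoint_adjoint a]
    refine adjoint_mem_of_mem_cspan (isClosed_cspan _) ?_ (hP.adjoint_mem_legHat ha)
    rintro _ ⟨η, y, rfl⟩
    exact mem_cspan ⟨η, y, rfl⟩
  refine idTensor_mem_of_mem_cspan P.α P.β P.β ((sandwich (ContinuousLinearMap.id ℂ _)
    (P.sket1 ζ)).comp (sandwich (P.op†) P.op)) (isClosed_cspan _) ?_ ha'
  rintro _ ⟨η, y, rfl⟩
  refine ⟨(P.isMorphism_hatElt η y).1.isIntertwiner.adjoint,
    cspan_mono ?_ (P.hatElt_adjoint_slice_sket1_mem η y ζ)⟩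
  rintro _ ⟨ζ', η', y', rfl⟩
  exact ⟨ζ', _, hP.adjoint_mem_legHat (P.hatElt_mem η' y'), rfl⟩

theorem SemiRegular.comul_tket2_mem (hP : P.SemiRegular) {a : H →L[ℂ] H} (ha : a ∈ P.leg)
    (η : P.β.space) :
    (P.op ∘L tensorId (b := b.op) P.βhat P.βhat P.α a ∘L P.op†) ∘L P.tket2 η ∈
      cspan {T | ∃ η' : P.β.space, ∃ y ∈ hP.legAlg, P.tket2 η' ∘L y = T} := by
  refine tensorId_mem_of_mem_cspan (b := b.op) P.βhat P.βhat P.α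
    ((sandwich (ContinuousLinearMap.id ℂ _) (P.tket2 η)).comp (sandwich P.op (P.op†)))
    (isClosed_cspan _) ?_ ha
  rintro _ ⟨x, p, rfl⟩
  exact ⟨(P.isMorphism_legElt x p).1.isIntertwiner, P.legElt_slice_tket2_mem x p η⟩

theorem SemiRegular.comul_tket1_mem (hP : P.SemiRegular) {a : H →L[ℂ] H} (ha : a ∈ P.leg)
    (ξ : P.α.space) :
    (P.op ∘L tensorId (b := b.op) P.βhat P.βhat P.α a ∘L P.op†) ∘L P.tket1 ξ ∈
      cspan {T | ∃ ξ' : P.α.space, ∃ y ∈ hP.legAlg, P.tket1 ξ' ∘L y = T} := by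
  have ha' : a ∈ cspan {T | ∃ x p, (P.legElt x p)† = T} := by
    rw [← adjoint_adjoint a]
    refine adjoint_mem_of_mem_cspan (isClosed_cspan _) ?_ (hP.adjoint_mem_leg ha)
    rintro _ ⟨x, p, rfl⟩
    exact mem_cspan ⟨x, p, rfl⟩
  refine tensorId_mem_of_mem_cspan (b := b.op) P.βhat P.βhat P.α
    ((sandwich (ContinuousLinearMap.id ℂ _) (P.tket1 ξ)).comp (sandwich P.op (P.op†)))
    (isClosed_cspan _) ?_ ha'
  rintro _ ⟨x, p, rfl⟩
  refine ⟨(P.isMorphism_legElt x p).1.isIntertwiner.adjoint,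
    cspan_mono ?_ (P.legElt_adjoint_slice_tket1_mem x p ξ)⟩
  rintro _ ⟨ξ', x', p', rfl⟩
  exact ⟨ξ', _, hP.adjoint_mem_leg (P.legElt_mem x' p'), rfl⟩

/-- The restriction of `Δ̂_V` to `Â_V`. -/
def SemiRegular.comulHatHom (hP : P.SemiRegular) :
    hP.hatAlg →⋆ₙₐ[ℂ] (P.Source →L[ℂ] P.Source) :=
  idTensorHom P.α P.β hP.hatAlg (fun _ ha => P.legHat_le_intertwinerSpace ha) P.op
    P.op_comp_adjoint_op

/-- The restriction of `Δ_V` to `A_V`. -/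
def SemiRegular.comulHom (hP : P.SemiRegular) :
    hP.legAlg →⋆ₙₐ[ℂ] (P.Target →L[ℂ] P.Target) :=
  tensorIdHom (b := b.op) P.βhat P.α hP.legAlg (fun _ ha => P.leg_le_intertwinerSpace ha) P.op
    P.adjoint_op_comp_op

theorem SemiRegular.comulHatHom_mem (hP : P.SemiRegular) (a : hP.hatAlg) :
    hP.comulHatHom a ∈ fiberProduct (b := b.op) P.βhat P.α hP.hatAlg hP.hatAlg := by
  have e : (hP.comulHatHom a)† = hP.comulHatHom (star a) := (map_star hP.comulHatHom a).symm
  refine ⟨fun ζ => ⟨hP.comulHat_sket1_mem a.2 ζ, ?_⟩, fun ξ => ⟨hP.comulHat_sket2_mem a.2 ξ, ?_⟩⟩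
  · rw [e]
    exact hP.comulHat_sket1_mem (star a).2 ζ
  · rw [e]
    exact hP.comulHat_sket2_mem (star a).2 ξ

theorem SemiRegular.comulHom_mem (hP : P.SemiRegular) (a : hP.legAlg) :
    hP.comulHom a ∈ fiberProduct P.α P.β hP.legAlg hP.legAlg := by
  have e : (hP.comulHom a)† = hP.comulHom (star a) := (map_star hP.comulHom a).symm
  refine ⟨fun ξ => ⟨hP.comul_tket1_mem a.2 ξ, ?_⟩, fun η => ⟨hP.comul_tket2_mem a.2 η, ?_⟩⟩
  · rw [e]
    exact hP.comul_tket1_mem (star a).2 ξ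
  · rw [e]
    exact hP.comul_tket2_mem (star a).2 η

end PseudoMultUnitary

end PMU

/-! ### Computing `φ ∗ Id` and `Id ∗ ψ` on a total family of intertwiners -/

section maps

variable {𝔎 : Type u} [NormedAddCommGroup 𝔎] [InnerProductSpace ℂ 𝔎] [CompleteSpace 𝔎]
  {b : CStarBase 𝔎}
  {H : Type v} [NormedAddCommGroup H] [InnerProductSpace ℂ H] [CompleteSpace H]
  {K : Type w} [NormedAddCommGroup K] [InnerProductSpace ℂ K] [CompleteSpace K]
  {L : Type x} [NormedAddCommGroup L] [InnerProductSpace ℂ L] [CompleteSpace L]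

/-- An operator that satisfies the defining property of `(φ ∗ Id)(x)` for a family of intertwiners
`S` with `[S β] = λ` is equal to `(φ ∗ Id)(x)`. -/
theorem mapLeft_eq (β : BaseModule b H) (lam : BaseModule b L) (γ : BaseModule b.op K)
    {A : NonUnitalStarSubalgebra ℂ (H →L[ℂ] H)} {B : NonUnitalStarSubalgebra ℂ (K →L[ℂ] K)}
    (φ : A →⋆ₙₐ[ℂ] (L →L[ℂ] L)) {ι : Type*} (S : ι → H →L[ℂ] L)
    (hS : ∀ i, S i ∈ intertwiners φ) (hS' : ∀ i, IsSemiMorphism β lam (S i))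
    (htot : lam.space ≤ cspan {T | ∃ i, ∃ ξ ∈ β.space, S i ∘L ξ = T})
    {x : RTP β γ →L[ℂ] RTP β γ} (hx : x ∈ fiberProduct β γ A B)
    {R : RTP lam γ →L[ℂ] RTP lam γ}
    (hR : ∀ i, R ∘L tensorId β lam γ (S i) = tensorId β lam γ (S i) ∘L x) :
    mapLeft β lam γ φ x = R := by
  have hφ : lam.space ≤ cspan {T : 𝔎 →L[ℂ] L | ∃ S ∈ intertwiners φ, IsSemiMorphism β lam S ∧
      ∃ ξ ∈ β.space, S ∘L ξ = T} := by
    refine htot.trans (cspan_mono ?_)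
    rintro _ ⟨i, ξ, hξ, rfl⟩
    exact ⟨S i, hS i, hS' i, ξ, hξ, rfl⟩
  refine eq_of_comp_eq (f := fun i => tensorId β lam γ (S i)) ?_ fun i => ?_
  · rw [← top_le_iff, ← tmul_total lam γ]
    refine cspan_le (isClosed_cspan _) ?_
    rintro _ ⟨⟨l, η⟩, ζ, rfl⟩
    have e : tmul lam γ l η ζ = ket2 lam γ η ((l : 𝔎 →L[ℂ] L) ζ) :=
      (DFunLike.congr_fun (ket2_comp lam γ l η) ζ).symm
    show tmul lam γ l η ζ ∈ _
    rw [e]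
    refine map_mem_of_mem_cspan ((ket2 lam γ η).comp (ContinuousLinearMap.apply ℂ L ζ))
      (isClosed_cspan _) ?_ (htot l.2)
    rintro _ ⟨i, ξ, hξ, rfl⟩
    exact mem_cspan ⟨i, ket2 β γ η (ξ ζ),
      DFunLike.congr_fun ((hS' i).isIntertwiner.tensorId_comp_ket2 γ η) (ξ ζ)⟩
  · rw [hR, mapLeft_comp_tensorId β lam γ φ hφ hx (hS i) (hS' i)]

/-- An operator that satisfies the defining property of `(Id ∗ ψ)(x)` for a family of intertwiners
`S` with `[S γ] = μ` is equal to `(Id ∗ ψ)(x)`. -/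
theorem mapRight_eq (β : BaseModule b H) (γ : BaseModule b.op K) (μ : BaseModule b.op L)
    {A : NonUnitalStarSubalgebra ℂ (H →L[ℂ] H)} {B : NonUnitalStarSubalgebra ℂ (K →L[ℂ] K)}
    (ψ : B →⋆ₙₐ[ℂ] (L →L[ℂ] L)) {ι : Type*} (S : ι → K →L[ℂ] L)
    (hS : ∀ i, S i ∈ intertwiners ψ) (hS' : ∀ i, IsSemiMorphism γ μ (S i))
    (htot : μ.space ≤ cspan {T | ∃ i, ∃ η ∈ γ.space, S i ∘L η = T})
    {x : RTP β γ →L[ℂ] RTP β γ} (hx : x ∈ fiberProduct β γ A B)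
    {R : RTP β μ →L[ℂ] RTP β μ}
    (hR : ∀ i, R ∘L idTensor β γ μ (S i) = idTensor β γ μ (S i) ∘L x) :
    mapRight β γ μ ψ x = R := by
  have hψ : μ.space ≤ cspan {T : 𝔎 →L[ℂ] L | ∃ S ∈ intertwiners ψ, IsSemiMorphism γ μ S ∧
      ∃ η ∈ γ.space, S ∘L η = T} := by
    refine htot.trans (cspan_mono ?_)
    rintro _ ⟨i, η, hη, rfl⟩
    exact ⟨S i, hS i, hS' i, η, hη, rfl⟩
  refine eq_of_comp_eq (f := fun i => idTensor β γ μ (S i)) ?_ fun i => ?_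
  · rw [← top_le_iff, ← tmul_total β μ]
    refine cspan_le (isClosed_cspan _) ?_
    rintro _ ⟨⟨ξ, l⟩, ζ, rfl⟩
    have e : tmul β μ ξ l ζ = ket1 β μ ξ ((l : 𝔎 →L[ℂ] L) ζ) :=
      (DFunLike.congr_fun (ket1_comp β μ ξ l) ζ).symm
    show tmul β μ ξ l ζ ∈ _
    rw [e]
    refine map_mem_of_mem_cspan ((ket1 β μ ξ).comp (ContinuousLinearMap.apply ℂ L ζ))
      (isClosed_cspan _) ?_ (htot l.2)
    rintro _ ⟨i, η, hη, rfl⟩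
    exact mem_cspan ⟨i, ket1 β γ ξ (η ζ),
      DFunLike.congr_fun ((hS' i).isIntertwiner.idTensor_comp_ket1 β ξ) (η ζ)⟩
  · rw [hR, mapRight_comp_idTensor β γ μ ψ hψ hx (hS i) (hS' i)]

end maps

section PMU

variable {𝔎 : Type u} [NormedAddCommGroup 𝔎] [InnerProductSpace ℂ 𝔎] [CompleteSpace 𝔎]
  {b : CStarBase 𝔎}
  {H : Type v} [NormedAddCommGroup H] [InnerProductSpace ℂ H] [CompleteSpace H]

namespace PseudoMultUnitary

/-! ### Joint normality -/

section normal

variable {P : PseudoMultUnitary b H}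

theorem SemiRegular.adjoint_op_comp_tket1_mem_intertwiners (hP : P.SemiRegular) (ξ : P.α.space) :
    P.op† ∘L P.tket1 ξ ∈ intertwiners hP.comulHatHom := by
  intro a
  have e := IsIntertwiner.idTensor_comp_ket1 P.α (P.legHat_le_intertwinerSpace a.2) ξ
  show (P.op† ∘L P.tket1 ξ) ∘L (a : H →L[ℂ] H) =
    (P.op† ∘L idTensor P.α P.β P.β a ∘L P.op) ∘L P.op† ∘L P.tket1 ξ
  rw [comp_assoc, comp_assoc, comp_assoc, ← comp_assoc P.op, P.op_comp_adjoint_op, id_comp, e]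

theorem SemiRegular.op_comp_sket2_mem_intertwiners (hP : P.SemiRegular) (ξ : P.α.space) :
    P.op ∘L P.sket2 ξ ∈ intertwiners hP.comulHom := by
  intro a
  have e := IsIntertwiner.tensorId_comp_ket2 (b := b.op) P.α (P.leg_le_intertwinerSpace a.2) ξ
  show (P.op ∘L P.sket2 ξ) ∘L (a : H →L[ℂ] H) =
    (P.op ∘L tensorId (b := b.op) P.βhat P.βhat P.α a ∘L P.op†) ∘L P.op ∘L P.sket2 ξ
  rw [comp_assoc, comp_assoc, comp_assoc, ← comp_assoc (P.op†), P.adjoint_op_comp_op, id_comp, e]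

variable (P)

theorem cspan_adjoint_op_comp_tket1_α :
    cspan {T | ∃ ξ : P.α.space, ∃ ζ ∈ P.α.space, (P.op† ∘L P.tket1 ξ) ∘L ζ = T} =
      P.srcα.space := by
  rw [← (P.intertwines.1.adjoint P.adjoint_op_comp_op).cspan_eq rfl]
  congr 1
  ext T
  constructor
  · rintro ⟨ξ, ζ, hζ, rfl⟩
    exact ⟨_, ⟨ξ, ζ, hζ, rfl⟩, rfl⟩
  · rintro ⟨_, ⟨ξ, ζ, hζ, rfl⟩, rfl⟩
    exact ⟨ξ, ζ, hζ, rfl⟩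

theorem cspan_adjoint_op_comp_tket1_βhat :
    cspan {T | ∃ ξ : P.α.space, ∃ ζ ∈ P.βhat.space, (P.op† ∘L P.tket1 ξ) ∘L ζ = T} =
      P.srcβhat.space := by
  rw [← (P.intertwines.2.2.1.adjoint P.adjoint_op_comp_op).cspan_eq rfl]
  congr 1
  ext T
  constructor
  · rintro ⟨ξ, ζ, hζ, rfl⟩
    exact ⟨_, ⟨ξ, ζ, hζ, rfl⟩, rfl⟩
  · rintro ⟨_, ⟨ξ, ζ, hζ, rfl⟩, rfl⟩
    exact ⟨ξ, ζ, hζ, rfl⟩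

theorem cspan_op_comp_sket2_α :
    cspan {T | ∃ y : P.α.space, ∃ ζ ∈ P.α.space, (P.op ∘L P.sket2 y) ∘L ζ = T} =
      P.tgtα.space := by
  rw [← P.intertwines.1.cspan_eq rfl]
  congr 1
  ext T
  constructor
  · rintro ⟨ξ, ζ, hζ, rfl⟩
    exact ⟨_, ⟨ξ, ζ, hζ, rfl⟩, rfl⟩
  · rintro ⟨_, ⟨ξ, ζ, hζ, rfl⟩, rfl⟩
    exact ⟨ξ, ζ, hζ, rfl⟩

theorem cspan_op_comp_sket2_β :
    cspan {T | ∃ y : P.α.space, ∃ ζ ∈ P.β.space, (P.op ∘L P.sket2 y) ∘L ζ = T} =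
      P.tgtβ.space := by
  rw [← P.intertwines.2.2.2.cspan_eq rfl]
  congr 1
  ext T
  constructor
  · rintro ⟨ξ, ζ, hζ, rfl⟩
    exact ⟨_, ⟨ξ, ζ, hζ, rfl⟩, rfl⟩
  · rintro ⟨_, ⟨ξ, ζ, hζ, rfl⟩, rfl⟩
    exact ⟨ξ, ζ, hζ, rfl⟩

end normal

/-! ### Coassociativity -/

section coassoc

variable (P : PseudoMultUnitary b H)

/-- The operator `V₁₂ V₁₃ V₂₃` of the pentagon equation, on `H ⊗ (H ⊗ H)`. -/
def pentagonOp : RTP (b := b.op) P.βhat P.srcα →L[ℂ] RTP P.α P.tgtβ :=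
  P.V12 ∘L P.V13 ∘L idTensor (b := b.op) P.βhat P.srcα P.tgtα P.op

theorem adjoint_pentagonOp_comp_pentagonOp :
    P.pentagonOp† ∘L P.pentagonOp = ContinuousLinearMap.id ℂ _ := by
  have hi := P.isMorphism_op_α.1.isIntertwiner
  have e := idTensor_comp_idTensor (b := b.op) P.βhat hi.adjoint hi
  rw [pentagonOp, adjoint_comp, adjoint_comp, comp_assoc, comp_assoc,
    ← comp_assoc (P.V12†), P.adjoint_V12_comp_V12, id_comp, ← comp_assoc (P.V13†),
    P.adjoint_V13_comp_V13, id_comp, idTensor_adjoint (b := b.op) P.βhat hi, e,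
    P.adjoint_op_comp_op, idTensor_id (b := b.op)]

theorem pentagonOp_comp_idTensor_sket2 (y : P.α.space) :
    P.pentagonOp ∘L idTensor (b := b.op) P.βhat P.α P.srcα (P.sket2 y) =
      idTensor P.α P.β P.tgtβ (P.op ∘L P.sket2 y) ∘L P.op := by
  have e := idTensor_comp_idTensor (b := b.op) P.βhat P.isMorphism_op_α.1.isIntertwiner
    (P.isMorphism_sket2 y).1.1.isIntertwiner
  rw [pentagonOp, comp_assoc, comp_assoc, e, P.idTensor_comp_op]

theorem pentagonOp_comp_idTensor_tket1 (y : P.α.space) :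
    P.pentagonOp ∘L idTensor (b := b.op) P.βhat P.α P.srcα (P.op† ∘L P.tket1 y) =
      assoc P.α P.β P.α P.β P.β_α P.α_β ∘L
        tensorId P.α P.tgtα P.β (P.op ∘L P.sket2 y) ∘L P.op := by
  have e := idTensor_comp_idTensor (b := b.op) P.βhat P.isMorphism_op_α.1.isIntertwiner
    (P.isMorphism_adjoint_op_comp_tket1 y).1.1.isIntertwiner
  have e2 : P.op ∘L P.op† ∘L P.tket1 y = P.tket1 y := by
    rw [← comp_assoc, P.op_comp_adjoint_op, id_comp]
  rw [pentagonOp, comp_assoc, comp_assoc, e, e2, P.V13_comp_idTensor, ← comp_assoc,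
    P.V12_comp_tensorId, comp_assoc]

theorem pentagonOp_comp_assoc_comp_tensorId (ξ : P.α.space) :
    (P.pentagonOp ∘L assoc (b := b.op) (d := b.op) P.βhat P.α P.βhat P.α P.α_βhat P.βhat_α) ∘L
        tensorId (b := b.op) P.βhat P.srcβhat P.α (P.op† ∘L P.tket1 ξ) =
      ket1 P.α P.tgtβ ξ ∘L P.op := by
  have e := tensorId_comp_tensorId (b := b.op) P.α P.isMorphism_op_βhat.1.isIntertwiner
    (P.isMorphism_adjoint_op_comp_tket1 ξ).2.1.isIntertwiner
  have e1 : P.op ∘L P.op† ∘L P.tket1 ξ = P.tket1 ξ := by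
    rw [← comp_assoc, P.op_comp_adjoint_op, id_comp]
  have e2 := assoc_comp_tensorId (d := b.op) P.α P.β P.βhat P.α P.β_βhat P.βhat_β ξ
  have e3 := P.isMorphism_op_β.1.isIntertwiner.idTensor_comp_ket1 P.α ξ
  rw [pentagonOp, comp_assoc P.V12, comp_assoc P.V13, ← P.pentagon_eq, comp_assoc, comp_assoc, e,
    e1, e2, e3]

variable {P}

theorem SemiRegular.op_comp_comulHatHom (hP : P.SemiRegular) (a : hP.hatAlg) :
    P.op ∘L hP.comulHatHom a = idTensor P.α P.β P.β (a : H →L[ℂ] H) ∘L P.op := by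
  show P.op ∘L P.op† ∘L idTensor P.α P.β P.β (a : H →L[ℂ] H) ∘L P.op = _
  rw [← comp_assoc, P.op_comp_adjoint_op, id_comp]

theorem SemiRegular.comulHom_comp_op (hP : P.SemiRegular) (a : hP.legAlg) :
    hP.comulHom a ∘L P.op = P.op ∘L tensorId (b := b.op) P.βhat P.βhat P.α (a : H →L[ℂ] H) := by
  show (P.op ∘L tensorId (b := b.op) P.βhat P.βhat P.α (a : H →L[ℂ] H) ∘L P.op†) ∘L P.op = _
  rw [comp_assoc, comp_assoc, P.adjoint_op_comp_op, comp_id]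

/-- Equality of operators can be tested after composition with the unitary `V`. -/
theorem eq_of_comp_op_eq {L : Type w} [NormedAddCommGroup L] [InnerProductSpace ℂ L]
    {R S : P.Target →L[ℂ] L} (h : R ∘L P.op = S ∘L P.op) : R = S := by
  rw [← comp_id R, ← comp_id S, ← P.op_comp_adjoint_op, ← comp_assoc, ← comp_assoc, h]

/-- `(Id ∗ Δ̂_V)(Δ̂_V(a))` is `Id ⊗ Id ⊗ a`, conjugated with `V₁₂ V₁₃ V₂₃`. -/
theorem SemiRegular.mapRight_comulHatHom (hP : P.SemiRegular) (a : hP.hatAlg) :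
    mapRight (b := b.op) P.βhat P.α P.srcα hP.comulHatHom (hP.comulHatHom a) =
      P.pentagonOp† ∘L idTensor P.α P.tgtβ P.tgtβ (idTensor P.α P.β P.β (a : H →L[ℂ] H)) ∘L
        P.pentagonOp := by
  have ha : IsIntertwiner P.β P.β (a : H →L[ℂ] H) := P.legHat_le_intertwinerSpace a.2
  have ha2 := IsIntertwiner.idTensor_ltri P.β P.α P.β P.α_β P.β_α ha
  refine mapRight_eq (b := b.op) P.βhat P.α P.srcα hP.comulHatHom
    (fun ξ : P.α.space => P.op† ∘L P.tket1 ξ) hP.adjoint_op_comp_tket1_mem_intertwiners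
    (fun ξ => (P.isMorphism_adjoint_op_comp_tket1 ξ).1.1)
    P.cspan_adjoint_op_comp_tket1_α.ge (hP.comulHatHom_mem a) fun ξ => ?_
  have e1 := P.pentagonOp_comp_idTensor_tket1 ξ
  have e2 := assoc_comp_idTensor P.α P.β P.α P.β P.β_α P.α_β ha ha2
  have e3 := tensorId_comp_idTensor (P.isMorphism_op_comp_sket2 ξ).1.1 ha
  have e4 : idTensor P.α P.tgtβ P.tgtβ (idTensor P.α P.β P.β (a : H →L[ℂ] H)) ∘L
      P.pentagonOp ∘L idTensor (b := b.op) P.βhat P.α P.srcα (P.op† ∘L P.tket1 ξ) =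
      P.pentagonOp ∘L idTensor (b := b.op) P.βhat P.α P.srcα (P.op† ∘L P.tket1 ξ) ∘L
        hP.comulHatHom a := by
    rw [e1, ← comp_assoc (idTensor _ _ _ _), ← e2, comp_assoc (assoc _ _ _ _ _ _),
      ← comp_assoc (idTensor _ _ _ _), ← e3, comp_assoc (tensorId _ _ _ _),
      ← hP.op_comp_comulHatHom, ← comp_assoc (tensorId _ _ _ _),
      ← comp_assoc (assoc _ _ _ _ _ _), ← e1, comp_assoc]
  rw [comp_assoc, comp_assoc, e4, ← comp_assoc (P.pentagonOp†),
    P.adjoint_pentagonOp_comp_pentagonOp, id_comp]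

/-- `(Δ̂_V ∗ Id)(Δ̂_V(a))` is `Id ⊗ Id ⊗ a`, conjugated with `V₁₂ V₁₃ V₂₃` and the associativity
isomorphism. -/
theorem SemiRegular.mapLeft_comulHatHom (hP : P.SemiRegular) (a : hP.hatAlg) :
    mapLeft (b := b.op) P.βhat P.srcβhat P.α hP.comulHatHom (hP.comulHatHom a) =
      (assoc (b := b.op) (d := b.op) P.βhat P.α P.βhat P.α P.α_βhat P.βhat_α)† ∘L
        P.pentagonOp† ∘L idTensor P.α P.tgtβ P.tgtβ (idTensor P.α P.β P.β (a : H →L[ℂ] H)) ∘L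
        P.pentagonOp ∘L
        assoc (b := b.op) (d := b.op) P.βhat P.α P.βhat P.α P.α_βhat P.βhat_α := by
  have ha : IsIntertwiner P.β P.β (a : H →L[ℂ] H) := P.legHat_le_intertwinerSpace a.2
  have ha2 := IsIntertwiner.idTensor_ltri P.β P.α P.β P.α_β P.β_α ha
  refine mapLeft_eq (b := b.op) P.βhat P.srcβhat P.α hP.comulHatHom
    (fun ξ : P.α.space => P.op† ∘L P.tket1 ξ) hP.adjoint_op_comp_tket1_mem_intertwiners
    (fun ξ => (P.isMorphism_adjoint_op_comp_tket1 ξ).2.1)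
    P.cspan_adjoint_op_comp_tket1_βhat.ge (hP.comulHatHom_mem a) fun ξ => ?_
  have e0 := assoc_adjoint_comp_assoc (b := b.op) (d := b.op) P.βhat P.α P.βhat P.α P.α_βhat
    P.βhat_α
  have e1 := P.pentagonOp_comp_assoc_comp_tensorId ξ
  have e2 := ha2.idTensor_comp_ket1 P.α ξ
  rw [comp_assoc] at e1
  rw [comp_assoc, comp_assoc, comp_assoc, comp_assoc, e1, ← comp_assoc (idTensor _ _ _ _), e2,
    comp_assoc (ket1 _ _ _), ← hP.op_comp_comulHatHom, ← comp_assoc (ket1 _ _ _), ← e1,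
    comp_assoc, ← comp_assoc (P.pentagonOp†), P.adjoint_pentagonOp_comp_pentagonOp, id_comp,
    comp_assoc, ← comp_assoc ((assoc _ _ _ _ _ _)†), e0, id_comp]

theorem SemiRegular.coassoc_comulHatHom (hP : P.SemiRegular) (a : hP.hatAlg) :
    assoc (b := b.op) (d := b.op) P.βhat P.α P.βhat P.α P.α_βhat P.βhat_α ∘L
        mapLeft (b := b.op) P.βhat P.srcβhat P.α hP.comulHatHom (hP.comulHatHom a) =
      mapRight (b := b.op) P.βhat P.α P.srcα hP.comulHatHom (hP.comulHatHom a) ∘L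
        assoc (b := b.op) (d := b.op) P.βhat P.α P.βhat P.α P.α_βhat P.βhat_α := by
  have e := assoc_comp_assocSymm (b := b.op) (d := b.op) P.βhat P.α P.βhat P.α P.α_βhat P.βhat_α
  rw [← assoc_adjoint] at e
  rw [hP.mapLeft_comulHatHom, hP.mapRight_comulHatHom, ← comp_assoc (assoc _ _ _ _ _ _), e,
    id_comp, comp_assoc, comp_assoc]

/-- `(Id ∗ Δ_V)(Δ_V(a))` is `a ⊗ Id ⊗ Id`, conjugated with `V₁₂ V₁₃ V₂₃`. -/
theorem SemiRegular.mapRight_comulHom (hP : P.SemiRegular) (a : hP.legAlg) :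
    mapRight P.α P.β P.tgtβ hP.comulHom (hP.comulHom a) =
      P.pentagonOp ∘L tensorId (b := b.op) P.βhat P.βhat P.srcα (a : H →L[ℂ] H) ∘L
        P.pentagonOp† := by
  have ha : IsIntertwiner P.βhat P.βhat (a : H →L[ℂ] H) := P.leg_le_intertwinerSpace a.2
  refine mapRight_eq P.α P.β P.tgtβ hP.comulHom
    (fun ξ : P.α.space => P.op ∘L P.sket2 ξ) hP.op_comp_sket2_mem_intertwiners
    (fun ξ => (P.isMorphism_op_comp_sket2 ξ).2.1)
    P.cspan_op_comp_sket2_β.ge (hP.comulHom_mem a) fun y => P.eq_of_comp_op_eq ?_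
  have e1 := P.pentagonOp_comp_idTensor_sket2 y
  have e2 := tensorId_comp_idTensor' (b := b.op) ha (P.isMorphism_sket2 y).1.1
  rw [comp_assoc, comp_assoc, comp_assoc, comp_assoc, hP.comulHom_comp_op,
    ← comp_assoc _ P.op, ← e1, ← comp_assoc (P.pentagonOp†),
    P.adjoint_pentagonOp_comp_pentagonOp, id_comp, e2, comp_assoc]

/-- `(Δ_V ∗ Id)(Δ_V(a))` is `a ⊗ Id ⊗ Id`, conjugated with `V₁₂ V₁₃ V₂₃` and the associativity
isomorphism. -/
theorem SemiRegular.mapLeft_comulHom (hP : P.SemiRegular) (a : hP.legAlg) :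
    mapLeft P.α P.tgtα P.β hP.comulHom (hP.comulHom a) =
      (assoc P.α P.β P.α P.β P.β_α P.α_β)† ∘L P.pentagonOp ∘L
        tensorId (b := b.op) P.βhat P.βhat P.srcα (a : H →L[ℂ] H) ∘L
        P.pentagonOp† ∘L assoc P.α P.β P.α P.β P.β_α P.α_β := by
  have ha : IsIntertwiner P.βhat P.βhat (a : H →L[ℂ] H) := P.leg_le_intertwinerSpace a.2
  refine mapLeft_eq P.α P.tgtα P.β hP.comulHom
    (fun ξ : P.α.space => P.op ∘L P.sket2 ξ) hP.op_comp_sket2_mem_intertwiners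
    (fun ξ => (P.isMorphism_op_comp_sket2 ξ).1.1)
    P.cspan_op_comp_sket2_α.ge (hP.comulHom_mem a) fun y => P.eq_of_comp_op_eq ?_
  have e0 := assoc_adjoint_comp_assoc P.α P.β P.α P.β P.β_α P.α_β
  have e1 := P.pentagonOp_comp_idTensor_tket1 y
  have e2 := tensorId_comp_idTensor' (b := b.op) ha (P.isMorphism_adjoint_op_comp_tket1 y).1.1
  rw [comp_assoc, comp_assoc, comp_assoc, comp_assoc, comp_assoc, comp_assoc,
    hP.comulHom_comp_op, ← e1, ← comp_assoc (P.pentagonOp†),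
    P.adjoint_pentagonOp_comp_pentagonOp, id_comp, e2, ← comp_assoc P.pentagonOp, e1, comp_assoc,
    ← comp_assoc ((assoc _ _ _ _ _ _)†), e0, id_comp, comp_assoc]

theorem SemiRegular.coassoc_comulHom (hP : P.SemiRegular) (a : hP.legAlg) :
    assoc P.α P.β P.α P.β P.β_α P.α_β ∘L
        mapLeft P.α P.tgtα P.β hP.comulHom (hP.comulHom a) =
      mapRight P.α P.β P.tgtβ hP.comulHom (hP.comulHom a) ∘L
        assoc P.α P.β P.α P.β P.β_α P.α_β := by
  have e := assoc_comp_assocSymm P.α P.β P.α P.β P.β_α P.α_β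
  rw [← assoc_adjoint] at e
  rw [hP.mapLeft_comulHom, hP.mapRight_comulHom, ← comp_assoc (assoc _ _ _ _ _ _), e, id_comp,
    comp_assoc, comp_assoc]

end coassoc

/-! ### The Hopf `C*`-bimodules of `V` -/

section hopf

variable {P : PseudoMultUnitary b H}

/-- The normal Hopf `C*`-bimodule `(Â_V, Δ̂_V)` over `𝔟†`. -/
def SemiRegular.hopfHat (hP : P.SemiRegular) :
    NormalHopfBimodule b.op (H := H) P.α P.βhat P.α_βhat P.βhat_α where
  alg := hP.hatAlg
  isClosed_alg := isClosed_cspan _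
  rho_mul_mem_left _ hc _ ha := hP.rho_α_comp_mem_legHat hc ha
  rho_mul_mem_right _ hc _ ha := P.rho_βhat_comp_mem_legHat hc ha
  comul := hP.comulHatHom
  comul_mem := hP.comulHatHom_mem
  normal_left := by
    refine le_antisymm (cspan_le (isClosed_cspan _) ?_)
      (P.cspan_adjoint_op_comp_tket1_α.ge.trans (cspan_mono ?_))
    · rintro _ ⟨S, -, hS, -, ξ, hξ, rfl⟩
      exact hS.1 ξ hξ
    · rintro _ ⟨ξ, ζ, hζ, rfl⟩
      exact ⟨_, hP.adjoint_op_comp_tket1_mem_intertwiners ξ,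
        (P.isMorphism_adjoint_op_comp_tket1 ξ).1, (P.isMorphism_adjoint_op_comp_tket1 ξ).2,
        ζ, hζ, rfl⟩
  normal_right := by
    refine le_antisymm (cspan_le (isClosed_cspan _) ?_)
      (P.cspan_adjoint_op_comp_tket1_βhat.ge.trans (cspan_mono ?_))
    · rintro _ ⟨S, -, -, hS, ξ, hξ, rfl⟩
      exact hS.1 ξ hξ
    · rintro _ ⟨ξ, ζ, hζ, rfl⟩
      exact ⟨_, hP.adjoint_op_comp_tket1_mem_intertwiners ξ,
        (P.isMorphism_adjoint_op_comp_tket1 ξ).1, (P.isMorphism_adjoint_op_comp_tket1 ξ).2,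
        ζ, hζ, rfl⟩
  coassoc := hP.coassoc_comulHatHom

/-- The normal Hopf `C*`-bimodule `(A_V, Δ_V)` over `𝔟`. -/
def SemiRegular.hopf (hP : P.SemiRegular) :
    NormalHopfBimodule b P.β P.α P.β_α P.α_β where
  alg := hP.legAlg
  isClosed_alg := isClosed_cspan _
  rho_mul_mem_left _ hc _ ha := hP.rho_β_comp_mem_leg hc ha
  rho_mul_mem_right _ hc _ ha := P.rho_α_comp_mem_leg hc ha
  comul := hP.comulHom
  comul_mem := hP.comulHom_mem
  normal_left := by
    refine le_antisymm (cspan_le (isClosed_cspan _) ?_)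
      (P.cspan_op_comp_sket2_β.ge.trans (cspan_mono ?_))
    · rintro _ ⟨S, -, hS, -, ξ, hξ, rfl⟩
      exact hS.1 ξ hξ
    · rintro _ ⟨ξ, ζ, hζ, rfl⟩
      exact ⟨_, hP.op_comp_sket2_mem_intertwiners ξ,
        (P.isMorphism_op_comp_sket2 ξ).2, (P.isMorphism_op_comp_sket2 ξ).1, ζ, hζ, rfl⟩
  normal_right := by
    refine le_antisymm (cspan_le (isClosed_cspan _) ?_)
      (P.cspan_op_comp_sket2_α.ge.trans (cspan_mono ?_))
    · rintro _ ⟨S, -, -, hS, ξ, hξ, rfl⟩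
      exact hS.1 ξ hξ
    · rintro _ ⟨ξ, ζ, hζ, rfl⟩
      exact ⟨_, hP.op_comp_sket2_mem_intertwiners ξ,
        (P.isMorphism_op_comp_sket2 ξ).2, (P.isMorphism_op_comp_sket2 ξ).1, ζ, hζ, rfl⟩
  coassoc := hP.coassoc_comulHom

theorem legHat_le_centralizer : (P.legHat : Set (H →L[ℂ] H)) ⊆
    Set.centralizer (P.β.rho '' (b.alg : Set (𝔎 →L[ℂ] 𝔎))) := by
  rintro a ha _ ⟨c, hc, rfl⟩
  exact (P.legHat_le_intertwinerSpace ha c hc).symm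

theorem leg_le_centralizer : (P.leg : Set (H →L[ℂ] H)) ⊆
    Set.centralizer (P.βhat.rho '' (b.alg : Set (𝔎 →L[ℂ] 𝔎))) := by
  rintro a ha _ ⟨c, hc, rfl⟩
  exact (P.leg_le_intertwinerSpace ha c hc).symm

end hopf

end PseudoMultUnitary

end PMU

end

end CStarPMU

theorem mainTheorem1 {𝔎 : Type*} [NormedAddCommGroup 𝔎] [InnerProductSpace ℂ 𝔎] [CompleteSpace 𝔎]
    (b : CStarPMU.CStarBase 𝔎) {H : Type*} [NormedAddCommGroup H] [InnerProductSpace ℂ H]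
    [CompleteSpace H] (P : CStarPMU.PseudoMultUnitary b H) (hP : P.SemiRegular) :
    (∃ A : CStarPMU.NormalHopfBimodule b.op (H := H) P.α P.βhat P.α_βhat P.βhat_α,
      (A.alg : Set (H →L[ℂ] H)) = P.legHat ∧
      ∀ a : A.alg, ∃ ha, A.comul a = P.comulHat ⟨a, ha⟩) ∧
    ∃ A : CStarPMU.NormalHopfBimodule b P.β P.α P.β_α P.α_β,
      (A.alg : Set (H →L[ℂ] H)) = P.leg ∧
      ∀ a : A.alg, ∃ ha, A.comul a = P.comul ⟨a, ha⟩ :=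
  ⟨⟨hP.hopfHat, rfl, fun a => ⟨P.legHat_le_centralizer a.2, rfl⟩⟩,
    ⟨hP.hopf, rfl, fun a => ⟨P.leg_le_centralizer a.2, rfl⟩⟩⟩
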